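/- Let $k$ be an algebraically closed field (of any characteristic) and let $X$ be a normal projective variety over $k$ (an integral closed subscheme of some $\mathbb P^N_k$ whose local rings are integrally closed), of dimension $n$. Let $\Delta$ be an $\mathbb R$-divisor on $X$ with coefficients in $[0,1]$ such that $K_X+\Delta$ is $\mathbb R$-Cartier (that is, $(X,\Delta)$ is a log pair), and let $D$ be an $\mathbb R$-Cartier $\mathbb R$-divisor on $X$ such that $$\operatorname{vol}_X(D):=\limsup_{m\to\infty}\frac{n!\,\dim_k H^0(X,\mathcal O_X(\lfloor mD\rfloor))}{m^n}>n^n .$$ Then for every closed point $x\in X$ at which $X$ is smooth over $k$ there is an effective $\mathbb R$-Cartier $\mathbb R$-divisor $\Pi\sim_{\mathbb R}D$ such that $x\in\operatorname{Supp}\Pi$ and the pair $(X,\Delta+\Pi)$ is not klt at $x$, i.e. there are a normal variety $Y$, a birational morphism $f:Y\to X$ over $k$ and a prime divisor $E\subset Y$ such that $x$ lies in the center $\overline{f(E)}$ of $E$ and the discrepancy $a(E,X,\Delta+\Pi)$, the coefficient of $E$ in $K_Y-f^*(K_X+\Delta+\Pi)$ (where $K_X$ and $K_Y$ are the divisors of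 a nonzero rational $n$-form on $X$ and of its pullback to $Y$), is at most $-1$. -/

import Mathlib

open AlgebraicGeometry CategoryTheory

universe u

noncomputable section

namespace BirGeom

/-- A variety over a field `k`: an integral separated scheme of finite type over `k`. -/
structure Variety (k : Type u) [Field k] where
  X : Scheme.{u}
  str : X ⟶ Spec (CommRingCat.of k)
  isIntegral : IsIntegral X
  isSeparated : IsSeparated str
  locallyOfFiniteType : LocallyOfFiniteType str
  quasiCompact : QuasiCompact str

namespace Variety

variable {k : Type u} [Field k] (V : Variety k)

instance instIsIntegral : IsIntegral V.X := V.isIntegral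

instance instIsLocallyNoetherian : IsLocallyNoetherian V.X :=
  haveI := V.locallyOfFiniteType
  LocallyOfFiniteType.isLocallyNoetherian V.str

/-- The ring homomorphism from `k` to the global functions. -/
def constants : k →+* Γ(V.X, ⊤) :=
  ((Scheme.ΓSpecIso (CommRingCat.of k)).inv ≫ V.str.appTop).hom

/-- All local rings are `k`-algebras; this includes the function field, which is the local ring
at the generic point. -/
instance instAlgebraStalk (x : V.X) : Algebra k (V.X.presheaf.stalk x) :=
  ((V.X.presheaf.germ ⊤ x trivial).hom.comp V.constants).toAlgebra

/-- The function field. -/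
abbrev K : Type u := V.X.functionField

/-- A variety is normal if all its local rings are integrally closed domains. -/
class IsNormal : Prop where
  isIntegrallyClosed (x : V.X) : IsIntegrallyClosed (V.X.presheaf.stalk x)

attribute [local instance] MvPolynomial.gradedAlgebra in
/-- Projective space `ℙ^N` over `k`. -/
def projectiveSpace (k : Type u) [Field k] (N : ℕ) : Scheme.{u} :=
  Proj (MvPolynomial.homogeneousSubmodule (Fin (N + 1)) k)

attribute [local instance] MvPolynomial.gradedAlgebra in
/-- The structure morphism of `ℙ^N` over `k`. -/
def projectiveSpaceStr (k : Type u) [Field k] (N : ℕ) :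
    projectiveSpace k N ⟶ Spec (CommRingCat.of k) :=
  Proj.toSpecZero (MvPolynomial.homogeneousSubmodule (Fin (N + 1)) k) ≫
    Spec.map (CommRingCat.ofHom
      (algebraMap k (MvPolynomial.homogeneousSubmodule (Fin (N + 1)) k 0)))

/-- A variety is projective if it is a closed subscheme of some `ℙ^N`, over `k`. -/
def IsProjective : Prop :=
  ∃ (N : ℕ) (i : V.X ⟶ projectiveSpace k N),
    IsClosedImmersion i ∧ i ≫ projectiveSpaceStr k N = V.str

/-- `V` is smooth over `k` at `x`. -/
def IsSmoothAt (x : V.X) : Prop :=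
  ∃ U : V.X.Opens, x ∈ U ∧ Smooth (U.ι ≫ V.str)

/-- Prime divisors, given by their generic points: the points of codimension one.
(In Mathlib's order on the points of a scheme the generic point is the largest.) -/
abbrev PrimeDivisor : Type u := {P : V.X // Order.coheight P = 1}

/-- Weil `ℝ`-divisors. -/
abbrev RDiv : Type u := V.PrimeDivisor →₀ ℝ

/-- The order of vanishing of a rational function along a prime divisor. -/
def ord (f : V.K) (P : V.PrimeDivisor) : ℤ := V.X.ord f P.1

/-- `D` is the divisor of a nonzero rational function. -/
def IsPrincipal (D : V.RDiv) : Prop :=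
  ∃ f : V.K, f ≠ 0 ∧ ∀ P, D P = (V.ord f P : ℝ)

/-- `D` is a Cartier divisor: near every point it is the divisor of a rational function.
(Such a `D` has integral coefficients.) -/
def IsCartier (D : V.RDiv) : Prop :=
  ∀ x : V.X, ∃ U : V.X.Opens, x ∈ U ∧ ∃ f : V.K, f ≠ 0 ∧
    ∀ P : V.PrimeDivisor, P.1 ∈ U → D P = (V.ord f P : ℝ)

/-- `D` is `ℝ`-Cartier: an `ℝ`-linear combination of Cartier divisors. -/
def IsRCartier (D : V.RDiv) : Prop :=
  D ∈ Submodule.span ℝ {C : V.RDiv | V.IsCartier C}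

/-- `ℝ`-linear equivalence: the difference is an `ℝ`-linear combination of principal divisors. -/
def RLinEquiv (D D' : V.RDiv) : Prop :=
  D - D' ∈ Submodule.span ℝ {C : V.RDiv | V.IsPrincipal C}

/-- The point `x` lies in the support of `D`. -/
def PassesThrough (D : V.RDiv) (x : V.X) : Prop :=
  ∃ P : V.PrimeDivisor, D P ≠ 0 ∧ x ∈ closure {P.1}

/-! ### Sections and volume -/

theorem isDiscreteValuationRing_stalk [V.IsNormal] (P : V.PrimeDivisor) :
    IsDiscreteValuationRing (V.X.presheaf.stalk P.1) := by
  have hdim : ringKrullDim (V.X.presheaf.stalk P.1) = 1 := by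
    rw [ringKrullDim_stalk_eq_coheight, P.2]; rfl
  have hF : ¬ IsField (V.X.presheaf.stalk P.1) := by
    intro h
    have := ringKrullDim_eq_zero_of_isField h
    rw [hdim] at this
    exact one_ne_zero this
  have hle : Ring.KrullDimLE 1 (V.X.presheaf.stalk P.1) := krullDimLE_of_coheight_le P.2.le
  have hic := IsNormal.isIntegrallyClosed P.1
  have hmax : IsLocalRing.maximalIdeal (V.X.presheaf.stalk P.1) ≠ ⊥ :=
    fun h => hF (IsLocalRing.isField_iff_maximalIdeal_eq.mpr h)
  have h4 : IsIntegrallyClosed (V.X.presheaf.stalk P.1) ∧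
      ∃! Q : Ideal (V.X.presheaf.stalk P.1), Q ≠ ⊥ ∧ Q.IsPrime := by
    refine ⟨hic, IsLocalRing.maximalIdeal _, ⟨hmax, inferInstance⟩, ?_⟩
    rintro Q ⟨hQ, hQp⟩
    exact IsLocalRing.eq_maximalIdeal (Ring.krullDimLE_one_iff_of_isPrime_bot.mp hle Q hQ hQp)
  exact ((IsDiscreteValuationRing.TFAE _ hF).out 0 3).mpr h4

theorem ord_le_ord_smul {c : k} (hc : c ≠ 0) (f : V.K) (P : V.PrimeDivisor) :
    V.ord f P ≤ V.ord (c • f) P := by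
  have : Nonempty (⊤ : V.X.Opens) := ⟨⟨P.1, trivial⟩⟩
  have hc' : V.constants c ≠ 0 := by
    rwa [ne_eq, map_eq_zero]
  have h := Scheme.ord_le_smul (X := V.X) (x := P.1) (U := ⊤) trivial hc' f
  rw [Algebra.smul_def] at h
  rw [Algebra.smul_def]
  exact h

/-- The space `H⁰(V, 𝒪_V(⌊D⌋))` of all rational functions `f` with `f = 0` or
`div f + ⌊D⌋ ≥ 0`, on a normal variety. -/
def sections [V.IsNormal] (D : V.RDiv) : Submodule k V.K where
  carrier := {f | f = 0 ∨ ∀ P, 0 ≤ V.ord f P + ⌊D P⌋}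
  zero_mem' := Or.inl rfl
  add_mem' := by
    rintro f g (rfl | hf) (rfl | hg)
    · left; simp
    · right; simpa using hg
    · right; simpa using hf
    · by_cases h : f + g = 0
      · exact Or.inl h
      · right
        intro P
        have := V.isDiscreteValuationRing_stalk P
        have h1 := Scheme.ord_add (x := P.1) h
        have h2 := hf P
        have h3 := hg P
        simp only [ord] at h2 h3 ⊢
        rcases min_le_iff.mp h1 with h4 | h4 <;> linarith
  smul_mem' := by
    rintro c f (rfl | hf)
    · left; simp
    · by_cases hc : c = 0
      · left; simp [hc]
      right
      intro P
      have h1 := V.ord_le_ord_smul hc f P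
      have h2 := hf P
      linarith

/-- The volume of `D` on a variety of dimension `n`:
the upper limit of `n! h⁰(⌊mD⌋) / m^n` as `m → ∞`. -/
def vol [V.IsNormal] (n : ℕ) (D : V.RDiv) : EReal :=
  Filter.limsup (fun m : ℕ =>
    (((n.factorial : ℝ) * (Module.finrank k (V.sections ((m : ℝ) • D)) : ℝ) / (m : ℝ) ^ n : ℝ) :
      EReal)) Filter.atTop

/-! ### Canonical divisors -/

/-- `ds₁ ∧ ⋯ ∧ dsₙ` as a rational `n`-form. -/
def wedge {n : ℕ} (s : Fin n → V.K) : ⋀[V.K]^n (Ω[V.K⁄k]) :=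
  exteriorPower.ιMulti V.K n (fun i => KaehlerDifferential.D k V.K (s i))

/-- A nonzero rational `n`-form, written as `g dt₁ ∧ ⋯ ∧ dtₙ`. For `n = dim V` every nonzero
rational `n`-form can be so written, since the top exterior power is one-dimensional and the
differentials of functions span. -/
structure RationalForm (n : ℕ) where
  g : V.K
  t : Fin n → V.K
  ne_zero : g • V.wedge t ≠ 0

/-- The rational `n`-form `g dt₁ ∧ ⋯ ∧ dtₙ` has order `m` along the prime divisor `P`: it equals
`h ds₁ ∧ ⋯ ∧ dsₙ`, where `m = ord_P h` and `ds₁, …, dsₙ` is a basis of the module of differentials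
of the local ring at `P`. -/
def HasFormOrd {n : ℕ} (g : V.K) (t : Fin n → V.K) (P : V.PrimeDivisor) (m : ℤ) : Prop :=
  ∃ (s : Fin n → V.X.presheaf.stalk P.1) (h : V.K),
    LinearIndependent (V.X.presheaf.stalk P.1)
      (fun i => KaehlerDifferential.D k (V.X.presheaf.stalk P.1) (s i)) ∧
    Submodule.span (V.X.presheaf.stalk P.1)
      (Set.range fun i => KaehlerDifferential.D k (V.X.presheaf.stalk P.1) (s i)) = ⊤ ∧
    h ≠ 0 ∧
    g • V.wedge t = h • V.wedge (fun i => algebraMap (V.X.presheaf.stalk P.1) V.K (s i)) ∧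
    V.ord h P = m

/-- `C` is the divisor of the rational form `ω`. -/
def IsDivOfForm {n : ℕ} (ω : V.RationalForm n) (C : V.RDiv) : Prop :=
  ∀ P, ∃ m : ℤ, V.HasFormOrd ω.g ω.t P m ∧ C P = (m : ℝ)

/-- `(V, Δ)` is a log pair, where `dim V = n`: the coefficients of `Δ` lie in `[0, 1]` and
`K_V + Δ` is `ℝ`-Cartier. (The choice of the canonical divisor is immaterial, as any two differ by
a principal divisor.) -/
def IsLogPair (n : ℕ) (Δ : V.RDiv) : Prop :=
  (∀ P, 0 ≤ Δ P ∧ Δ P ≤ 1) ∧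
    ∃ (ω : V.RationalForm n) (C : V.RDiv), V.IsDivOfForm ω C ∧ V.IsRCartier (C + Δ)

/-! ### Discrepancies and klt singularities -/

/-- A prime divisor `E` over `V`: a prime divisor on a normal variety `Y` with a (not necessarily
proper) birational morphism `f : Y ⟶ V` over `k`. A morphism is birational if it sends the generic
point to the generic point and induces an isomorphism of the local rings there. -/
structure DivisorOver where
  Y : Variety k
  isNormal : Y.IsNormal
  f : Y.X ⟶ V.X
  comp_str : f ≫ V.str = Y.str
  map_genericPoint : f (genericPoint Y.X) = genericPoint V.X
  bijective : Function.Bijective (f.stalkMap (genericPoint Y.X)).hom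
  E : Y.PrimeDivisor

namespace DivisorOver

variable {V} (B : V.DivisorOver)

/-- The generic point of the center of `E` on `V`. -/
def centerPoint : V.X := B.f B.E.1

/-- Pullback of rational functions. -/
def pullback : V.K →+* B.Y.K :=
  (V.X.presheaf.stalkSpecializes (specializes_of_eq B.map_genericPoint) ≫
    B.f.stalkMap (genericPoint B.Y.X)).hom

/-- The coefficient of `E` in `f^* D` is `c`: near the center of `E` one has
`D = ∑ rᵢ div(hᵢ)` with real numbers `rᵢ`, and `c = ∑ rᵢ ord_E(f^* hᵢ)`. -/
def HasPullbackCoeff (D : V.RDiv) (c : ℝ) : Prop :=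
  ∃ (U : V.X.Opens) (N : ℕ) (r : Fin N → ℝ) (h : Fin N → V.K),
    B.centerPoint ∈ U ∧ (∀ i, h i ≠ 0) ∧
    (∀ P : V.PrimeDivisor, P.1 ∈ U → D P = ∑ i, r i * (V.ord (h i) P : ℝ)) ∧
    c = ∑ i, r i * (B.Y.ord (B.pullback (h i)) B.E : ℝ)

/-- `a` is the discrepancy `a(E, V, Δ)`, i.e. the coefficient of `E` in `K_Y - f^*(K_V + Δ)`, where
`K_V = div ω` and `K_Y = div f^*ω` for a nonzero rational form `ω` of degree `n = dim V`. -/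
def HasDiscrepancy (n : ℕ) (Δ : V.RDiv) (a : ℝ) : Prop :=
  ∃ (ω : V.RationalForm n) (C : V.RDiv) (m : ℤ) (c : ℝ),
    V.IsDivOfForm ω C ∧
    B.Y.HasFormOrd (B.pullback ω.g) (fun i => B.pullback (ω.t i)) B.E m ∧
    B.HasPullbackCoeff (C + Δ) c ∧
    a = m - c

end DivisorOver

/-- `(V, Δ)`, with `dim V = n` and `K_V + Δ` an `ℝ`-Cartier divisor, is klt at `x`: every prime
divisor `E` over `V` whose center contains `x` has discrepancy greater than `-1`. -/
def IsKltAt (n : ℕ) (Δ : V.RDiv) (x : V.X) : Prop :=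
  ∀ (B : V.DivisorOver) (a : ℝ), x ∈ closure {B.centerPoint} → B.HasDiscrepancy n Δ a → -1 < a

end Variety

end BirGeom

end

open BirGeom

noncomputable section

namespace BirGeom

/-! ### Auxiliary algebra -/

/-! Let `E` be the exceptional divisor of the blow-up of the smooth point `x`. A function regular at
`x` vanishes there to order at least `r + 1` once at most `(n + r).choose n` linear conditions hold,
a number close to `r ^ n / n!`. As the volume of `D` exceeds `n ^ n`, for a suitable large `M` the
space of sections of `⌊M D⌋` has dimension greater than this number for `r = M * n + W`, where the
constant `W` pays for rounding real coefficients. So there is a section `f` for which the effective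
divisor `Θ = D + M⁻¹ div f` has coefficient at least `n` along `E` after pullback
(`exists_section_of_lt_vol`). The canonical divisor contributes only `n - 1` along `E`, and the
effective `Δ` can only lower the discrepancy (`IsDivOfForm.exists_hasFormOrd_blowup`). Hence the
discrepancy of `E` is at most `(n - 1) - n = -1`. Since the pullback of `Θ` is positive along `E`,
its support contains `x`.

Most of the work produces `E`. A divisor over `X` may live on a non-proper model, so one normal
affine chart suffices. Formal smoothness makes the graded ring of the local ring at `x` a polynomial
ring (`eq_zero_of_aeval_mem_pow`), so the order of vanishing at `x` is a valuation `v`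
(`exists_valuation_le_exp_iff`). The chart (`exists_chart`) is a localization of the integral
closure of `k[t_1/t_0, …, t_d/t_0][t_0]` in the function field, which is finite separable over the
fractions of that ring in every characteristic because the `dt_i` generate the differentials. The
identity `dt_0 ∧ … ∧ dt_d = t_0 ^ d • dt_0 ∧ d(t_1/t_0) ∧ … ∧ d(t_d/t_0)` gives the canonical
coefficient `d = n - 1`.

Pullbacks of real divisors are handled through positivity (`HasPullbackCoeff.nonneg`): a divisor
effective near `x` has nonnegative coefficient along `E`. Rational approximation
(`sum_mul_nonneg_of_forall_int`) reduces this to integral combinations of principal divisors, where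
a function on a normal variety without poles through `x` is regular at `x`
(`mem_range_algebraMap_of_ord_nonneg`). -/

/-- A rational linear functional which is nonnegative on the integral points of a rational
polyhedral cone is nonnegative on the cone. -/
theorem sum_mul_nonneg_of_forall_int {ι S : Type*} [Fintype ι] [Finite S] (a : S → ι → ℤ)
    (w : ι → ℤ)
    (H : ∀ q : ι → ℤ, (∀ s, 0 ≤ ∑ i, q i * a s i) → 0 ≤ ∑ i, q i * w i)
    (r : ι → ℝ) (hr : ∀ s, 0 ≤ ∑ i, r i * (a s i : ℝ)) : 0 ≤ ∑ i, r i * (w i : ℝ) := by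
  classical
  have HQ : ∀ q : ι → ℚ, (∀ s, 0 ≤ ∑ i, q i * (a s i : ℚ)) → 0 ≤ ∑ i, q i * (w i : ℚ) := by
    intro q hq
    obtain ⟨b, hb⟩ := IsLocalization.exist_integer_multiples_of_finset (nonZeroDivisors ℤ)
      (Finset.univ.image q)
    have hb0 : (0 : ℚ) < |((b : ℤ) : ℚ)| := by
      have := nonZeroDivisors.ne_zero b.2
      positivity
    have h1 : ∀ i, ∃ z : ℤ, (z : ℚ) = |((b : ℤ) : ℚ)| * q i := by
      intro i
      obtain ⟨z, hz⟩ := hb (q i) (Finset.mem_image_of_mem _ (Finset.mem_univ i))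
      have hz' : (z : ℚ) = (b : ℤ) * q i := by simpa using hz
      rcases abs_choice ((b : ℤ) : ℚ) with h | h
      · exact ⟨z, by rw [h, hz']⟩
      · exact ⟨-z, by rw [h]; push_cast; rw [hz']; ring⟩
    choose z hz using h1
    have key : ∀ c : ι → ℤ, ((∑ i, z i * c i : ℤ) : ℚ)
        = |((b : ℤ) : ℚ)| * ∑ i, q i * (c i : ℚ) := by
      intro c
      push_cast
      rw [Finset.mul_sum]
      exact Finset.sum_congr rfl fun i _ => by rw [hz]; ring
    have h2 := H z fun s => by
      have : (0 : ℚ) ≤ ((∑ i, z i * a s i : ℤ) : ℚ) := by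
        rw [key]; exact mul_nonneg hb0.le (hq s)
      exact_mod_cast this
    have h3 : (0 : ℚ) ≤ ((∑ i, z i * w i : ℤ) : ℚ) := by exact_mod_cast h2
    rw [key] at h3
    exact nonneg_of_mul_nonneg_right h3 hb0
  -- In coordinates over a `ℚ`-basis `β` of the span of the `r i`, all constraints become linear
  -- forms with rational coefficients. By independence of `β`, a form that vanishes at `β` vanishes
  -- identically.
  let L : Submodule ℚ ℝ := Submodule.span ℚ (Set.range r)
  have : Module.Finite ℚ L := Module.Finite.span_of_finite ℚ (Set.finite_range r)
  let b := Module.finBasis ℚ L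
  let c : ι → Fin (Module.finrank ℚ L) → ℚ := fun i =>
    b.repr ⟨r i, Submodule.subset_span ⟨i, rfl⟩⟩
  let β : Fin (Module.finrank ℚ L) → ℝ := fun j => (b j : ℝ)
  have hrc : ∀ i, r i = ∑ j, (c i j : ℝ) * β j := by
    intro i
    have := congrArg (Subtype.val) (b.sum_repr ⟨r i, Submodule.subset_span ⟨i, rfl⟩⟩)
    simp only [Submodule.coe_sum, Submodule.coe_smul] at this
    rw [← this]
    exact Finset.sum_congr rfl fun j _ => by rw [Rat.smul_def]
  have hli : ∀ e : Fin (Module.finrank ℚ L) → ℚ, ∑ j, (e j : ℝ) * β j = 0 → e = 0 := by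
    intro e he
    have h0 : ∑ j, e j • b j = 0 := by
      apply Subtype.ext
      simp only [Submodule.coe_sum, Submodule.coe_smul, ZeroMemClass.coe_zero]
      rw [← he]
      exact Finset.sum_congr rfl fun j _ => by rw [Rat.smul_def]
    exact funext (Fintype.linearIndependent_iff.mp b.linearIndependent e h0)
  let F : (ι → ℤ) → (Fin (Module.finrank ℚ L) → ℝ) → ℝ := fun d γ =>
    ∑ i, (∑ j, (c i j : ℝ) * γ j) * (d i : ℝ)
  have hFc : ∀ d, Continuous (F d) := fun d => by fun_prop
  have hFr : ∀ d : ι → ℤ, ∑ i, r i * (d i : ℝ) = F d β := fun d =>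
    Finset.sum_congr rfl fun i _ => by rw [hrc]
  have hFswap : ∀ d γ, F d γ = ∑ j, ((∑ i, c i j * (d i : ℚ) : ℚ) : ℝ) * γ j := by
    intro d γ
    simp only [F, Finset.sum_mul]
    rw [Finset.sum_comm]
    refine Finset.sum_congr rfl fun j _ => ?_
    push_cast
    rw [Finset.sum_mul]
    exact Finset.sum_congr rfl fun i _ => by ring
  by_contra hneg
  push Not at hneg
  rw [hFr] at hneg
  -- Strict constraints and the negated conclusion are open conditions, and tight constraints hold
  -- identically. So a rational point near `β` would contradict the rational case.
  have hnhds : {γ | F w γ < 0} ∩ (⋂ s, {γ | F (a s) β = 0 ∨ 0 < F (a s) γ}) ∈ nhds β := by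
    refine Filter.inter_mem ((isOpen_lt (hFc w) continuous_const).mem_nhds hneg) ?_
    rw [Filter.iInter_mem]
    intro s
    have := hr s
    rw [hFr] at this
    rcases this.eq_or_lt with h | h
    · exact Filter.mem_of_superset Filter.univ_mem fun γ _ => Or.inl h.symm
    · exact Filter.mem_of_superset ((isOpen_lt continuous_const (hFc (a s))).mem_nhds h)
        fun γ hγ => Or.inr hγ
  have hdense : DenseRange (fun (q : Fin (Module.finrank ℚ L) → ℚ) j => ((q j : ℚ) : ℝ)) :=
    DenseRange.piMap fun _ => Rat.denseRange_cast
  obtain ⟨q, hq⟩ := hdense.exists_mem_open isOpen_interior ⟨β, mem_interior_iff_mem_nhds.mpr hnhds⟩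
  have hq' := interior_subset hq
  obtain ⟨hq1, hq2⟩ := hq'
  rw [Set.mem_iInter] at hq2
  have hcast : ∀ d : ι → ℤ, F d (fun j => (q j : ℝ)) =
      ((∑ i, (∑ j, c i j * q j) * (d i : ℚ) : ℚ) : ℝ) := by
    intro d; simp only [F]; push_cast; rfl
  have := HQ (fun i => ∑ j, c i j * q j) fun s => by
    have : (0 : ℝ) ≤ F (a s) (fun j => (q j : ℝ)) := by
      rcases hq2 s with h | h
      · rw [hFswap] at h ⊢
        have := hli _ h
        refine (Finset.sum_eq_zero fun j _ => ?_).ge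
        have h2 := congrFun this j
        simp only [Pi.zero_apply] at h2
        rw [h2]; simp
      · exact h.le
    rw [hcast] at this
    exact_mod_cast this
  have h4 : (0 : ℝ) ≤ F w (fun j => (q j : ℝ)) := by
    rw [hcast]; exact_mod_cast this
  exact absurd hq1 (not_lt.mpr h4)

/-- An element of the fraction field of a Noetherian domain `A` that lies in all the localizations
of `A` at the primes of height one below `m` lies in the localization at `m`, if the latter is
integrally closed. -/
theorem exists_smul_eq_of_forall_height_one {A K : Type*} [CommRing A] [IsDomain A]
    [IsNoetherianRing A] [Field K] [Algebra A K] [IsFractionRing A K] (m : Ideal A)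
    (hm : ∀ z : K, IsIntegral A z → ∃ s ∉ m, ∃ a, s • z = algebraMap A K a) (y : K)
    (hy : ∀ p : Ideal A, p.IsPrime → p ≤ m → p.height = 1 →
      ∃ s ∉ p, ∃ a, s • y = algebraMap A K a) (hmp : m.IsPrime) :
    ∃ s ∉ m, ∃ a, s • y = algebraMap A K a := by
  let N : Submodule A K := LinearMap.range (Algebra.linearMap A K)
  have hN : ∀ (s : A) (z : K), s ∈ N.colon {z} ↔ ∃ a, s • z = algebraMap A K a := by
    intro s z
    rw [Submodule.mem_colon_singleton]
    exact ⟨fun ⟨a, ha⟩ => ⟨a, ha.symm⟩, fun ⟨a, ha⟩ => ⟨a, ha.symm⟩⟩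
  by_contra hcon
  push Not at hcon
  have hle : N.colon {y} ≤ m := by
    intro s hs
    by_contra hsm
    obtain ⟨a, ha⟩ := (hN s y).mp hs
    exact hcon s hsm a ha
  -- A minimal prime over the denominator ideal of `y` is itself the denominator ideal of some `z`.
  -- It will be shown to have height one, which the assumption on `y` forbids.
  obtain ⟨p, hp, hpm⟩ := Ideal.exists_minimalPrimes_le hle
  have hpp : p.IsPrime := hp.1.1
  obtain ⟨z, hz⟩ := Submodule.exists_eq_colon_of_mem_minimalPrimes hp
  have hmem : ∀ s : A, s ∈ p ↔ ∃ a, s • z = algebraMap A K a := fun s => by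
    rw [hz]; exact hN s z
  have hp0 : p ≠ ⊥ := by
    obtain ⟨a, b, hb, hab⟩ := IsFractionRing.div_surjective (A := A) y
    have hb0 := nonZeroDivisors.ne_zero hb
    have : b ∈ p := hp.1.2 ((hN b y).mpr ⟨a, by
      rw [← hab, Algebra.smul_def]
      field_simp [IsFractionRing.to_map_ne_zero_of_mem_nonZeroDivisors hb]⟩)
    exact fun h => hb0 (by simpa [h] using this)
  have hheight : p.height = 1 := by
    refine le_antisymm ?_ (Order.one_le_iff_pos.mpr ?_)
    -- If multiplication by `z` maps `p` into itself, the determinant trick makes `z` integral, so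
    -- `z` has a denominator outside `m`, which is absurd as `p ≤ m`.
    · by_cases hc : ∀ q ∈ p, ∃ a ∈ p, q • z = algebraMap A K a
      · exfalso
        have hz_int : IsIntegral A z := by
          refine isIntegral_of_smul_mem_submodule (Submodule.map (Algebra.linearMap A K) p) ?_
            ((IsNoetherian.noetherian p).map _) z ?_
          · intro h
            refine hp0 (Submodule.map_injective_of_injective (f := Algebra.linearMap A K)
              (IsFractionRing.injective A K) ?_)
            rw [h, Submodule.map_bot]
          · rintro _ ⟨q, hq, rfl⟩
            obtain ⟨a, ha, hqa⟩ := hc q hq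
            refine ⟨a, ha, ?_⟩
            rw [Algebra.linearMap_apply, ← hqa, Algebra.linearMap_apply, Algebra.smul_def,
              smul_eq_mul, mul_comm]
        obtain ⟨s, hs, a, ha⟩ := hm z hz_int
        exact hs (hpm ((hmem s).mpr ⟨a, ha⟩))
      · push Not at hc
        obtain ⟨q, hq, hqa⟩ := hc
        obtain ⟨a, ha⟩ := (hmem q).mp hq
        have hap : a ∉ p := fun h => hqa a h ha
        -- Here `q z = a` with `a ∉ p`, so `a b = q (b z)` for `b ∈ p`: after inverting `a` the
        -- ideal `p` is generated by `q`, and Krull's principal ideal theorem bounds its height.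
        have hmin : p ∈ (Ideal.span {q}).minimalPrimes := by
          refine ⟨⟨hpp, by rwa [Ideal.span_singleton_le_iff_mem]⟩, ?_⟩
          rintro p' ⟨hp', hqp'⟩ hle' b hb
          rw [Ideal.span_singleton_le_iff_mem] at hqp'
          obtain ⟨c, hc⟩ := (hmem b).mp hb
          have : a * b = q * c := by
            apply IsFractionRing.injective A K
            rw [map_mul, map_mul, ← ha, ← hc, Algebra.smul_def, Algebra.smul_def]
            ring
          have h2 : a * b ∈ p' := this ▸ p'.mul_mem_right _ hqp'
          exact (hp'.mem_or_mem h2).resolve_left fun h => hap (hle' h)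
        exact Ideal.height_le_one_of_isPrincipal_of_mem_minimalPrimes _ _ hmin
    · rw [pos_iff_ne_zero, Ne, Ideal.height_eq_zero_iff_eq_bot]
      exact hp0
  obtain ⟨s, hs, a, ha⟩ := hy p hpp hpm hheight
  exact hs (hp.1.2 ((hN s y).mpr ⟨a, ha⟩))

/-- The space of elements of a `k`-algebra modulo the `(r + 1)`-st power of an ideal with `n`
generators and residue ring `k` has dimension at most the number of monomials of degree at most `r`
in `n` variables. -/
theorem exists_ne_zero_mem_pow_of_choose_lt {k O S : Type*} [Field k] [CommRing O] [Algebra k O]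
    [AddCommGroup S] [Module k S] {n : ℕ} (t : Fin n → O) (m : Ideal O)
    (hm : m = Ideal.span (Set.range t)) (hk : ∀ a : O, ∃ c : k, a - algebraMap k O c ∈ m)
    (φ : S →ₗ[k] O) (r : ℕ) (hS : (n + r).choose n < Module.finrank k S) :
    ∃ s ≠ 0, φ s ∈ m ^ (r + 1) := by
  classical
  -- The extra variable `none` is sent to `1`, so that products of exactly `r` entries are the
  -- monomials of degree at most `r`. The multisets `Sym (Option (Fin n)) r` then give the binomial
  -- count.
  let t' : Option (Fin n) → O := fun o => o.elim 1 t
  let g : (r : ℕ) → Sym (Option (Fin n)) r → O := fun r s => ((s : Multiset _).map t').prod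
  have hspan : ∀ r, Submodule.span k (Set.range (g r)) ⊔ (m ^ (r + 1)).restrictScalars k = ⊤ := by
    intro r
    induction r with
    | zero =>
      rw [eq_top_iff]
      intro a _
      obtain ⟨c, hc⟩ := hk a
      rw [← add_sub_cancel (algebraMap k O c) a]
      refine Submodule.add_mem_sup ?_ (by simpa using hc)
      rw [Algebra.algebraMap_eq_smul_one]
      refine Submodule.smul_mem _ _ (Submodule.subset_span ⟨Sym.nil, ?_⟩)
      simp [g]
    | succ r ih =>
      have hstep : ∀ o : Option (Fin n), ∀ b : O, (∃ c : k, b = algebraMap k O c) ∨ t' o ∈ m →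
          t' o * b ∈ Submodule.span k (Set.range (g (r + 1))) ⊔
            (m ^ (r + 1 + 1)).restrictScalars k := by
        intro o b hob
        have hmem : ∀ d ∈ Submodule.span k (Set.range (g r)),
            t' o * d ∈ Submodule.span k (Set.range (g (r + 1))) := by
          intro d hd
          induction hd using Submodule.span_induction with
          | mem x hx =>
            obtain ⟨s, rfl⟩ := hx
            exact Submodule.subset_span ⟨o ::ₛ s, by simp [g, Sym.coe_cons]⟩
          | zero => simp
          | add x y _ _ hx hy => rw [mul_add]; exact add_mem hx hy
          | smul c x _ hx => rw [mul_smul_comm]; exact Submodule.smul_mem _ _ hx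
        rcases hob with ⟨c, rfl⟩ | hom
        · refine Submodule.mem_sup_left (hmem _ ?_)
          rw [Algebra.algebraMap_eq_smul_one]
          refine Submodule.smul_mem _ _ (Submodule.subset_span ⟨Sym.replicate r none, ?_⟩)
          simp [g, t', Sym.coe_replicate]
        · have hb : b ∈ Submodule.span k (Set.range (g r)) ⊔ (m ^ (r + 1)).restrictScalars k := by
            rw [ih]; trivial
          obtain ⟨d, hd, e, he, rfl⟩ := Submodule.mem_sup.mp hb
          rw [mul_add]
          refine Submodule.add_mem_sup (hmem d hd) ?_
          rw [Submodule.restrictScalars_mem] at he ⊢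
          rw [pow_succ']
          exact Ideal.mul_mem_mul hom he
      rw [eq_top_iff]
      intro a _
      obtain ⟨c, hc⟩ := hk a
      rw [← add_sub_cancel (algebraMap k O c) a]
      refine add_mem ?_ ?_
      · have := hstep none (algebraMap k O c) (Or.inl ⟨c, rfl⟩)
        simpa [t'] using this
      · rw [hm] at hc
        obtain ⟨b, hb⟩ := (Submodule.mem_span_range_iff_exists_fun O).mp hc
        rw [← hb]
        refine sum_mem fun i _ => ?_
        rw [smul_eq_mul, mul_comm]
        exact hstep (some i) (b i) (Or.inr (hm ▸ Ideal.subset_span ⟨i, rfl⟩))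
  let Q := O ⧸ (m ^ (r + 1)).restrictScalars k
  let π : O →ₗ[k] Q := Submodule.mkQ _
  let ρ : (Sym (Option (Fin n)) r → k) →ₗ[k] Q := π ∘ₗ Fintype.linearCombination k (g r)
  have hρ : Function.Surjective ρ := by
    intro q
    obtain ⟨a, rfl⟩ := Submodule.mkQ_surjective _ q
    have ha : a ∈ Submodule.span k (Set.range (g r)) ⊔ (m ^ (r + 1)).restrictScalars k := by
      rw [hspan]; trivial
    obtain ⟨d, hd, e, he, rfl⟩ := Submodule.mem_sup.mp ha
    rw [← Fintype.range_linearCombination] at hd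
    obtain ⟨c, rfl⟩ := hd
    refine ⟨c, ?_⟩
    simp only [ρ, π, LinearMap.comp_apply, map_add]
    rw [left_eq_add, Submodule.mkQ_apply, Submodule.Quotient.mk_eq_zero]
    exact he
  have : Module.Finite k Q := Module.Finite.of_surjective ρ hρ
  have hQ : Module.finrank k Q ≤ (n + r).choose n := by
    refine (LinearMap.finrank_le_finrank_of_surjective hρ).trans ?_
    rw [Module.finrank_fintype_fun_eq_card, Sym.card_sym_eq_choose, Fintype.card_option,
      Fintype.card_fin, show n + 1 + r - 1 = n + r by omega, Nat.choose_symm_add]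
  have : Module.Finite k S := Module.finite_of_finrank_pos (by omega)
  have hker : LinearMap.ker (π ∘ₗ φ) ≠ ⊥ := LinearMap.ker_ne_bot_of_finrank_lt (by omega)
  obtain ⟨s, hs, hs0⟩ := Submodule.exists_mem_ne_zero_of_ne_bot hker
  refine ⟨s, hs0, ?_⟩
  rw [LinearMap.mem_ker, LinearMap.comp_apply, Submodule.mkQ_apply,
    Submodule.Quotient.mk_eq_zero] at hs
  exact hs

/-! ### Coordinates on a smooth local algebra -/

section Coordinates

open IsLocalRing MvPolynomial

variable {k O : Type u} [Field k] [CommRing O] [IsLocalRing O] [Algebra k O]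

theorem algebraMap_eq_zero_of_mem_maximalIdeal {c : k} (hc : algebraMap k O c ∈ maximalIdeal O) :
    c = 0 := by
  by_contra h
  exact (mem_maximalIdeal _).mp hc ((isUnit_iff_ne_zero.mpr h).map (algebraMap k O))

/-- Subtracting constants shows that differentials of elements of the maximal ideal generate
`Ω[O⁄k]`. By formal smoothness and finiteness this module is projective and finitely presented, so
over the local ring a basis can be chosen among these generators. -/
theorem exists_coordinates [Algebra.FormallySmooth k O] [Algebra.EssFiniteType k O]
    (hk : ∀ a : O, ∃ c : k, a - algebraMap k O c ∈ maximalIdeal O) :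
    ∃ (d : ℕ) (t : Fin d → O), (∀ i, t i ∈ maximalIdeal O) ∧
      LinearIndependent O (fun i => KaehlerDifferential.D k O (t i)) ∧
      Submodule.span O (Set.range fun i => KaehlerDifferential.D k O (t i)) = ⊤ := by
  have hspan : Submodule.span O (Set.range fun a : maximalIdeal O =>
      KaehlerDifferential.D k O (a : O)) = ⊤ := by
    rw [eq_top_iff, ← KaehlerDifferential.span_range_derivation, Submodule.span_le]
    rintro _ ⟨a, rfl⟩
    obtain ⟨c, hc⟩ := hk a
    refine Submodule.subset_span ⟨⟨_, hc⟩, ?_⟩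
    simp
  have : Module.FinitePresentation O (Ω[O⁄k]) :=
    Module.finitePresentation_of_projective O _
  obtain ⟨κ, a, b, hb⟩ := Module.exists_basis_of_span_of_flat _ hspan
  have : Finite κ := Module.Finite.finite_basis b
  obtain ⟨d, ⟨e⟩⟩ := Finite.exists_equiv_fin κ
  refine ⟨d, fun i => a (e.symm i), fun i => (a (e.symm i)).2, ?_, ?_⟩
  · convert! (b.reindex e).linearIndependent using 2
    simp [hb]
  · rw [← (b.reindex e).span_eq]
    congr 2
    ext i
    simp [hb]

variable {n : ℕ} {t : Fin n → O}

/-- The map `a ↦ a - a(x)` into `O ⧸ ((t) + m²)` is a derivation. It kills every `t i`, hence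
vanishes because the `dt i` generate, so `m ≤ (t) + m²` and Nakayama's lemma applies. -/
theorem maximalIdeal_eq_span_of_span_D [IsNoetherianRing O]
    (hk : ∀ a : O, ∃ c : k, a - algebraMap k O c ∈ maximalIdeal O)
    (ht : ∀ i, t i ∈ maximalIdeal O)
    (hspan : Submodule.span O (Set.range fun i => KaehlerDifferential.D k O (t i)) = ⊤) :
    maximalIdeal O = Ideal.span (Set.range t) := by
  set m := maximalIdeal O with hmdef
  set N := Ideal.span (Set.range t) with hN
  have hNm : N ≤ m := by
    rw [hN, Ideal.span_le]; rintro _ ⟨i, rfl⟩; exact ht i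
  choose ε hε using hk
  have huniq : ∀ (a : O) (c : k), a - algebraMap k O c ∈ m → ε a = c := by
    intro a c hc
    have : algebraMap k O (ε a - c) ∈ m := by
      have := m.sub_mem hc (hε a)
      rw [map_sub]; convert this using 1; ring
    exact sub_eq_zero.mp (algebraMap_eq_zero_of_mem_maximalIdeal this)
  have hadd : ∀ a b, ε (a + b) = ε a + ε b := fun a b => huniq _ _ (by
    have := m.add_mem (hε a) (hε b)
    rw [map_add]; convert this using 1; ring)
  have hmul : ∀ a b, ε (a * b) = ε a * ε b := fun a b => huniq _ _ (by
    have := m.add_mem (m.mul_mem_left a (hε b)) (m.mul_mem_left (algebraMap k O (ε b)) (hε a))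
    rw [map_mul]; convert this using 1; ring)
  have hsmul : ∀ (c : k) a, ε (c • a) = c * ε a := fun c a => huniq _ _ (by
    have := m.mul_mem_left (algebraMap k O c) (hε a)
    rw [map_mul, Algebra.smul_def]; convert this using 1; ring)
  let J : Ideal O := N ⊔ m ^ 2
  let δ : Derivation k O (O ⧸ J) := Derivation.mk'
    { toFun := fun a => Ideal.Quotient.mk J (a - algebraMap k O (ε a))
      map_add' := fun a b => by rw [hadd, ← map_add]; congr 1; rw [map_add]; ring
      map_smul' := fun c a => by
        rw [hsmul, RingHom.id_apply]
        have : (c • a - algebraMap k O (c * ε a)) = c • (a - algebraMap k O (ε a)) := by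
          rw [Algebra.smul_def, Algebra.smul_def, map_mul]; ring
        rw [this]; rfl }
    (fun a b => by
      change Ideal.Quotient.mk J _ = Ideal.Quotient.mk J (a * _) + Ideal.Quotient.mk J (b * _)
      rw [← map_add, Ideal.Quotient.eq, hmul]
      refine Ideal.mem_sup_right ?_
      have := neg_mem (Ideal.mul_mem_mul (hε a) (hε b))
      rw [pow_two]
      convert this using 1
      rw [map_mul]; ring)
  have hδ : δ.liftKaehlerDifferential = 0 := by
    refine LinearMap.ext_on_range hspan fun i => ?_
    rw [Derivation.liftKaehlerDifferential_comp_D, LinearMap.zero_apply]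
    change Ideal.Quotient.mk J _ = 0
    rw [huniq (t i) 0 (by simpa using ht i), map_zero, sub_zero, Ideal.Quotient.eq_zero_iff_mem]
    exact Ideal.mem_sup_left (Ideal.subset_span ⟨i, rfl⟩)
  have hmJ : m ≤ J := by
    intro a ha
    have h1 : δ a = 0 := by rw [← Derivation.liftKaehlerDifferential_comp_D, hδ]; rfl
    change Ideal.Quotient.mk J _ = 0 at h1
    rwa [huniq a 0 (by simpa using ha), map_zero, sub_zero, Ideal.Quotient.eq_zero_iff_mem] at h1
  refine le_antisymm ?_ hNm
  refine Submodule.le_of_le_smul_of_le_jacobson_bot (I := m) (IsNoetherian.noetherian m)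
    (IsLocalRing.jacobson_eq_maximalIdeal ⊥ bot_ne_top).ge ?_
  rwa [smul_eq_mul, ← pow_two]

theorem exists_aeval_sub_mem_pow (hm : maximalIdeal O = Ideal.span (Set.range t))
    (hk : ∀ a : O, ∃ c : k, a - algebraMap k O c ∈ maximalIdeal O) (r : ℕ) (a : O) :
    ∃ G : MvPolynomial (Fin n) k, a - aeval t G ∈ maximalIdeal O ^ r := by
  induction r generalizing a with
  | zero => exact ⟨0, by simp⟩
  | succ r ih =>
    obtain ⟨c, hc⟩ := hk a
    have hc' := hc
    rw [hm] at hc'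
    obtain ⟨b, hb⟩ := (Submodule.mem_span_range_iff_exists_fun O).mp hc'
    choose G hG using fun i => ih (b i)
    refine ⟨C c + ∑ i, G i * X i, ?_⟩
    have : a - aeval t (C c + ∑ i, G i * X i) = ∑ i, t i * (b i - aeval t (G i)) := by
      simp only [map_add, map_sum, map_mul, aeval_X, algHom_C]
      rw [← sub_sub, ← hb, ← Finset.sum_sub_distrib]
      refine Finset.sum_congr rfl fun i _ => ?_
      rw [smul_eq_mul]; ring
    rw [this, pow_succ']
    exact Ideal.sum_mem _ fun i _ => Ideal.mul_mem_mul (hm ▸ Ideal.subset_span ⟨i, rfl⟩) (hG i)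

theorem exists_isHomogeneous_aeval_sub_mem_pow (hm : maximalIdeal O = Ideal.span (Set.range t))
    (hk : ∀ a : O, ∃ c : k, a - algebraMap k O c ∈ maximalIdeal O) (r : ℕ) (a : O)
    (ha : a ∈ maximalIdeal O ^ r) :
    ∃ G : MvPolynomial (Fin n) k, G.IsHomogeneous r ∧
      a - aeval t G ∈ maximalIdeal O ^ (r + 1) := by
  induction r generalizing a with
  | zero =>
    obtain ⟨c, hc⟩ := hk a
    exact ⟨C c, isHomogeneous_C _ _, by simpa using hc⟩
  | succ r ih =>
    rw [pow_succ'] at ha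
    induction ha using Submodule.mul_induction_on' with
    | mem_mul_mem x hx y hy =>
      rw [hm] at hx
      obtain ⟨b, hb⟩ := (Submodule.mem_span_range_iff_exists_fun O).mp hx
      choose G hGh hG using fun i => ih (b i * y) (Ideal.mul_mem_left _ _ hy)
      refine ⟨∑ i, X i * G i, ?_, ?_⟩
      · refine IsHomogeneous.sum _ _ _ fun i _ => ?_
        rw [add_comm]
        exact (isHomogeneous_X _ _).mul (hGh i)
      · have : x * y - aeval t (∑ i, X i * G i) = ∑ i, t i * (b i * y - aeval t (G i)) := by
          simp only [map_sum, map_mul, aeval_X]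
          rw [← hb, Finset.sum_mul, ← Finset.sum_sub_distrib]
          refine Finset.sum_congr rfl fun i _ => ?_
          rw [smul_eq_mul]; ring
        rw [this, pow_succ' _ (r + 1)]
        exact Ideal.sum_mem _ fun i _ => Ideal.mul_mem_mul (hm ▸ Ideal.subset_span ⟨i, rfl⟩) (hG i)
    | add x _ y _ hx hy =>
      obtain ⟨F, hF, hF'⟩ := hx
      obtain ⟨G, hG, hG'⟩ := hy
      refine ⟨F + G, hF.add hG, ?_⟩
      have := Ideal.add_mem _ hF' hG'
      rw [map_add]; convert this using 1; ring

/-- Evaluating a homogeneous polynomial of degree `e` at two points of an ideal that are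
congruent modulo the square gives values congruent modulo the `(e + 1)`-st power. -/
theorem aeval_sub_aeval_mem_pow {B σ : Type*} [CommRing B] [Algebra k B] (I : Ideal B) (x y : σ → B)
    (hx : ∀ i, x i ∈ I) (hxy : ∀ i, x i - y i ∈ I ^ 2) {e : ℕ} {F : MvPolynomial σ k}
    (hF : F.IsHomogeneous e) : aeval x F - aeval y F ∈ I ^ (e + 1) := by
  have hy : ∀ i, y i ∈ I := fun i => by
    have := I.sub_mem (hx i) (Ideal.pow_le_self two_ne_zero (hxy i))
    simpa using this
  have key : ∀ s : Multiset σ, (s.map y).prod ∈ I ^ s.card ∧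
      (s.map x).prod - (s.map y).prod ∈ I ^ (s.card + 1) := by
    intro s
    induction s using Multiset.induction with
    | empty => simp
    | cons a s ih =>
      simp only [Multiset.map_cons, Multiset.prod_cons, Multiset.card_cons]
      refine ⟨?_, ?_⟩
      · rw [pow_succ']; exact Ideal.mul_mem_mul (hy a) ih.1
      · have h1 : x a * ((s.map x).prod - (s.map y).prod) ∈ I ^ (s.card + 1 + 1) := by
          rw [pow_succ' _ (s.card + 1)]; exact Ideal.mul_mem_mul (hx a) ih.2
        have h2 : (x a - y a) * (s.map y).prod ∈ I ^ (s.card + 1 + 1) := by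
          rw [show s.card + 1 + 1 = 2 + s.card by ring, pow_add]
          exact Ideal.mul_mem_mul (hxy a) ih.1
        convert Ideal.add_mem _ h1 h2 using 1
        ring
  rw [aeval_def, aeval_def, eval₂_eq, eval₂_eq, ← Finset.sum_sub_distrib]
  refine Ideal.sum_mem _ fun s hs => ?_
  rw [← mul_sub]
  refine Ideal.mul_mem_left _ _ ?_
  have hdeg : (Finsupp.toMultiset s).card = e := by
    rw [Finsupp.card_toMultiset]
    change s.degree = e
    by_contra h
    exact mem_support_iff.mp hs (hF.coeff_eq_zero h)
  have hprod : ∀ z : σ → B, ((Finsupp.toMultiset s).map z).prod = ∏ i ∈ s.support, z i ^ s i := by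
    intro z
    rw [Finsupp.toMultiset_map, Finsupp.prod_toMultiset, Finsupp.prod_mapDomain_index] <;>
      simp [pow_add, Finsupp.prod]
  have := (key (Finsupp.toMultiset s)).2
  rwa [hprod, hprod, hdeg] at this

/-- By Leibniz, the differential of an element of `m²` has coordinates in `m`, whereas the
coordinates of the differential of the sum are the constants `c i`. -/
theorem eq_zero_of_sum_mem_maximalIdeal_sq
    (hli : LinearIndependent O (fun i => KaehlerDifferential.D k O (t i)))
    (hspan : Submodule.span O (Set.range fun i => KaehlerDifferential.D k O (t i)) = ⊤)
    (c : Fin n → k) (hc : ∑ i, algebraMap k O (c i) * t i ∈ maximalIdeal O ^ 2) : c = 0 := by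
  let b := Module.Basis.mk hli hspan.ge
  have hD : ∀ a ∈ maximalIdeal O ^ 2, ∀ i, b.repr (KaehlerDifferential.D k O a) i ∈
      maximalIdeal O := by
    intro a ha i
    rw [pow_two] at ha
    induction ha using Submodule.mul_induction_on' with
    | mem_mul_mem x hx y hy =>
      rw [Derivation.leibniz, map_add, map_smul, map_smul, Finsupp.add_apply, Finsupp.smul_apply,
        Finsupp.smul_apply, smul_eq_mul, smul_eq_mul]
      exact Ideal.add_mem _ (Ideal.mul_mem_right _ _ hx) (Ideal.mul_mem_right _ _ hy)
    | add x _ y _ hx hy =>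
      rw [map_add, map_add]; exact Ideal.add_mem _ hx hy
  funext i
  have h1 := hD _ hc i
  have h2 : KaehlerDifferential.D k O (∑ i, algebraMap k O (c i) * t i) =
      ∑ i, algebraMap k O (c i) • b i := by
    rw [map_sum]
    refine Finset.sum_congr rfl fun j _ => ?_
    rw [Derivation.leibniz, Derivation.map_algebraMap, smul_zero, add_zero,
      Module.Basis.mk_apply]
  rw [h2, b.repr_sum_self] at h1
  exact algebraMap_eq_zero_of_mem_maximalIdeal h1

/-- The graded ring of a smooth local algebra with residue field `k` is a polynomial ring. -/
theorem eq_zero_of_aeval_mem_pow [Algebra.FormallySmooth k O]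
    (hm : maximalIdeal O = Ideal.span (Set.range t))
    (hk : ∀ a : O, ∃ c : k, a - algebraMap k O c ∈ maximalIdeal O)
    (hli : LinearIndependent O (fun i => KaehlerDifferential.D k O (t i)))
    (hspan : Submodule.span O (Set.range fun i => KaehlerDifferential.D k O (t i)) = ⊤)
    {e : ℕ} {F : MvPolynomial (Fin n) k} (hF : F.IsHomogeneous e)
    (hFm : aeval t F ∈ maximalIdeal O ^ (e + 1)) : F = 0 := by
  set m := maximalIdeal O with hmdef
  have ht : ∀ i, t i ∈ m := fun i => hm ▸ Ideal.subset_span ⟨i, rfl⟩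
  let I := idealOfVars (Fin n) k
  have hI0 : ∀ G : MvPolynomial (Fin n) k, aeval t G ∈ m → G ∈ I := by
    intro G hG
    rw [← pow_one I, mem_pow_idealOfVars_iff']
    intro s hs
    have hs0 : s = 0 := by rw [← Finsupp.degree_eq_zero_iff]; omega
    subst hs0
    apply algebraMap_eq_zero_of_mem_maximalIdeal (O := O)
    have h1 : aeval t (G - C (coeff 0 G)) ∈ m := by
      have : G - C (coeff 0 G) ∈ I := by
        rw [← pow_one I, mem_pow_idealOfVars_iff']
        intro s hs
        have hs0 : s = 0 := by rw [← Finsupp.degree_eq_zero_iff]; omega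
        simp [hs0]
      have h2 : I.map (aeval t : MvPolynomial (Fin n) k →ₐ[k] O) ≤ m := by
        rw [Ideal.map_span, Ideal.span_le]
        rintro _ ⟨_, ⟨i, rfl⟩, rfl⟩
        simpa using ht i
      exact h2 (Ideal.mem_map_of_mem _ this)
    have h3 := Ideal.sub_mem _ hG h1
    rwa [map_sub, sub_sub_cancel, algHom_C] at h3
  have hI2 : ∀ G : MvPolynomial (Fin n) k, aeval t G ∈ m ^ 2 → G ∈ I ^ 2 := by
    intro G hG
    have hGI := hI0 G (Ideal.pow_le_self two_ne_zero hG)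
    obtain ⟨b, hb⟩ := (Submodule.mem_span_range_iff_exists_fun _).mp hGI
    have hbI : ∀ i, b i - C (coeff 0 (b i)) ∈ I := fun i => by
      rw [← pow_one I, mem_pow_idealOfVars_iff']
      intro s hs
      have hs0 : s = 0 := by rw [← Finsupp.degree_eq_zero_iff]; omega
      simp [hs0]
    have hmapI : ∀ H ∈ I, aeval t H ∈ m := fun H hH => by
      have h2 : I.map (aeval t : MvPolynomial (Fin n) k →ₐ[k] O) ≤ m := by
        rw [Ideal.map_span, Ideal.span_le]
        rintro _ ⟨_, ⟨i, rfl⟩, rfl⟩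
        simpa using ht i
      exact h2 (Ideal.mem_map_of_mem _ hH)
    have hc : (fun i => coeff 0 (b i)) = 0 := by
      refine eq_zero_of_sum_mem_maximalIdeal_sq hli hspan _ ?_
      have h1 : ∑ i, aeval t (b i - C (coeff 0 (b i))) * t i ∈ m ^ 2 :=
        Ideal.sum_mem _ fun i _ => by
          rw [pow_two]; exact Ideal.mul_mem_mul (hmapI _ (hbI i)) (ht i)
      have := Ideal.sub_mem _ hG h1
      convert this using 1
      rw [← hb]
      simp [sub_mul, Finset.sum_sub_distrib]
    rw [← hb]
    refine Ideal.sum_mem _ fun i _ => ?_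
    have := hbI i
    rw [show coeff 0 (b i) = 0 from congrFun hc i, C_0, sub_zero] at this
    rw [smul_eq_mul, pow_two]
    exact Ideal.mul_mem_mul this (Ideal.subset_span ⟨i, rfl⟩)
  rcases Nat.eq_zero_or_pos e with rfl | he
  · have h1 := hI0 F (by simpa using hFm)
    rw [← pow_one I, mem_pow_idealOfVars_iff'] at h1
    ext s
    by_cases hs : s.degree = 0
    · rw [h1 s (by omega), coeff_zero]
    · rw [hF.coeff_eq_zero hs, coeff_zero]
  let Q := MvPolynomial (Fin n) k ⧸ I ^ (e + 1)
  have hle : ∀ H ∈ I ^ (e + 1), Ideal.Quotient.mkₐ k (m ^ (e + 1)) (aeval t H) = 0 := by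
    intro H hH
    rw [Ideal.Quotient.mkₐ_eq_mk, Ideal.Quotient.eq_zero_iff_mem]
    have h2 : (I ^ (e + 1)).map (aeval t : MvPolynomial (Fin n) k →ₐ[k] O) ≤ m ^ (e + 1) := by
      rw [Ideal.map_pow]
      refine Ideal.pow_right_mono ?_ _
      rw [Ideal.map_span, Ideal.span_le]
      rintro _ ⟨_, ⟨i, rfl⟩, rfl⟩
      simpa using ht i
    exact h2 (Ideal.mem_map_of_mem _ hH)
  -- The truncated polynomial ring maps onto `O ⧸ m ^ (e + 1)` by `X i ↦ t i`. Independence of the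
  -- `t i` modulo `m²` puts the kernel in the image of `I²`, so the kernel is nilpotent.
  let p : Q →ₐ[k] O ⧸ m ^ (e + 1) :=
    Ideal.Quotient.liftₐ (I ^ (e + 1)) ((Ideal.Quotient.mkₐ k (m ^ (e + 1))).comp (aeval t)) hle
  have hp : ∀ G, p (Ideal.Quotient.mk _ G) = Ideal.Quotient.mk _ (aeval t G) := fun G => rfl
  have hpsurj : Function.Surjective p := by
    intro q
    obtain ⟨a, rfl⟩ := Ideal.Quotient.mk_surjective q
    obtain ⟨G, hG⟩ := exists_aeval_sub_mem_pow hm hk (e + 1) a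
    exact ⟨Ideal.Quotient.mk _ G, by rw [hp]; exact ((Ideal.Quotient.eq).mpr hG).symm⟩
  have hker2 : ∀ q : Q, p q = 0 → q ∈ (I ^ 2).map (Ideal.Quotient.mk (I ^ (e + 1))) := by
    intro q hq
    obtain ⟨G, rfl⟩ := Ideal.Quotient.mk_surjective q
    rw [hp, Ideal.Quotient.eq_zero_iff_mem] at hq
    exact Ideal.mem_map_of_mem _ (hI2 G (Ideal.pow_le_pow_right (by omega) hq))
  have hnil : IsNilpotent (RingHom.ker (p : Q →+* O ⧸ m ^ (e + 1))) := by
    refine ⟨e + 1, ?_⟩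
    rw [Ideal.zero_eq_bot, eq_bot_iff]
    have h1 : RingHom.ker (p : Q →+* O ⧸ m ^ (e + 1)) ≤ I.map (Ideal.Quotient.mk (I ^ (e + 1))) :=
      fun q hq => Ideal.map_mono (Ideal.pow_le_self two_ne_zero) (hker2 q hq)
    refine (Ideal.pow_right_mono h1 _).trans ?_
    rw [← Ideal.map_pow, Ideal.map_quotient_self]
  -- Formal smoothness lifts the quotient map of `O` through `p`. The lift sends `t i` to `X i`
  -- modulo the square of the ideal of variables.
  let ψ : O →ₐ[k] Q := Algebra.FormallySmooth.liftOfSurjective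
    (Ideal.Quotient.mkₐ k (m ^ (e + 1))) p hpsurj hnil
  have hψ : ∀ a, p (ψ a) = Ideal.Quotient.mk _ a := fun a =>
    Algebra.FormallySmooth.liftOfSurjective_apply _ _ _ _ a
  let I' := I.map (Ideal.Quotient.mk (I ^ (e + 1)))
  have hX : ∀ i, Ideal.Quotient.mk (I ^ (e + 1)) (X i) ∈ I' := fun i =>
    Ideal.mem_map_of_mem _ (Ideal.subset_span ⟨i, rfl⟩)
  have hdiff : ∀ i, Ideal.Quotient.mk (I ^ (e + 1)) (X i) - ψ (t i) ∈ I' ^ 2 := fun i => by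
    rw [← Ideal.map_pow]
    apply hker2
    rw [map_sub, hψ, hp, aeval_X, sub_self]
  have hψm : ∀ a ∈ m ^ (e + 1), ψ a = 0 := by
    intro a ha
    have h1 : m.map ψ ≤ I' := by
      rw [hm, Ideal.map_span, Ideal.span_le]
      rintro _ ⟨_, ⟨i, rfl⟩, rfl⟩
      have := Ideal.sub_mem _ (hX i) (Ideal.pow_le_self two_ne_zero (hdiff i))
      simpa using this
    have h2 : ψ a ∈ I' ^ (e + 1) := by
      have := Ideal.mem_map_of_mem ψ ha
      rw [Ideal.map_pow] at this
      exact Ideal.pow_right_mono h1 _ this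
    rwa [← Ideal.map_pow, Ideal.map_quotient_self, Ideal.mem_bot] at h2
  -- In degree `e` the difference between `X i` and `ψ (t i)` is invisible, so the class of `F`
  -- equals `ψ (F(t)) = 0`. A form of degree `e` lying in `I ^ (e + 1)` is zero.
  have h1 := aeval_sub_aeval_mem_pow I' _ _ hX hdiff hF
  rw [← Ideal.map_pow, Ideal.map_quotient_self, Ideal.mem_bot] at h1
  have h2 : aeval (fun i => ψ (t i)) F = ψ (aeval t F) := (comp_aeval_apply t ψ F).symm
  rw [h2, hψm _ hFm, sub_zero] at h1
  have h3 : aeval (fun i => Ideal.Quotient.mk (I ^ (e + 1)) (X i)) F =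
      Ideal.Quotient.mk (I ^ (e + 1)) F := by
    have := comp_aeval_apply X (Ideal.Quotient.mkₐ k (I ^ (e + 1))) F
    rw [aeval_X_left_apply] at this
    exact this.symm
  rw [h3, Ideal.Quotient.eq_zero_iff_mem, mem_pow_idealOfVars_iff'] at h1
  ext s
  by_cases hs : s.degree = e
  · rw [h1 s (by omega), coeff_zero]
  · rw [hF.coeff_eq_zero hs, coeff_zero]

/-- The leading forms of `a` and `b` are nonzero polynomials, so their product is nonzero and is the
leading form of `a * b` in degree `r + s`. -/
theorem mul_notMem_pow [Algebra.FormallySmooth k O]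
    (hm : maximalIdeal O = Ideal.span (Set.range t))
    (hk : ∀ a : O, ∃ c : k, a - algebraMap k O c ∈ maximalIdeal O)
    (hli : LinearIndependent O (fun i => KaehlerDifferential.D k O (t i)))
    (hspan : Submodule.span O (Set.range fun i => KaehlerDifferential.D k O (t i)) = ⊤)
    {r s : ℕ} {a b : O} (ha : a ∈ maximalIdeal O ^ r) (ha' : a ∉ maximalIdeal O ^ (r + 1))
    (hb : b ∈ maximalIdeal O ^ s) (hb' : b ∉ maximalIdeal O ^ (s + 1)) :
    a * b ∉ maximalIdeal O ^ (r + s + 1) := by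
  intro hab
  obtain ⟨F, hF, hFa⟩ := exists_isHomogeneous_aeval_sub_mem_pow hm hk r a ha
  obtain ⟨G, hG, hGb⟩ := exists_isHomogeneous_aeval_sub_mem_pow hm hk s b hb
  have hF0 : F ≠ 0 := by rintro rfl; exact ha' (by simpa using hFa)
  have hG0 : G ≠ 0 := by rintro rfl; exact hb' (by simpa using hGb)
  refine mul_ne_zero hF0 hG0 (eq_zero_of_aeval_mem_pow hm hk hli hspan (hF.mul hG) ?_)
  have hFm : aeval t F ∈ maximalIdeal O ^ r := by
    have := Ideal.sub_mem _ ha (Ideal.pow_le_pow_right (Nat.le_succ r) hFa)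
    simpa using this
  have h1 : (a - aeval t F) * b ∈ maximalIdeal O ^ (r + s + 1) := by
    rw [show r + s + 1 = r + 1 + s by ring, pow_add]; exact Ideal.mul_mem_mul hFa hb
  have h2 : aeval t F * (b - aeval t G) ∈ maximalIdeal O ^ (r + s + 1) := by
    rw [add_assoc, pow_add]; exact Ideal.mul_mem_mul hFm hGb
  rw [map_mul]
  convert Ideal.sub_mem _ hab (Ideal.add_mem _ h1 h2) using 1
  ring

/-- The order valuation of a local domain whose graded ring has no zero divisors. -/
theorem exists_valuation_le_exp_iff (K : Type u) [Field K] [Algebra O K] [IsFractionRing O K]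
    [IsDomain O] [IsNoetherianRing O]
    (hmul : ∀ (r s : ℕ) (a b : O), a ∈ maximalIdeal O ^ r → a ∉ maximalIdeal O ^ (r + 1) →
      b ∈ maximalIdeal O ^ s → b ∉ maximalIdeal O ^ (s + 1) →
      a * b ∉ maximalIdeal O ^ (r + s + 1)) :
    ∃ v : Valuation K (WithZero (Multiplicative ℤ)), ∀ (a : O) (r : ℕ),
      v (algebraMap O K a) ≤ WithZero.exp (-(r : ℤ)) ↔ a ∈ maximalIdeal O ^ r := by
  classical
  set m := maximalIdeal O with hm
  have hex : ∀ a : O, a ≠ 0 → ∃ r, a ∉ m ^ (r + 1) := by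
    intro a ha
    by_contra hcon
    push Not at hcon
    -- Krull's intersection theorem makes the order of a nonzero element finite.
    have : a ∈ (⨅ i, m ^ i : Ideal O) := by
      rw [Ideal.mem_iInf]
      rintro (_ | r)
      · simp
      · exact hcon r
    rw [Ideal.iInf_pow_eq_bot_of_isLocalRing m (maximalIdeal.isMaximal O).ne_top] at this
    exact ha (by simpa using this)
  have hord : ∀ a : O, a ≠ 0 → ∃ r, a ∈ m ^ r ∧ a ∉ m ^ (r + 1) := by
    intro a ha
    refine ⟨Nat.find (hex a ha), ?_, Nat.find_spec (hex a ha)⟩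
    rcases hr : Nat.find (hex a ha) with _ | r
    · simp
    · by_contra hc
      exact Nat.find_min (hex a ha) (m := r) (by omega) hc
  choose! o ho ho' using hord
  have hle : ∀ a : O, a ≠ 0 → ∀ r, a ∈ m ^ r ↔ r ≤ o a := by
    intro a ha r
    refine ⟨fun h => ?_, fun h => Ideal.pow_le_pow_right h (ho a ha)⟩
    by_contra hlt
    exact ho' a ha (Ideal.pow_le_pow_right (by omega) h)
  have homul : ∀ a b : O, a ≠ 0 → b ≠ 0 → o (a * b) = o a + o b := by
    intro a b ha hb
    have hab := mul_ne_zero ha hb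
    refine le_antisymm ?_ ?_
    · by_contra hlt
      refine hmul _ _ a b (ho a ha) (ho' a ha) (ho b hb) (ho' b hb) ?_
      rw [hle _ hab]; omega
    · rw [← hle _ hab, pow_add]
      exact Ideal.mul_mem_mul (ho a ha) (ho b hb)
  let f : O → WithZero (Multiplicative ℤ) := fun a => if a = 0 then 0 else WithZero.exp (-(o a : ℤ))
  have hf : ∀ (a : O) (r : ℕ), f a ≤ WithZero.exp (-(r : ℤ)) ↔ a ∈ m ^ r := by
    intro a r
    by_cases ha : a = 0
    · simp [f, ha]
    · simp only [f, if_neg ha, WithZero.exp_le_exp, neg_le_neg_iff, Nat.cast_le]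
      exact (hle a ha r).symm
  let w : Valuation O (WithZero (Multiplicative ℤ)) :=
    { toFun := f
      map_zero' := by simp [f]
      map_one' := by
        have h1 : o 1 = 0 := by
          have := homul 1 1 one_ne_zero one_ne_zero
          rw [one_mul] at this; omega
        simp [f, h1]
      map_mul' := fun a b => by
        by_cases ha : a = 0
        · simp [f, ha]
        by_cases hb : b = 0
        · simp [f, hb]
        simp only [f, if_neg ha, if_neg hb, if_neg (mul_ne_zero ha hb), homul a b ha hb]
        rw [← WithZero.exp_add]; congr 1; push_cast; ring
      map_add_le_max' := fun a b => by
        by_cases ha : a = 0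
        · simp [ha]
        by_cases hb : b = 0
        · simp [hb]
        have key : f (a + b) ≤ WithZero.exp (-((min (o a) (o b) : ℕ) : ℤ)) := by
          rw [hf]
          exact Ideal.add_mem _ ((hle a ha _).mpr (min_le_left _ _))
            ((hle b hb _).mpr (min_le_right _ _))
        refine key.trans ?_
        simp only [f, if_neg ha, if_neg hb]
        rcases min_choice (o a) (o b) with h | h <;> rw [h]
        · exact le_max_left _ _
        · exact le_max_right _ _ }
  have hsupp : nonZeroDivisors O ≤ w.supp.primeCompl := by
    intro a ha hmem
    have h1 : f a = 0 := hmem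
    simp [f, nonZeroDivisors.ne_zero ha] at h1
  refine ⟨w.extendToLocalization hsupp K, fun a r => ?_⟩
  rw [Valuation.extendToLocalization_apply_map_apply]
  exact hf a r

end Coordinates

/-! ### The chart of the blow-up -/

section Chart

open IsLocalRing

/-- A Noetherian local integrally closed domain of dimension one is a discrete valuation ring. -/
theorem isDiscreteValuationRing_of_ringKrullDim_eq_one (L : Type*) [CommRing L] [IsDomain L]
    [IsLocalRing L] [IsNoetherianRing L] [IsIntegrallyClosed L] (hdim : ringKrullDim L = 1) :
    IsDiscreteValuationRing L := by
  have hF : ¬ IsField L := fun h => by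
    have := ringKrullDim_eq_zero_of_isField h
    rw [hdim] at this
    exact one_ne_zero this
  have hle : Ring.KrullDimLE 1 L := by
    rw [Ring.krullDimLE_iff, hdim]; rfl
  have hmax : maximalIdeal L ≠ ⊥ := fun h => hF (isField_iff_maximalIdeal_eq.mpr h)
  have h4 : IsIntegrallyClosed L ∧ ∃! Q : Ideal L, Q ≠ ⊥ ∧ Q.IsPrime := by
    refine ⟨inferInstance, maximalIdeal L, ⟨hmax, inferInstance⟩, ?_⟩
    rintro Q ⟨hQ, hQp⟩
    exact eq_maximalIdeal (Ring.krullDimLE_one_iff_of_isPrime_bot.mp hle Q hQ hQp)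
  exact ((IsDiscreteValuationRing.TFAE L hF).out 0 3).mpr h4

/-- The localization of `C` at the center of `v` is a discrete valuation ring, so one of `y` and its
inverse has a denominator outside `E`. -/
theorem exists_mul_eq_of_valuation_le_one {C K Γ : Type*} [CommRing C] [IsDomain C]
    [IsNoetherianRing C] [IsIntegrallyClosed C] [Field K] [Algebra C K] [IsFractionRing C K]
    [LinearOrderedCommGroupWithZero Γ] (v : Valuation K Γ) (E : Ideal C) [E.IsPrime]
    (hv : ∀ c : C, v (algebraMap C K c) ≤ 1) (hE : ∀ c, c ∈ E ↔ v (algebraMap C K c) < 1)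
    (hheight : E.height = 1) (y : K) (hy : v y ≤ 1) :
    ∃ c s : C, v (algebraMap C K s) = 1 ∧ y * algebraMap C K s = algebraMap C K c := by
  let L := Localization.AtPrime E
  have hinjL : Function.Injective (algebraMap C L) :=
    IsLocalization.injective L E.primeCompl_le_nonZeroDivisors
  have : IsDomain L := IsLocalization.isDomain_localization E.primeCompl_le_nonZeroDivisors
  have : IsIntegrallyClosed L :=
    isIntegrallyClosed_of_isLocalization L E.primeCompl E.primeCompl_le_nonZeroDivisors
  have : IsNoetherianRing L := IsLocalization.isNoetherianRing E.primeCompl L inferInstance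
  have : IsDiscreteValuationRing L := isDiscreteValuationRing_of_ringKrullDim_eq_one L (by
    rw [IsLocalization.AtPrime.ringKrullDim_eq_height E L, hheight]; rfl)
  have hnot : ∀ c : C, c ∉ E → v (algebraMap C K c) = 1 := fun c hc =>
    le_antisymm (hv c) (not_lt.mp fun h => hc ((hE c).mpr h))
  have hdvd : ∀ a b : C, algebraMap C L a ∣ algebraMap C L b → ∃ s ∉ E, ∃ c, s * b = a * c := by
    rintro a b ⟨q, hq⟩
    obtain ⟨c, s, rfl⟩ := IsLocalization.exists_mk'_eq E.primeCompl q
    refine ⟨s, s.2, c, hinjL ?_⟩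
    rw [map_mul, hq, map_mul, mul_left_comm, IsLocalization.mk'_spec']
  obtain ⟨a, b, hb, rfl⟩ := IsFractionRing.div_surjective (A := C) y
  have hb0 : algebraMap C K b ≠ 0 := IsFractionRing.to_map_ne_zero_of_mem_nonZeroDivisors hb
  rcases ValuationRing.dvd_total (algebraMap C L b) (algebraMap C L a) with h | h
  · obtain ⟨s, hs, c, hc⟩ := hdvd _ _ h
    refine ⟨c, s, hnot s hs, ?_⟩
    have := congrArg (algebraMap C K) hc
    rw [map_mul, map_mul] at this
    rw [div_mul_eq_mul_div, div_eq_iff hb0, mul_comm (algebraMap C K a), this, mul_comm]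
  · obtain ⟨s, hs, c, hc⟩ := hdvd _ _ h
    have := congrArg (algebraMap C K) hc
    rw [map_mul, map_mul] at this
    have hs0 : algebraMap C K s ≠ 0 := fun h0 => by
      have := hnot s hs
      rw [h0, map_zero] at this
      exact zero_ne_one this
    have hac : algebraMap C K a * algebraMap C K c ≠ 0 := this ▸ mul_ne_zero hs0 hb0
    have hc0 := right_ne_zero_of_mul hac
    have heq : algebraMap C K a / algebraMap C K b * algebraMap C K c = algebraMap C K s := by
      rw [div_mul_eq_mul_div, div_eq_iff hb0, this]
    -- When it is the inverse that is regular, `v y ≤ 1` and `v s = 1` force `v c = 1`, so `c` can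
    -- serve as the denominator of `y`.
    refine ⟨s, c, le_antisymm (hv c) ?_, heq⟩
    have h1 := congrArg v heq
    rw [map_mul, hnot s hs] at h1
    rw [← h1]
    exact mul_le_of_le_one_left' hy

variable {k O K : Type u} [Field k] [CommRing O] [Algebra k O] [Field K] [Algebra k K] [Algebra O K]
  [IsScalarTower k O K]

/-- If `Ω[O⁄k]` is generated by the differentials of elements which lie in the subfield `F` of
the fraction field `K` of `O`, then `K` is a finite separable extension of `F`. -/
theorem finite_and_isSeparable_of_span_D [IsDomain O] [IsFractionRing O K]
    [Algebra.EssFiniteType k O] {ι : Type*} {t : ι → O}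
    (hspan : Submodule.span O (Set.range fun i => KaehlerDifferential.D k O (t i)) = ⊤)
    (F : Type u) [Field F] [Algebra k F] [Algebra F K] [IsScalarTower k F K]
    (hF : ∀ i, ∃ f : F, algebraMap F K f = algebraMap O K (t i)) :
    Module.Finite F K ∧ Algebra.IsSeparable F K := by
  have : Algebra.EssFiniteType O K := Algebra.EssFiniteType.of_isLocalization K (nonZeroDivisors O)
  have : Algebra.EssFiniteType k K := Algebra.EssFiniteType.comp k O K
  have : Algebra.EssFiniteType F K := Algebra.EssFiniteType.of_comp k F K
  -- The universal derivation over `F` kills all `t i`, hence all of `O`, hence all fractions. So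
  -- `Ω[K⁄F] = 0`, and an essentially finite type extension that is unramified is finite separable.
  let δ : Derivation k O (Ω[K⁄F]) :=
    ((KaehlerDifferential.D F K).restrictScalars k).compAlgebraMap O
  have hδ : δ.liftKaehlerDifferential = 0 := by
    refine LinearMap.ext_on_range hspan fun i => ?_
    rw [Derivation.liftKaehlerDifferential_comp_D, LinearMap.zero_apply]
    obtain ⟨f, hf⟩ := hF i
    change KaehlerDifferential.D F K (algebraMap O K (t i)) = 0
    rw [← hf, Derivation.map_algebraMap]
  have hO : ∀ a : O, KaehlerDifferential.D F K (algebraMap O K a) = 0 := fun a => by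
    change δ a = 0
    rw [← Derivation.liftKaehlerDifferential_comp_D, hδ, LinearMap.zero_apply]
  have hD : ∀ y : K, KaehlerDifferential.D F K y = 0 := by
    intro y
    obtain ⟨a, b, hb, rfl⟩ := IsFractionRing.div_surjective (A := O) y
    have hb0 : algebraMap O K b ≠ 0 := IsFractionRing.to_map_ne_zero_of_mem_nonZeroDivisors hb
    have h1 := hO a
    rw [← div_mul_cancel₀ (algebraMap O K a) hb0, Derivation.leibniz, hO b, smul_zero, zero_add]
      at h1
    exact (smul_eq_zero.mp h1).resolve_left hb0
  have : Algebra.FormallyUnramified F K := by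
    constructor
    refine ⟨fun x y => ?_⟩
    have htop : (⊤ : Submodule K (Ω[K⁄F])) = ⊥ := by
      rw [← KaehlerDifferential.span_range_derivation, Submodule.span_eq_bot]
      rintro _ ⟨y, rfl⟩
      exact hD y
    have hx : x ∈ (⊤ : Submodule K (Ω[K⁄F])) := trivial
    have hy : y ∈ (⊤ : Submodule K (Ω[K⁄F])) := trivial
    rw [htop, Submodule.mem_bot] at hx hy
    rw [hx, hy]
  exact ⟨Algebra.FormallyUnramified.finite_of_free F K, Algebra.FormallyUnramified.isSeparable F K⟩

/-- Dehomogenization: a nonzero polynomial in the ratios `t i / t 0` is the quotient of a nonzero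
form in the `t i` by a power of `t 0`. -/
theorem exists_isHomogeneous_aeval_eq {d : ℕ} {t : Fin (d + 1) → O}
    (ht : algebraMap O K (t 0) ≠ 0) (Q : MvPolynomial (Fin d) k) (hQ : Q ≠ 0) :
    ∃ F : MvPolynomial (Fin (d + 1)) k, F ≠ 0 ∧ F.IsHomogeneous Q.totalDegree ∧
      algebraMap O K (MvPolynomial.aeval t F) = algebraMap O K (t 0) ^ Q.totalDegree *
        MvPolynomial.aeval (fun i : Fin d => algebraMap O K (t i.succ) / algebraMap O K (t 0)) Q := by
  classical
  set e := Q.totalDegree with he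
  let F : MvPolynomial (Fin (d + 1)) k :=
    ∑ s ∈ Q.support, MvPolynomial.monomial (Finsupp.cons (e - s.degree) s) (Q.coeff s)
  have hdeg : ∀ s ∈ Q.support, s.degree ≤ e := fun s hs => MvPolynomial.le_totalDegree hs
  refine ⟨F, ?_, ?_, ?_⟩
  · obtain ⟨s, hs⟩ := MvPolynomial.ne_zero_iff.mp hQ
    intro h0
    have h1 : F.coeff (Finsupp.cons (e - s.degree) s) = Q.coeff s := by
      simp only [F, MvPolynomial.coeff_sum, MvPolynomial.coeff_monomial]
      rw [Finset.sum_eq_single s]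
      · simp
      · intro b _ hbs
        rw [if_neg]
        intro h
        apply hbs
        have := congrArg Finsupp.tail h
        rwa [Finsupp.tail_cons, Finsupp.tail_cons] at this
      · intro h
        simp [MvPolynomial.notMem_support_iff.mp h]
    rw [h0, MvPolynomial.coeff_zero] at h1
    exact hs h1.symm
  · refine MvPolynomial.IsHomogeneous.sum _ _ _ fun s hs => ?_
    apply MvPolynomial.isHomogeneous_monomial
    have := hdeg s hs
    rw [Finsupp.degree_eq_sum] at this ⊢
    rw [Fin.sum_univ_succ]
    simp only [Finsupp.cons_zero, Finsupp.cons_succ]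
    rw [Finsupp.degree_eq_sum]
    omega
  · rw [MvPolynomial.aeval_def _ Q, MvPolynomial.eval₂_eq', map_sum, map_sum, Finset.mul_sum]
    refine Finset.sum_congr rfl fun s hs => ?_
    rw [MvPolynomial.aeval_monomial, map_mul, ← IsScalarTower.algebraMap_apply,
      Finsupp.prod_fintype _ _ (by simp), Fin.prod_univ_succ]
    simp only [Finsupp.cons_zero, Finsupp.cons_succ, map_mul, map_pow, map_prod, div_pow,
      Finset.prod_div_distrib]
    rw [Finset.prod_pow_eq_pow_sum, ← Finsupp.degree_eq_sum]
    have h2 : algebraMap O K (t 0) ^ e = algebraMap O K (t 0) ^ (e - s.degree) *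
        algebraMap O K (t 0) ^ s.degree := by
      rw [← pow_add, Nat.sub_add_cancel (hdeg s hs)]
    rw [h2]
    field_simp

/-- If `R → K` sends a ring into the valuation ring of `v` and the elements of positive valuation
are the multiples of the nonzero element `π`, then the integral closure of `R` in a finite separable
extension of its fraction field has the valuation ring of `v` as a localization. -/
theorem exists_mul_eq_of_integralClosure {R Γ : Type*} [CommRing R] [IsDomain R]
    [IsNoetherianRing R] [IsIntegrallyClosed R] [Algebra R K] [LinearOrderedCommGroupWithZero Γ]
    (v : Valuation K Γ) (F : Type*) [Field F] [Algebra R F] [IsFractionRing R F] [Algebra F K]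
    [IsScalarTower R F K] [Module.Finite F K] [Algebra.IsSeparable F K]
    (hv : ∀ r : R, v (algebraMap R K r) ≤ 1) (π : R) (hπ : π ≠ 0)
    (hvπ : ∀ r, v (algebraMap R K r) < 1 ↔ π ∣ r) :
    (∀ c : integralClosure R K, v c ≤ 1) ∧
    ∀ y : K, v y ≤ 1 → ∃ c s : integralClosure R K, v s = 1 ∧ y * s = c := by
  let C := integralClosure R K
  have : Module.Finite R C := IsIntegralClosure.finite R F K C
  have : IsNoetherianRing C := IsNoetherianRing.of_finite R C
  have : IsIntegrallyClosed C := integralClosure.isIntegrallyClosedOfFiniteExtension F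
  have : IsFractionRing C K := integralClosure.isFractionRing_of_finite_extension F K
  have hRK : Function.Injective (algebraMap R K) := by
    rw [IsScalarTower.algebraMap_eq R F K]
    exact (algebraMap F K).injective.comp (IsFractionRing.injective R F)
  have hC : ∀ c : C, v c ≤ 1 := by
    intro c
    obtain ⟨p, hp, hpc⟩ := c.2
    refine (Valuation.integer.integers v).mem_of_integral (x := (c : K))
      ⟨p.map ((algebraMap R K).codRestrict v.integer hv), hp.map _, ?_⟩
    rw [Polynomial.eval₂_map]
    exact hpc
  let E : Ideal C :=
    { carrier := {c | v (c : K) < 1}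
      add_mem' := fun {a b} ha hb => v.map_add_lt ha hb
      zero_mem' := by simp
      smul_mem' := fun c a ha => by
        change v ((c : K) * (a : K)) < 1
        rw [map_mul]
        exact mul_lt_one_of_nonneg_of_lt_one_right (hC c) zero_le ha }
  have hEprime : E.IsPrime := by
    refine ⟨?_, ?_⟩
    · rw [Ideal.ne_top_iff_one]
      change ¬ v ((1 : C) : K) < 1
      simp
    · intro a b hab
      by_contra hcon
      push Not at hcon
      have h1 : v (a : K) = 1 := le_antisymm (hC a) (not_lt.mp hcon.1)
      have h2 : v (b : K) = 1 := le_antisymm (hC b) (not_lt.mp hcon.2)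
      have h3 : v ((a : K) * (b : K)) < 1 := hab
      rw [map_mul, h1, h2, one_mul] at h3
      exact lt_irrefl _ h3
  have hER : ∀ r : R, algebraMap R C r ∈ E ↔ π ∣ r := fun r => hvπ r
  have hheight : E.height = 1 := by
    refine le_antisymm ?_ (Order.one_le_iff_pos.mpr ?_)
    · have hmin : E ∈ (Ideal.span {algebraMap R C π}).minimalPrimes := by
        refine ⟨⟨hEprime, ?_⟩, ?_⟩
        · rw [Ideal.span_singleton_le_iff_mem, hER]
        · rintro q ⟨hq, hπq⟩ hqE
          rw [Ideal.span_singleton_le_iff_mem] at hπq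
          by_contra hcon
          have hlt : q < E := lt_of_le_not_ge hqE hcon
          have h1 := Ideal.IsIntegral.comap_lt_comap (R := R) hlt
          refine h1.not_ge ?_
          intro r hr
          obtain ⟨b, rfl⟩ := (hER r).mp hr
          rw [Ideal.mem_comap, map_mul]
          exact q.mul_mem_right _ hπq
      exact Ideal.height_le_one_of_isPrincipal_of_mem_minimalPrimes _ _ hmin
    · rw [pos_iff_ne_zero, Ne, Ideal.height_eq_zero_iff_eq_bot]
      intro h
      have h1 : algebraMap R C π ∈ E := (hER π).mpr dvd_rfl
      rw [h, Ideal.mem_bot] at h1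
      apply hπ
      apply hRK
      rw [map_zero, IsScalarTower.algebraMap_apply R C K, h1, map_zero]
  exact ⟨hC, fun y hy => exists_mul_eq_of_valuation_le_one v E hC (fun c => Iff.rfl) hheight y hy⟩

/-- The evaluation at an element `τ` of positive valuation of polynomials with coefficients of
valuation zero. -/
theorem valuation_eval₂ {B Γ : Type*} [CommRing B] [LinearOrderedCommGroupWithZero Γ]
    (v : Valuation K Γ) (φ : B →+* K) (hφ : ∀ b, b ≠ 0 → v (φ b) = 1) {τ : K} (hτ0 : τ ≠ 0)
    (hτ1 : v τ < 1) :
    (∀ P, v (Polynomial.eval₂RingHom φ τ P) ≤ 1) ∧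
    (∀ P, v (Polynomial.eval₂RingHom φ τ P) < 1 ↔ Polynomial.X ∣ P) ∧
    Function.Injective (Polynomial.eval₂RingHom φ τ) := by
  set ρ := Polynomial.eval₂RingHom φ τ with hρdef
  -- Splitting off the constant coefficient decides the value: the first summand has value less than
  -- one, and the second has value one unless it is zero.
  have hρ : ∀ P, ρ P = ρ P.divX * τ + φ (P.coeff 0) := by
    intro P
    conv_lhs => rw [← Polynomial.divX_mul_X_add P]
    simp [ρ]
  have hρle : ∀ P, v (ρ P) ≤ 1 := by
    intro P
    have : ∀ b, v (φ b) ≤ 1 := fun b => by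
      by_cases h : b = 0
      · simp [h]
      · exact (hφ b h).le
    simp only [ρ, Polynomial.coe_eval₂RingHom, Polynomial.eval₂_eq_sum_range]
    refine v.map_sum_le fun i _ => ?_
    rw [map_mul, map_pow]
    exact mul_le_one' (this _) (pow_le_one' hτ1.le _)
  have hρlt : ∀ P, v (ρ P) < 1 ↔ Polynomial.X ∣ P := by
    intro P
    have h1 : v (ρ P.divX * τ) < 1 := by
      rw [map_mul]
      exact mul_lt_one_of_nonneg_of_lt_one_right (hρle _) zero_le hτ1
    rw [Polynomial.X_dvd_iff, hρ P]
    constructor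
    · intro h
      by_contra h0
      have h2 := v.map_sub_lt h h1
      rw [add_sub_cancel_left, hφ _ h0] at h2
      exact lt_irrefl _ h2
    · intro h
      rw [h, map_zero, add_zero]
      exact h1
  refine ⟨hρle, hρlt, ?_⟩
  rw [injective_iff_map_eq_zero]
  intro P
  -- A polynomial in the kernel has value zero, so it is divisible by `X`. Since `τ` is nonzero the
  -- quotient is again in the kernel, with smaller degree.
  induction hn : P.natDegree using Nat.strong_induction_on generalizing P with
  | _ n ih =>
    intro h0
    by_contra hP
    have hX : Polynomial.X ∣ P := (hρlt P).mp (by rw [h0, map_zero]; exact zero_lt_one)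
    obtain ⟨P', rfl⟩ := hX
    have hP' : P' ≠ 0 := right_ne_zero_of_mul hP
    have : Nontrivial B := ⟨P'.leadingCoeff, 0, Polynomial.leadingCoeff_ne_zero.mpr hP'⟩
    refine hP' (ih P'.natDegree ?_ P' rfl ?_)
    · rw [← hn, Polynomial.natDegree_X_mul hP']; omega
    · rw [map_mul] at h0
      refine (mul_eq_zero.mp h0).resolve_left ?_
      simpa [ρ] using hτ0

/-- The integral closure of `R` has the right local ring at the center of `v` but need not contain
`A`. Inverting the denominators of finitely many generators of `A` repairs this without losing
finite generation or normality. -/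
theorem exists_chart_of_isIntegrallyClosed {R Γ : Type*} [CommRing R] [IsDomain R]
    [IsNoetherianRing R] [IsIntegrallyClosed R] [Algebra k R] [Algebra.FiniteType k R]
    [Algebra R K] [IsScalarTower k R K] [LinearOrderedCommGroupWithZero Γ]
    (v : Valuation K Γ) (F : Type*) [Field F] [Algebra R F] [IsFractionRing R F] [Algebra F K]
    [IsScalarTower R F K] [Module.Finite F K] [Algebra.IsSeparable F K]
    (hv : ∀ r : R, v (algebraMap R K r) ≤ 1) (π : R) (hπ : π ≠ 0)
    (hvπ : ∀ r, v (algebraMap R K r) < 1 ↔ π ∣ r)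
    (A : Subalgebra k K) (hA : A.FG) (hAv : ∀ a ∈ A, v a ≤ 1) :
    ∃ C : Subalgebra k K, A ≤ C ∧ C.FG ∧ IsIntegrallyClosed C ∧ (∀ c ∈ C, v c ≤ 1) ∧
      ∀ y, v y ≤ 1 → ∃ c ∈ C, ∃ s ∈ C, v s = 1 ∧ y * s = c := by
  classical
  obtain ⟨hC1, hC2⟩ := exists_mul_eq_of_integralClosure v F hv π hπ hvπ
  let C := integralClosure R K
  have : Module.Finite R C := IsIntegralClosure.finite R F K C
  have : IsIntegrallyClosed C := integralClosure.isIntegrallyClosedOfFiniteExtension F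
  have : IsFractionRing C K := integralClosure.isFractionRing_of_finite_extension F K
  obtain ⟨S, rfl⟩ := hA
  choose! c s hs hcs using fun a (ha : a ∈ S) => hC2 a (hAv a (Algebra.subset_adjoin ha))
  -- All these denominators have value one, so inverting their product keeps the ring inside the
  -- valuation ring.
  let g : C := ∏ a ∈ S, s a
  have hg : v (g : K) = 1 := by
    simp only [g]
    rw [show ((∏ a ∈ S, s a : C) : K) = ∏ a ∈ S, (s a : K) from map_prod C.val s S, map_prod]
    exact Finset.prod_eq_one hs
  have hg0 : (g : K) ≠ 0 := fun h => by rw [h, map_zero] at hg; exact zero_ne_one hg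
  have hM : Submonoid.powers g ≤ nonZeroDivisors C :=
    powers_le_nonZeroDivisors_of_noZeroDivisors fun h => hg0 (by rw [h]; rfl)
  let C' : Subalgebra C K := Localization.subalgebra.ofField K (Submonoid.powers g) hM
  have hmem : ∀ y : K, y ∈ C' ↔ ∃ (c : C) (n : ℕ), y = (c : K) * ((g : K) ^ n)⁻¹ := by
    intro y
    constructor
    · rintro ⟨a, b, ⟨n, rfl⟩, h⟩
      exact ⟨a, n, by rw [h, map_pow]; rfl⟩
    · rintro ⟨a, n, h⟩
      exact ⟨a, g ^ n, ⟨n, rfl⟩, by rw [h, map_pow]; rfl⟩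
  refine ⟨C'.restrictScalars k, ?_, ?_, ?_, ?_, ?_⟩
  · rw [Algebra.adjoin_le_iff]
    intro a ha
    rw [SetLike.mem_coe, Subalgebra.mem_restrictScalars, hmem]
    have ha' : a ∈ S := ha
    refine ⟨c a * ∏ b ∈ S.erase a, s b, 1, ?_⟩
    have h1 : (g : K) = s a * ∏ b ∈ S.erase a, (s b : K) := by
      rw [Finset.mul_prod_erase S (fun b => (s b : K)) ha']
      exact map_prod C.val s S
    have h2 : ((∏ b ∈ S.erase a, s b : C) : K) = ∏ b ∈ S.erase a, (s b : K) :=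
      map_prod C.val s _
    rw [pow_one, eq_mul_inv_iff_mul_eq₀ hg0, h1, ← mul_assoc, hcs a ha', ← h2]
    rfl
  · rw [Subalgebra.fg_iff_finiteType]
    have h1 : Algebra.FiniteType R C := inferInstance
    have h2 : Algebra.FiniteType k C := Algebra.FiniteType.trans ‹Algebra.FiniteType k R› h1
    have h3 : Algebra.FiniteType C C' :=
      IsLocalization.finiteType_of_monoid_fg (Submonoid.powers g) C'
    have h4 : Algebra.FiniteType k C' := Algebra.FiniteType.trans h2 h3
    exact h4
  · have : IsIntegrallyClosed C' := isIntegrallyClosed_of_isLocalization C' (Submonoid.powers g) hM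
    exact this
  · intro y hy
    rw [Subalgebra.mem_restrictScalars, hmem] at hy
    obtain ⟨a, n, rfl⟩ := hy
    rw [map_mul, map_inv₀, map_pow, hg, one_pow, inv_one, mul_one]
    exact hC1 a
  · intro y hy
    obtain ⟨a, b, hb, hab⟩ := hC2 y hy
    have hin : ∀ a : C, (a : K) ∈ C'.restrictScalars k := fun a => by
      rw [Subalgebra.mem_restrictScalars, hmem]
      exact ⟨a, 0, by simp⟩
    exact ⟨a, hin a, b, hin b, hb, hab⟩

/-- An affine normal variety with function field `K` on which the order valuation `v` of the smooth
local ring `O` is centered at a divisor. -/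
theorem exists_chart [IsDomain O] [IsFractionRing O K] [Algebra.EssFiniteType k O] {d : ℕ}
    {t : Fin (d + 1) → O}
    (hspan : Submodule.span O (Set.range fun i => KaehlerDifferential.D k O (t i)) = ⊤)
    (v : Valuation K (WithZero (Multiplicative ℤ)))
    (hform : ∀ (e : ℕ) (F : MvPolynomial (Fin (d + 1)) k), F ≠ 0 → F.IsHomogeneous e →
      v (algebraMap O K (MvPolynomial.aeval t F)) = WithZero.exp (-(e : ℤ)))
    (A : Subalgebra k K) (hA : A.FG) (hAv : ∀ a ∈ A, v a ≤ 1) :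
    ∃ C : Subalgebra k K, A ≤ C ∧ C.FG ∧ IsIntegrallyClosed C ∧ (∀ c ∈ C, v c ≤ 1) ∧
      ∀ y, v y ≤ 1 → ∃ c ∈ C, ∃ s ∈ C, v s = 1 ∧ y * s = c := by
  set τ : K := algebraMap O K (t 0) with hτ
  have hvτ : v τ = WithZero.exp (-1) := by
    have := hform 1 (MvPolynomial.X 0) (MvPolynomial.X_ne_zero 0) (MvPolynomial.isHomogeneous_X _ _)
    simpa using this
  have hτ0 : τ ≠ 0 := fun h => by rw [h, map_zero] at hvτ; exact WithZero.exp_ne_zero hvτ.symm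
  have hτ1 : v τ < 1 := by
    rw [hvτ, ← WithZero.exp_zero, WithZero.exp_lt_exp]; norm_num
  let w : Fin d → K := fun i => algebraMap O K (t i.succ) / τ
  let φ : MvPolynomial (Fin d) k →+* K := (MvPolynomial.aeval w).toRingHom
  -- A polynomial of degree `e` in the ratios is a form of degree `e` divided by `t 0 ^ e`, and both
  -- have value `exp (-e)`. In particular the ratios are algebraically independent.
  have hQ : ∀ Q, Q ≠ 0 → v (φ Q) = 1 := by
    intro Q hQ
    obtain ⟨F, hF0, hF, hFQ⟩ := exists_isHomogeneous_aeval_eq (K := K) hτ0 Q hQ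
    have h1 := hform _ F hF0 hF
    rw [hFQ, map_mul, map_pow, hvτ, ← WithZero.exp_nsmul] at h1
    have h2 : Q.totalDegree • (-1 : ℤ) = -(Q.totalDegree : ℤ) := by simp
    rw [h2] at h1
    exact mul_left_cancel₀ WithZero.exp_ne_zero (h1.trans (mul_one _).symm)
  obtain ⟨hρle, hρlt, hρinj⟩ := valuation_eval₂ v φ hQ hτ0 hτ1
  -- The coordinate ring of the standard blow-up chart of affine space: the inner variables are the
  -- ratios `t i / t 0`, and the outer variable, which is `t 0`, defines the exceptional divisor.
  let _ : Algebra (Polynomial (MvPolynomial (Fin d) k)) K := (Polynomial.eval₂RingHom φ τ).toAlgebra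
  have : IsScalarTower k (Polynomial (MvPolynomial (Fin d) k)) K :=
    IsScalarTower.of_algebraMap_eq fun c => by
      change _ = Polynomial.eval₂RingHom φ τ (Polynomial.C (MvPolynomial.C c))
      simp [φ]
  have : FaithfulSMul (Polynomial (MvPolynomial (Fin d) k)) K :=
    (faithfulSMul_iff_algebraMap_injective _ K).mpr hρinj
  let _ := FractionRing.liftAlgebra (Polynomial (MvPolynomial (Fin d) k)) K
  have := FractionRing.isScalarTower_liftAlgebra (Polynomial (MvPolynomial (Fin d) k)) K
  have : IsScalarTower k (FractionRing (Polynomial (MvPolynomial (Fin d) k))) K :=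
    IsScalarTower.of_algebraMap_eq fun c => by
      rw [IsScalarTower.algebraMap_apply k (Polynomial (MvPolynomial (Fin d) k)) K,
        IsScalarTower.algebraMap_apply (Polynomial (MvPolynomial (Fin d) k))
          (FractionRing (Polynomial (MvPolynomial (Fin d) k))) K,
        ← IsScalarTower.algebraMap_apply k (Polynomial (MvPolynomial (Fin d) k))]
  obtain ⟨hfin, hsep⟩ := finite_and_isSeparable_of_span_D (K := K) hspan
    (FractionRing (Polynomial (MvPolynomial (Fin d) k))) (fun i => by
    refine Fin.cases ?_ (fun j => ?_) i
    · refine ⟨algebraMap (Polynomial (MvPolynomial (Fin d) k)) _ Polynomial.X, ?_⟩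
      rw [← IsScalarTower.algebraMap_apply]
      change Polynomial.eval₂RingHom φ τ _ = _
      simp [hτ]
    · refine ⟨algebraMap (Polynomial (MvPolynomial (Fin d) k)) _
        (Polynomial.C (MvPolynomial.X j) * Polynomial.X), ?_⟩
      rw [← IsScalarTower.algebraMap_apply]
      change Polynomial.eval₂RingHom φ τ _ = _
      simp [φ, w, div_mul_cancel₀ _ hτ0])
  have : Algebra.FiniteType k (Polynomial (MvPolynomial (Fin d) k)) :=
    Algebra.FiniteType.trans (S := MvPolynomial (Fin d) k) inferInstance inferInstance
  exact exists_chart_of_isIntegrallyClosed v (FractionRing (Polynomial (MvPolynomial (Fin d) k)))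
    hρle Polynomial.X Polynomial.X_ne_zero hρlt A hA hAv

/-- The differentials of the valuation ring `L` of the order valuation are generated by the
differentials of the coordinates of the blow-up. -/
theorem span_D_eq_top_of_valuation [IsDomain O] [IsLocalRing O] [IsFractionRing O K] {d : ℕ}
    {t : Fin (d + 1) → O} (hm : maximalIdeal O = Ideal.span (Set.range t))
    (hspan : Submodule.span O (Set.range fun i => KaehlerDifferential.D k O (t i)) = ⊤)
    (v : Valuation K (WithZero (Multiplicative ℤ)))
    (hv : ∀ (a : O) (r : ℕ),
      v (algebraMap O K a) ≤ WithZero.exp (-(r : ℤ)) ↔ a ∈ maximalIdeal O ^ r)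
    (hvτ : v (algebraMap O K (t 0)) = WithZero.exp (-1))
    (L : Type u) [CommRing L] [Algebra k L] [Algebra L K] [IsScalarTower k L K]
    (hinj : Function.Injective (algebraMap L K))
    (hL : ∀ y, v y ≤ 1 ↔ ∃ l : L, algebraMap L K l = y) (s : Fin (d + 1) → L)
    (hs0 : algebraMap L K (s 0) = algebraMap O K (t 0))
    (hs : ∀ i : Fin d, algebraMap L K (s i.succ) =
      algebraMap O K (t i.succ) / algebraMap O K (t 0)) :
    Submodule.span L (Set.range fun i => KaehlerDifferential.D k L (s i)) = ⊤ := by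
  set N := Submodule.span L (Set.range fun i => KaehlerDifferential.D k L (s i)) with hN
  have hDs : ∀ i, KaehlerDifferential.D k L (s i) ∈ N := fun i => Submodule.subset_span ⟨i, rfl⟩
  set τ : K := algebraMap O K (t 0) with hτ
  have hτ0 : τ ≠ 0 := fun h => by rw [h, map_zero] at hvτ; exact WithZero.exp_ne_zero hvτ.symm
  have hO1 : ∀ a : O, v (algebraMap O K a) ≤ 1 := fun a => by
    have := (hv a 0).mpr (by simp)
    simpa using this
  -- Through its image in `K` the ring `L` is the whole valuation ring, so it receives `O`.
  let e := AlgEquiv.ofInjective (IsScalarTower.toAlgHom k L K) hinj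
  let ι : O →ₐ[k] L := e.symm.toAlgHom.comp
    ((IsScalarTower.toAlgHom k O K).codRestrict _ fun a => (hL _).mp (hO1 a))
  have hι : ∀ a, algebraMap L K (ι a) = algebraMap O K a := fun a => by
    have : ((e (ι a) : _) : K) = algebraMap O K a := by simp [ι]; rfl
    exact this
  let _ : Algebra O L := ι.toRingHom.toAlgebra
  have : IsScalarTower k O L := IsScalarTower.of_algebraMap_eq fun c => (ι.commutes c).symm
  have hDO : ∀ a : O, KaehlerDifferential.D k L (ι a) ∈ N := by
    let δ : Derivation k O (Ω[L⁄k] ⧸ N) :=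
      (N.mkQ.compDer (KaehlerDifferential.D k L)).compAlgebraMap O
    have hδ' : ∀ a, δ a = N.mkQ (KaehlerDifferential.D k L (ι a)) := fun a => rfl
    have hδ : δ.liftKaehlerDifferential = 0 := by
      refine LinearMap.ext_on_range hspan fun i => ?_
      rw [Derivation.liftKaehlerDifferential_comp_D, LinearMap.zero_apply, hδ',
        Submodule.mkQ_apply, Submodule.Quotient.mk_eq_zero]
      refine Fin.cases ?_ (fun j => ?_) i
      · have : ι (t 0) = s 0 := hinj (by rw [hι, hs0])
        rw [this]; exact hDs 0
      · have : ι (t j.succ) = s 0 * s j.succ := hinj (by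
          rw [hι, map_mul, hs0, hs, mul_div_cancel₀ _ hτ0])
        rw [this, Derivation.leibniz]
        exact add_mem (N.smul_mem _ (hDs _)) (N.smul_mem _ (hDs _))
    intro a
    have h1 : δ a = 0 := by
      rw [← Derivation.liftKaehlerDifferential_comp_D, hδ, LinearMap.zero_apply]
    rwa [hδ', Submodule.mkQ_apply, Submodule.Quotient.mk_eq_zero] at h1
  -- Dividing an element of `m ^ r` by `τ ^ r` divides each of `r` factors `t i` by `t 0`, leaving
  -- `1` or some `s j`. Thus the quotient is a polynomial expression in the `s j` over `O`, and its
  -- differential stays in `N`.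
  have hpow : ∀ (r : ℕ) (a : O), a ∈ maximalIdeal O ^ r →
      ∃ l : L, algebraMap L K l * τ ^ r = algebraMap O K a ∧ KaehlerDifferential.D k L l ∈ N := by
    intro r
    induction r with
    | zero => exact fun a _ => ⟨ι a, by rw [hι, pow_zero, mul_one], hDO a⟩
    | succ r ih =>
      intro a ha
      rw [pow_succ'] at ha
      induction ha using Submodule.mul_induction_on' with
      | mem_mul_mem x hx y hy =>
        obtain ⟨l, hl, hlN⟩ := ih y hy
        rw [hm] at hx
        induction hx using Submodule.span_induction with
        | mem x hx =>
          obtain ⟨i, rfl⟩ := hx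
          refine Fin.cases ?_ (fun j => ?_) i
          · exact ⟨l, by rw [pow_succ', map_mul, ← hl]; ring, hlN⟩
          · refine ⟨s j.succ * l, ?_, ?_⟩
            · rw [map_mul, hs, map_mul, ← hl, pow_succ']
              field_simp
            · rw [Derivation.leibniz]
              exact add_mem (N.smul_mem _ hlN) (N.smul_mem _ (hDs _))
        | zero => exact ⟨0, by simp, by simp⟩
        | add x z _ _ hx hz =>
          obtain ⟨l₁, h₁, h₁'⟩ := hx
          obtain ⟨l₂, h₂, h₂'⟩ := hz
          exact ⟨l₁ + l₂, by rw [map_add, add_mul, h₁, h₂, ← map_add, add_mul],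
            by rw [map_add]; exact add_mem h₁' h₂'⟩
        | smul b x _ hx =>
          obtain ⟨l₁, h₁, h₁'⟩ := hx
          refine ⟨ι b * l₁, by rw [map_mul, mul_assoc, h₁, hι, ← map_mul, smul_eq_mul, mul_assoc],
            ?_⟩
          rw [Derivation.leibniz]
          exact add_mem (N.smul_mem _ h₁') (N.smul_mem _ (hDO _))
      | add x _ z _ hx hz =>
        obtain ⟨l₁, h₁, h₁'⟩ := hx
        obtain ⟨l₂, h₂, h₂'⟩ := hz
        exact ⟨l₁ + l₂, by rw [map_add, add_mul, h₁, h₂, ← map_add],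
          by rw [map_add]; exact add_mem h₁' h₂'⟩
  rw [eq_top_iff, ← KaehlerDifferential.span_range_derivation, Submodule.span_le]
  rintro _ ⟨y, rfl⟩
  obtain ⟨a, b, hb, hab⟩ := IsFractionRing.div_surjective (A := O) (algebraMap L K y)
  have hb0 : algebraMap O K b ≠ 0 := IsFractionRing.to_map_ne_zero_of_mem_nonZeroDivisors hb
  have hvb0 : v (algebraMap O K b) ≠ 0 := (map_ne_zero v).mpr hb0
  obtain ⟨r, hr⟩ : ∃ r : ℕ, v (algebraMap O K b) = WithZero.exp (-(r : ℤ)) := by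
    refine ⟨(-(WithZero.log (v (algebraMap O K b)))).toNat, ?_⟩
    have h1 := hO1 b
    rw [← WithZero.exp_log hvb0, ← WithZero.exp_zero, WithZero.exp_le_exp] at h1
    rw [Int.toNat_of_nonneg (by omega), neg_neg, WithZero.exp_log hvb0]
  have hya : algebraMap O K a = algebraMap L K y * algebraMap O K b := by
    rw [← hab, div_mul_cancel₀ _ hb0]
  obtain ⟨lb, hlb, hlbN⟩ := hpow r b ((hv b r).mp hr.le)
  obtain ⟨la, hla, hlaN⟩ := hpow r a ((hv a r).mp (by
    rw [hya, map_mul, hr]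
    exact mul_le_of_le_one_left' ((hL _).mpr ⟨y, rfl⟩)))
  -- After dividing numerator and denominator by the same `τ ^ r`, the denominator `lb` is a unit.
  -- Leibniz applied to `y * lb` then puts `lb • D y`, hence `D y`, in `N`.
  have hmul : y * lb = la := hinj (mul_right_cancel₀ (pow_ne_zero r hτ0) (by
    rw [map_mul, mul_assoc, hlb, hla, hya]))
  have hvlb : v (algebraMap L K lb) = 1 := by
    have h1 := congrArg v hlb
    rw [map_mul, map_pow, hvτ, hr, ← WithZero.exp_nsmul] at h1
    have h2 : r • (-1 : ℤ) = -(r : ℤ) := by simp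
    rw [h2] at h1
    exact mul_right_cancel₀ WithZero.exp_ne_zero (h1.trans (one_mul _).symm)
  obtain ⟨lb', hlb'⟩ := (hL (algebraMap L K lb)⁻¹).mp (by rw [map_inv₀, hvlb, inv_one])
  have hunit : lb' * lb = 1 := hinj (by
    rw [map_mul, hlb', map_one, inv_mul_cancel₀]
    intro h0
    rw [h0, map_zero] at hvlb
    exact zero_ne_one hvlb)
  have h1 : lb • KaehlerDifferential.D k L y ∈ N := by
    rw [← hmul, Derivation.leibniz] at hlaN
    have := sub_mem hlaN (N.smul_mem y hlbN)
    rwa [add_sub_cancel_left] at this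
  have h2 := N.smul_mem lb' h1
  rwa [smul_smul, hunit, one_smul] at h2

end Chart

/-! ### Orders of vanishing -/

theorem one_le_ordFrac_iff {R K : Type*} [CommRing R] [IsDomain R] [IsDiscreteValuationRing R]
    [Field K] [Algebra R K] [IsFractionRing R K] {f : K} (hf : f ≠ 0) :
    1 ≤ Ring.ordFrac R f ↔ ∃ r, algebraMap R K r = f := by
  constructor
  · intro h
    rcases ValuationRing.isInteger_or_isInteger R f with ⟨r, hr⟩ | ⟨r, hr⟩
    · exact ⟨r, hr⟩
    · have hr0 : r ≠ 0 := by
        rintro rfl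
        rw [map_zero] at hr
        exact inv_ne_zero hf hr.symm
      have h1 : 1 ≤ Ring.ordFrac R (algebraMap R K r) := Ring.ordFrac_ge_one_of_ne_zero hr0
      have h2 : Ring.ordFrac R (algebraMap R K r) = 1 := by
        refine le_antisymm ?_ h1
        rw [hr, map_inv₀]
        exact inv_le_one_of_one_le₀ h
      have hu : IsUnit r := by
        rwa [← Ring.isUnit_iff_ordFrac_one_of_isDiscreteValuationRing (K := K)] at h2
      obtain ⟨u, rfl⟩ := hu
      refine ⟨((u⁻¹ : Rˣ) : R), ?_⟩
      have h3 : algebraMap R K u * algebraMap R K ((u⁻¹ : Rˣ) : R) = 1 := by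
        rw [← map_mul, Units.mul_inv, map_one]
      rw [hr] at h3
      exact eq_of_inv_mul_eq_one h3 |>.symm
  · rintro ⟨r, rfl⟩
    exact Ring.ordFrac_ge_one_of_ne_zero fun h => hf (by rw [h, map_zero])

namespace Variety

variable {k : Type u} [Field k] (V : Variety k)

section Ord

theorem ord_mul {f g : V.K} (hf : f ≠ 0) (hg : g ≠ 0) (P : V.PrimeDivisor) :
    V.ord (f * g) P = V.ord f P + V.ord g P := Scheme.ord_mul hf hg

theorem ord_one (P : V.PrimeDivisor) : V.ord 1 P = 0 := by
  have := V.ord_mul one_ne_zero one_ne_zero P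
  rw [one_mul] at this
  omega

theorem ord_inv {f : V.K} (hf : f ≠ 0) (P : V.PrimeDivisor) : V.ord f⁻¹ P = - V.ord f P := by
  have := V.ord_mul hf (inv_ne_zero hf) P
  rw [mul_inv_cancel₀ hf, ord_one] at this
  omega

theorem ord_pow {f : V.K} (hf : f ≠ 0) (n : ℕ) (P : V.PrimeDivisor) :
    V.ord (f ^ n) P = n * V.ord f P := by
  induction n with
  | zero => simp [ord_one]
  | succ n ih =>
    rw [pow_succ, V.ord_mul (pow_ne_zero _ hf) hf, ih]
    push_cast; ring

theorem ord_zpow {f : V.K} (hf : f ≠ 0) (n : ℤ) (P : V.PrimeDivisor) :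
    V.ord (f ^ n) P = n * V.ord f P := by
  obtain ⟨m, rfl | rfl⟩ := n.eq_nat_or_neg
  · simpa using V.ord_pow hf m P
  · rw [zpow_neg, V.ord_inv (zpow_ne_zero _ hf), zpow_natCast, V.ord_pow hf]
    ring

theorem ord_prod {ι : Type*} (s : Finset ι) (f : ι → V.K) (hf : ∀ i ∈ s, f i ≠ 0)
    (P : V.PrimeDivisor) : V.ord (∏ i ∈ s, f i) P = ∑ i ∈ s, V.ord (f i) P := by
  classical
  induction s using Finset.induction_on with
  | empty => simp [ord_one]
  | insert a s ha ih =>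
    rw [Finset.prod_insert ha, Finset.sum_insert ha, V.ord_mul (hf a (Finset.mem_insert_self _ _))
      (Finset.prod_ne_zero_iff.mpr fun i hi => hf i (Finset.mem_insert_of_mem hi)),
      ih fun i hi => hf i (Finset.mem_insert_of_mem hi)]

theorem ord_prod_zpow {ι : Type*} (s : Finset ι) (f : ι → V.K) (hf : ∀ i, f i ≠ 0) (q : ι → ℤ)
    (P : V.PrimeDivisor) : V.ord (∏ i ∈ s, f i ^ q i) P = ∑ i ∈ s, q i * V.ord (f i) P := by
  rw [V.ord_prod s _ (fun i _ => zpow_ne_zero _ (hf i))]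
  exact Finset.sum_congr rfl fun i _ => V.ord_zpow (hf i) _ P

theorem ord_nonneg_iff [V.IsNormal] {f : V.K} (hf : f ≠ 0) (P : V.PrimeDivisor) :
    0 ≤ V.ord f P ↔ ∃ r : V.X.presheaf.stalk P.1, algebraMap _ V.K r = f := by
  have := V.isDiscreteValuationRing_stalk P
  rw [← one_le_ordFrac_iff (R := V.X.presheaf.stalk P.1) hf]
  exact Scheme.le_ord_iff P.2 hf

theorem ord_algebraMap_irreducible [V.IsNormal] (P : V.PrimeDivisor) {ϖ : V.X.presheaf.stalk P.1}
    (hϖ : Irreducible ϖ) : V.ord (algebraMap _ V.K ϖ) P = 1 := by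
  have := V.isDiscreteValuationRing_stalk P
  have h0 : algebraMap (V.X.presheaf.stalk P.1) V.K ϖ ≠ 0 := by
    rw [Ne, FaithfulSMul.algebraMap_eq_zero_iff]
    exact hϖ.ne_zero
  refine (Scheme.ord_eq_iff P.2 h0).mpr ?_
  exact Ring.ordFrac_irreducible hϖ

end Ord

/-! ### Finiteness of the divisor of a rational function -/

section Topology

instance instCompactSpace : CompactSpace V.X := by
  have := V.quasiCompact
  exact QuasiCompact.compactSpace_of_compactSpace V.str

instance instIsNoetherian : IsNoetherian V.X where

theorem genericPoint_specializes (y : V.X) : genericPoint V.X ⤳ y :=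
  (genericPoint_spec V.X).specializes trivial

/-- A third point strictly between the generic point and `P` would raise the codimension of `P` to
two. -/
theorem eq_of_specializes_primeDivisor (P : V.PrimeDivisor) {y : V.X} (hy : y ⤳ P.1)
    (hne : y ≠ genericPoint V.X) : y = P.1 := by
  by_contra hyP
  have h1 : P.1 < y := lt_of_le_not_ge (Scheme.le_iff_specializes.mpr hy) fun h =>
    hyP (hy.antisymm (Scheme.le_iff_specializes.mp h)).eq
  have h2 : y < genericPoint V.X :=
    lt_of_le_not_ge (Scheme.le_iff_specializes.mpr (V.genericPoint_specializes y)) fun h =>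
      hne ((Scheme.le_iff_specializes.mp h).antisymm (V.genericPoint_specializes y)).eq
  have h3 := Order.coheight_add_one_le h1
  have h4 := Order.coheight_add_one_le h2
  rw [P.2] at h3
  have h5 : (1 : ℕ∞) ≤ Order.coheight y := le_trans (by simp) h4
  have h6 : (1 : ℕ∞) + 1 ≤ 1 := le_trans (by gcongr) h3
  exact absurd h6 (by decide)

/-- On some nonempty open set `f` is a unit. A prime divisor where `f` has nonzero order lies in the
complement, and codimension one forces it to be the generic point of one of finitely many closed
irreducible pieces. -/
theorem finite_setOf_ord_ne_zero {f : V.K} (hf : f ≠ 0) :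
    {P : V.PrimeDivisor | V.ord f P ≠ 0}.Finite := by
  obtain ⟨U, _, f', hU, rfl, hf'⟩ := exists_isUnit_germ_eq V.X f hf
  have hη : genericPoint V.X ∈ U :=
    ((genericPoint_spec V.X).mem_open_set_iff U.isOpen).mpr (by simpa using hU)
  obtain ⟨S, hSf, hSc, hSi, hS⟩ := TopologicalSpace.NoetherianSpace.exists_finite_set_isClosed_irreducible
    (U.isOpen.isClosed_compl)
  refine Set.Finite.of_finite_image (f := fun P : V.PrimeDivisor => closure {P.1}) ?_ ?_
  · refine hSf.subset ?_
    rintro _ ⟨P, hP, rfl⟩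
    have hPU : P.1 ∈ ((U : Set V.X))ᶜ := fun h => hP (Scheme.ord_of_isUnit hf' h)
    rw [hS] at hPU
    obtain ⟨T, hT, hPT⟩ := hPU
    obtain ⟨y, hy⟩ := QuasiSober.sober (hSi T hT) (hSc T hT)
    have hyT : y ∈ T := hy.mem
    have hyP : y = P.1 := V.eq_of_specializes_primeDivisor P (hy.specializes hPT) (by
      rintro rfl
      have : genericPoint V.X ∈ ((U : Set V.X))ᶜ := by rw [hS]; exact ⟨T, hT, hyT⟩
      exact this hη)
    change closure {P.1} ∈ S
    rw [← hyP, hy.def]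
    exact hT
  · intro P _ Q _ h
    exact Subtype.ext (Inseparable.eq ((specializes_iff_closure_subset.mpr h.ge).antisymm
      (specializes_iff_closure_subset.mpr h.le)))

end Topology

/-! ### Regularity in codimension one and existence of prime divisors through a point -/

section Affine

variable {V} {W : V.X.Opens} (hW : IsAffineOpen W)

theorem mem_range_algebraMap_stalk_iff {x : V.X} (hx : x ∈ W) (f : V.K) :
    haveI : Nonempty W := ⟨⟨x, hx⟩⟩
    (∃ r : V.X.presheaf.stalk x, algebraMap _ V.K r = f) ↔
      ∃ s ∉ (hW.primeIdealOf ⟨x, hx⟩).asIdeal, ∃ a, s • f = algebraMap Γ(V.X, W) V.K a := by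
  have : Nonempty W := ⟨⟨x, hx⟩⟩
  have hloc := hW.isLocalization_stalk ⟨x, hx⟩
  let _ := V.X.presheaf.algebra_section_stalk (⟨x, hx⟩ : W)
  have htow := functionField_isScalarTower V.X W ⟨x, hx⟩
  constructor
  · rintro ⟨r, rfl⟩
    obtain ⟨⟨a, s⟩, h⟩ := IsLocalization.surj (hW.primeIdealOf ⟨x, hx⟩).asIdeal.primeCompl r
    refine ⟨s, s.2, a, ?_⟩
    rw [IsScalarTower.algebraMap_apply Γ(V.X, W) (V.X.presheaf.stalk x) V.K, ← h, map_mul,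
      Algebra.smul_def, mul_comm, ← IsScalarTower.algebraMap_apply]
  · rintro ⟨s, hs, a, h⟩
    obtain ⟨r, hr⟩ : ∃ r : V.X.presheaf.stalk x, algebraMap _ _ s * r = algebraMap _ _ a :=
      ⟨_, IsLocalization.mk'_spec' (V.X.presheaf.stalk x) a
        (⟨s, hs⟩ : (hW.primeIdealOf ⟨x, hx⟩).asIdeal.primeCompl)⟩
    refine ⟨r, ?_⟩
    have hs0 : algebraMap Γ(V.X, W) V.K s ≠ 0 := by
      intro h0
      have : s = 0 := Scheme.germToFunctionField_injective V.X W (by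
        rw [map_zero]; exact h0)
      exact hs (this ▸ Ideal.zero_mem _)
    apply mul_left_cancel₀ hs0
    rw [← Algebra.smul_def s f, h, IsScalarTower.algebraMap_apply Γ(V.X, W) (V.X.presheaf.stalk x),
      ← map_mul, hr, ← IsScalarTower.algebraMap_apply]

/-- The point of an affine open given by a prime ideal, as a generization of `x`. -/
theorem exists_specializes_of_le_primeIdealOf {x : V.X} (hx : x ∈ W) (p : Ideal Γ(V.X, W))
    [hp : p.IsPrime] (hpx : p ≤ (hW.primeIdealOf ⟨x, hx⟩).asIdeal) :
    ∃ (y : V.X) (hy : y ∈ W), y ⤳ x ∧ (hW.primeIdealOf ⟨y, hy⟩).asIdeal = p := by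
  have hyW : hW.fromSpec (⟨p, hp⟩ : PrimeSpectrum Γ(V.X, W)) ∈ W := by
    have : hW.fromSpec (⟨p, hp⟩ : PrimeSpectrum Γ(V.X, W)) ∈ Set.range hW.fromSpec := ⟨_, rfl⟩
    rwa [hW.range_fromSpec] at this
  refine ⟨_, hyW, ?_, ?_⟩
  · have h1 : (⟨p, hp⟩ : PrimeSpectrum Γ(V.X, W)) ⤳ hW.primeIdealOf ⟨x, hx⟩ :=
      (PrimeSpectrum.le_iff_specializes _ _).mp hpx
    have h2 := h1.map hW.fromSpec.continuous
    rwa [hW.fromSpec_primeIdealOf] at h2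
  · have h1 : hW.fromSpec (hW.primeIdealOf ⟨_, hyW⟩) =
        hW.fromSpec (⟨p, hp⟩ : PrimeSpectrum Γ(V.X, W)) := hW.fromSpec_primeIdealOf ⟨_, hyW⟩
    have h2 := hW.fromSpec.isOpenEmbedding.injective h1
    rw [h2]

theorem coheight_eq_height_primeIdealOf {y : V.X} (hy : y ∈ W) :
    ((Order.coheight y : ℕ∞) : WithBot ℕ∞) = (hW.primeIdealOf ⟨y, hy⟩).asIdeal.height := by
  have hloc := hW.isLocalization_stalk ⟨y, hy⟩
  let _ := V.X.presheaf.algebra_section_stalk (⟨y, hy⟩ : W)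
  rw [← ringKrullDim_stalk_eq_coheight]
  exact IsLocalization.AtPrime.ringKrullDim_eq_height (hW.primeIdealOf ⟨y, hy⟩).asIdeal _

/-- On a normal variety a rational function without poles through `x` is regular at `x`. -/
theorem mem_range_algebraMap_of_ord_nonneg [V.IsNormal] (x : V.X) (f : V.K)
    (hf : ∀ P : V.PrimeDivisor, P.1 ⤳ x → 0 ≤ V.ord f P) :
    ∃ r : V.X.presheaf.stalk x, algebraMap _ V.K r = f := by
  by_cases hf0 : f = 0
  · exact ⟨0, by rw [map_zero, hf0]⟩
  obtain ⟨_, ⟨W, hW, rfl⟩, hx, -⟩ :=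
    V.X.isBasis_affineOpens.exists_subset_of_mem_open (Set.mem_univ x) isOpen_univ
  have : Nonempty W := ⟨⟨x, hx⟩⟩
  have hfrac := functionField_isFractionRing_of_isAffineOpen V.X W hW
  have : IsNoetherianRing Γ(V.X, W) := IsLocallyNoetherian.component_noetherian ⟨W, hW⟩
  let _ := V.X.presheaf.algebra_section_stalk (⟨x, hx⟩ : W)
  have htow := functionField_isScalarTower V.X W ⟨x, hx⟩
  rw [mem_range_algebraMap_stalk_iff hW hx]
  -- Primes of height one below the prime of `x` are exactly the prime divisors of the variety
  -- through `x` seen on `W`.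
  refine exists_smul_eq_of_forall_height_one _ (fun z hz => ?_) f (fun p hp hpx hp1 => ?_)
    inferInstance
  · have := IsNormal.isIntegrallyClosed (V := V) x
    rw [← mem_range_algebraMap_stalk_iff hW hx]
    exact IsIntegrallyClosed.isIntegral_iff.mp
      (IsIntegral.tower_top (A := V.X.presheaf.stalk x) hz)
  · obtain ⟨y, hy, hyx, rfl⟩ := exists_specializes_of_le_primeIdealOf hW hx p hpx
    have hy1 : Order.coheight y = 1 := by
      have := coheight_eq_height_primeIdealOf hW hy
      rw [hp1] at this
      exact_mod_cast this
    rw [← mem_range_algebraMap_stalk_iff hW hy]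
    exact (V.ord_nonneg_iff hf0 ⟨y, hy1⟩).mp (hf ⟨y, hy1⟩ hyx)

/-- A point whose local ring is not a field lies on a prime divisor. -/
theorem exists_primeDivisor_specializes (x : V.X)
    (hx0 : IsLocalRing.maximalIdeal (V.X.presheaf.stalk x) ≠ ⊥) :
    ∃ P : V.PrimeDivisor, P.1 ⤳ x := by
  obtain ⟨_, ⟨W, hW, rfl⟩, hx, -⟩ :=
    V.X.isBasis_affineOpens.exists_subset_of_mem_open (Set.mem_univ x) isOpen_univ
  have : Nonempty W := ⟨⟨x, hx⟩⟩
  have : IsNoetherianRing Γ(V.X, W) := IsLocallyNoetherian.component_noetherian ⟨W, hW⟩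
  have hloc := hW.isLocalization_stalk ⟨x, hx⟩
  let _ := V.X.presheaf.algebra_section_stalk (⟨x, hx⟩ : W)
  set m := (hW.primeIdealOf ⟨x, hx⟩).asIdeal with hm
  have hm0 : m ≠ ⊥ := by
    intro h
    apply hx0
    have h1 := IsLocalization.AtPrime.map_eq_maximalIdeal m (V.X.presheaf.stalk x)
    rw [← h1, h, Ideal.map_bot]
  obtain ⟨a, ham, ha0⟩ := Submodule.exists_mem_ne_zero_of_ne_bot hm0
  obtain ⟨p, hp, hpm⟩ := Ideal.exists_minimalPrimes_le (I := Ideal.span {a}) (J := m)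
    (by rwa [Ideal.span_singleton_le_iff_mem])
  have hpp : p.IsPrime := hp.1.1
  have hp1 : p.height = 1 := by
    refine le_antisymm (Ideal.height_le_one_of_isPrincipal_of_mem_minimalPrimes _ _ hp)
      (Order.one_le_iff_pos.mpr ?_)
    rw [pos_iff_ne_zero, Ne, Ideal.height_eq_zero_iff_eq_bot]
    rintro rfl
    exact ha0 (by simpa using hp.1.2)
  obtain ⟨y, hy, hyx, rfl⟩ := exists_specializes_of_le_primeIdealOf hW hx p hpm
  refine ⟨⟨y, ?_⟩, hyx⟩
  have := coheight_eq_height_primeIdealOf hW hy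
  rw [hp1] at this
  exact_mod_cast this

end Affine

end Variety

/-! ### Local rings of varieties as algebras -/

namespace Variety

variable {k : Type u} [Field k] (V : Variety k)

section Scalars

instance instIsScalarTowerStalk (x : V.X) : IsScalarTower k (V.X.presheaf.stalk x) V.K :=
  IsScalarTower.of_algebraMap_eq fun c => by
    have : Nonempty (⊤ : V.X.Opens) := ⟨⟨x, trivial⟩⟩
    exact (Scheme.algebraMap_germ_eq_germToFunctionField (X := V.X) (U := ⊤) (x := x) trivial
      (V.constants c)).symm

/-- The ring homomorphism from `k` to the functions on an open set. -/
def sectionConstants (W : V.X.Opens) : k →+* Γ(V.X, W) :=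
  (V.X.presheaf.map (homOfLE le_top).op).hom.comp V.constants

theorem germ_sectionConstants {W : V.X.Opens} {x : V.X} (hx : x ∈ W) (c : k) :
    V.X.presheaf.germ W x hx (V.sectionConstants W c) =
      algebraMap k (V.X.presheaf.stalk x) c := by
  exact V.X.presheaf.germ_res_apply (homOfLE le_top) x hx (V.constants c)

theorem sectionConstants_eq (W : V.X.Opens) : V.sectionConstants W =
    ((Scheme.ΓSpecIso (CommRingCat.of k)).inv ≫ V.str.appLE ⊤ W le_top).hom := by
  rw [sectionConstants, constants, ← CommRingCat.hom_comp, Category.assoc]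
  rfl

theorem finiteType_sectionConstants {W : V.X.Opens} (hW : IsAffineOpen W) :
    (V.sectionConstants W).FiniteType := by
  have := V.locallyOfFiniteType
  rw [sectionConstants_eq, CommRingCat.hom_comp]
  refine (V.str.finiteType_appLE (isAffineOpen_top _) hW le_top).comp ?_
  exact RingHom.FiniteType.of_surjective _
    (Scheme.ΓSpecIso (CommRingCat.of k)).symm.commRingCatIsoToRingEquiv.surjective

theorem essFiniteType_stalk (x : V.X) : Algebra.EssFiniteType k (V.X.presheaf.stalk x) := by
  obtain ⟨_, ⟨W, hW, rfl⟩, hx, -⟩ :=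
    V.X.isBasis_affineOpens.exists_subset_of_mem_open (Set.mem_univ x) isOpen_univ
  have hft := V.finiteType_sectionConstants hW
  have hloc := hW.isLocalization_stalk ⟨x, hx⟩
  let _ := V.X.presheaf.algebra_section_stalk (⟨x, hx⟩ : W)
  let _ : Algebra k Γ(V.X, W) := (V.sectionConstants W).toAlgebra
  have : Algebra.FiniteType k Γ(V.X, W) := hft
  have : IsScalarTower k Γ(V.X, W) (V.X.presheaf.stalk x) :=
    IsScalarTower.of_algebraMap_eq fun c => (V.germ_sectionConstants hx c).symm
  have : Algebra.EssFiniteType Γ(V.X, W) (V.X.presheaf.stalk x) :=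
    Algebra.EssFiniteType.of_isLocalization _ (hW.primeIdealOf ⟨x, hx⟩).asIdeal.primeCompl
  exact Algebra.EssFiniteType.comp k Γ(V.X, W) _

/-- At a closed point the prime is maximal, and the Nullstellensatz over an algebraically closed
field makes the residue field equal to `k`. A fraction is congruent to the quotient of the residues
of its numerator and denominator. -/
theorem exists_sub_algebraMap_mem_maximalIdeal [IsAlgClosed k] {x : V.X} (hx : IsClosed {x})
    (a : V.X.presheaf.stalk x) :
    ∃ c : k, a - algebraMap k _ c ∈ IsLocalRing.maximalIdeal (V.X.presheaf.stalk x) := by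
  obtain ⟨_, ⟨W, hW, rfl⟩, hxW, -⟩ :=
    V.X.isBasis_affineOpens.exists_subset_of_mem_open (Set.mem_univ x) isOpen_univ
  have hft := V.finiteType_sectionConstants hW
  have hloc := hW.isLocalization_stalk ⟨x, hxW⟩
  let _ := V.X.presheaf.algebra_section_stalk (⟨x, hxW⟩ : W)
  let _ : Algebra k Γ(V.X, W) := (V.sectionConstants W).toAlgebra
  have : Algebra.FiniteType k Γ(V.X, W) := hft
  have htow : IsScalarTower k Γ(V.X, W) (V.X.presheaf.stalk x) :=
    IsScalarTower.of_algebraMap_eq fun c => (V.germ_sectionConstants hxW c).symm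
  set p := (hW.primeIdealOf ⟨x, hxW⟩).asIdeal with hp
  have hmax : p.IsMaximal := hW.primeIdealOf_isMaximal_of_isClosed ⟨x, hxW⟩ hx
  let _ : Field (Γ(V.X, W) ⧸ p) := Ideal.Quotient.field p
  have : Module.Finite k (Γ(V.X, W) ⧸ p) := finite_of_finite_type_of_isJacobsonRing k _
  have hsurj : Function.Surjective (algebraMap k (Γ(V.X, W) ⧸ p)) :=
    IsAlgClosed.algebraMap_bijective_of_isIntegral.2
  have hres : ∀ b : Γ(V.X, W), ∃ c : k, b - algebraMap k _ c ∈ p := by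
    intro b
    obtain ⟨c, hc⟩ := hsurj (Ideal.Quotient.mk p b)
    exact ⟨c, Ideal.Quotient.eq.mp hc.symm⟩
  have hpm : ∀ b ∈ p, algebraMap _ (V.X.presheaf.stalk x) b ∈
      IsLocalRing.maximalIdeal (V.X.presheaf.stalk x) := fun b hb =>
    (IsLocalization.AtPrime.to_map_mem_maximal_iff (V.X.presheaf.stalk x) p b).mpr hb
  obtain ⟨⟨b, s⟩, hbs⟩ := IsLocalization.surj p.primeCompl a
  obtain ⟨cb, hcb⟩ := hres b
  obtain ⟨cs, hcs⟩ := hres s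
  have hcs0 : cs ≠ 0 := by
    rintro rfl
    rw [map_zero, sub_zero] at hcs
    exact s.2 hcs
  refine ⟨cs⁻¹ * cb, ?_⟩
  have hcb' := hpm _ hcb
  have hcs' := hpm _ hcs
  rw [map_sub, ← IsScalarTower.algebraMap_apply] at hcb' hcs'
  have h1 : algebraMap k (V.X.presheaf.stalk x) cs * a - algebraMap k _ cb ∈
      IsLocalRing.maximalIdeal (V.X.presheaf.stalk x) := by
    have := Ideal.sub_mem _ hcb' (Ideal.mul_mem_left _ a hcs')
    convert this using 1
    rw [mul_sub, hbs]; ring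
  have h2 := Ideal.mul_mem_left _ (algebraMap k (V.X.presheaf.stalk x) cs⁻¹) h1
  convert h2 using 1
  rw [mul_sub, ← mul_assoc, ← map_mul, ← map_mul, inv_mul_cancel₀ hcs0, map_one, one_mul]

/-- The stalk map of the structure morphism is formally smooth on the smooth locus. It is
precomposed with an isomorphism from `k` and a localization, both of which are formally smooth. -/
theorem formallySmooth_stalk {x : V.X} (hx : V.IsSmoothAt x) :
    Algebra.FormallySmooth k (V.X.presheaf.stalk x) := by
  obtain ⟨U, hxU, hU⟩ := hx
  have := V.locallyOfFiniteType
  have : LocallyOfFinitePresentation V.str := inferInstance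
  have h1 : x ∈ V.str.smoothLocus := by
    have h2 := Scheme.Hom.preimage_smoothLocus_eq U.ι V.str
    rw [Scheme.Hom.smoothLocus_eq_top (U.ι ≫ V.str)] at h2
    have h3 : (⟨x, hxU⟩ : U) ∈ (⊤ : Scheme.Opens U) := trivial
    rw [← h2] at h3
    exact h3
  rw [Scheme.Hom.mem_smoothLocus] at h1
  have h4 : algebraMap k (V.X.presheaf.stalk x) = (V.str.stalkMap x).hom.comp
      (((Spec (CommRingCat.of k)).presheaf.germ ⊤ (V.str x) trivial).hom.comp
        (Scheme.ΓSpecIso (CommRingCat.of k)).inv.hom) := by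
    ext c
    exact (Scheme.Hom.germ_stalkMap_apply V.str ⊤ x trivial _).symm
  rw [← RingHom.formallySmooth_algebraMap, h4]
  refine RingHom.FormallySmooth.comp (RingHom.FormallySmooth.comp ?_ ?_) h1
  rotate_left
  · have hloc := (isAffineOpen_top (Spec (CommRingCat.of k))).isLocalization_stalk
      ⟨V.str x, trivial⟩
    let _ := (Spec (CommRingCat.of k)).presheaf.algebra_section_stalk
      (⟨V.str x, trivial⟩ : (⊤ : (Spec (CommRingCat.of k)).Opens))
    exact RingHom.formallySmooth_algebraMap.mpr
      (Algebra.FormallySmooth.of_isLocalization (IsAffineOpen.primeIdealOf (isAffineOpen_top _)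
        ⟨V.str x, trivial⟩).asIdeal.primeCompl)
  · exact RingHom.FormallySmooth.of_bijective
      (Scheme.ΓSpecIso (CommRingCat.of k)).symm.commRingCatIsoToRingEquiv.bijective

end Scalars

end Variety

/-! ### Affine varieties and charts -/

section SpecHom

variable {X : Scheme.{u}} {U : X.Opens} (hU : IsAffineOpen U) {R : CommRingCat.{u}}
  (φ : Γ(X, U) ⟶ R)

theorem specMap_fromSpec_comp {k : CommRingCat.{u}} (g : X ⟶ Spec k) :
    (Spec.map φ ≫ hU.fromSpec) ≫ g =
      Spec.map ((Scheme.ΓSpecIso k).inv ≫ g.appLE ⊤ U le_top ≫ φ) := by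
  have h1 := IsAffineOpen.SpecMap_appLE_fromSpec g (isAffineOpen_top _) hU le_top
  rw [Category.assoc, ← h1, IsAffineOpen.fromSpec_top, Scheme.isoSpec_Spec_inv, ← Spec.map_comp,
    ← Spec.map_comp, Category.assoc]

theorem specMap_fromSpec_apply {y : X} (hy : y ∈ U) (p : PrimeSpectrum R)
    (h : ∀ a, φ a ∈ p.asIdeal ↔ a ∈ (hU.primeIdealOf ⟨y, hy⟩).asIdeal) :
    (Spec.map φ ≫ hU.fromSpec) p = y := by
  have h2 : Spec.map φ p = hU.primeIdealOf ⟨y, hy⟩ := PrimeSpectrum.ext (Ideal.ext fun a => h a)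
  exact (congrArg hU.fromSpec h2).trans (hU.fromSpec_primeIdealOf ⟨y, hy⟩)

theorem specMap_fromSpec_stalkMap (p : Spec R) (hp : (Spec.map φ ≫ hU.fromSpec) p ∈ U)
    (a : Γ(X, U)) :
    (Spec.map φ ≫ hU.fromSpec).stalkMap p (X.presheaf.germ U _ hp a) =
      (Spec R).presheaf.germ ⊤ p trivial ((Scheme.ΓSpecIso R).inv (φ a)) := by
  have htop : (Spec.map φ ≫ hU.fromSpec) ⁻¹ᵁ U = ⊤ := by
    rw [Scheme.Hom.comp_preimage, hU.fromSpec_preimage_self]; rfl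
  have key : (Spec.map φ ≫ hU.fromSpec).appLE U ⊤ htop.ge = φ ≫ (Scheme.ΓSpecIso R).inv := by
    rw [Scheme.Hom.comp_appLE, hU.fromSpec_app_self, Scheme.ΓSpecIso_inv_naturality,
      Category.assoc]
    have h1 : (⊤ : (Spec R).Opens) ≤ Spec.map φ ⁻¹ᵁ hU.fromSpec ⁻¹ᵁ U := htop.ge
    have h2 := Scheme.Hom.map_appLE (Spec.map φ) h1 (eqToHom hU.fromSpec_preimage_self).op
    rw [Scheme.Hom.appTop, ← Scheme.Hom.appLE_eq_app]
    exact congrArg (fun ψ => (Scheme.ΓSpecIso Γ(X, U)).inv ≫ ψ) h2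
  rw [Scheme.Hom.germ_stalkMap_apply]
  have h2 := (Spec R).presheaf.germ_res_apply (homOfLE htop.ge) p trivial
    ((Spec.map φ ≫ hU.fromSpec).app U a)
  refine h2.symm.trans ?_
  congr 1
  exact ConcreteCategory.congr_hom key a

end SpecHom

namespace Variety

variable {k : Type u} [Field k] (V : Variety k)

/-! ### The affine variety of a finitely generated domain and its local rings -/

section Affine

variable (C : Type u) [CommRing C] [IsDomain C] [Algebra k C] [Algebra.FiniteType k C]

/-- The affine variety of a finitely generated domain. -/
def affine : Variety k where
  X := Spec (CommRingCat.of C)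
  str := Spec.map (CommRingCat.ofHom (algebraMap k C))
  isIntegral := inferInstance
  isSeparated := inferInstance
  locallyOfFiniteType := by
    rw [HasRingHomProperty.Spec_iff (P := @LocallyOfFiniteType)]
    exact RingHom.finiteType_algebraMap.mpr inferInstance
  quasiCompact := inferInstance

/-- A point of an affine variety, given by a prime ideal. -/
def affinePoint (p : PrimeSpectrum C) : (affine (k := k) C).X := p

instance instAlgebraStalkAffine (p : PrimeSpectrum C) :
    Algebra C ((affine (k := k) C).X.presheaf.stalk (affinePoint C p)) :=
  (StructureSheaf.toStalk C p).hom.toAlgebra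

instance instIsLocalizationStalkAffine (p : PrimeSpectrum C) :
    IsLocalization.AtPrime ((affine (k := k) C).X.presheaf.stalk (affinePoint C p)) p.asIdeal :=
  StructureSheaf.IsLocalization.to_stalk C p

theorem germ_top_ΓSpecIso_inv (p : PrimeSpectrum C) (c : C) :
    (affine (k := k) C).X.presheaf.germ ⊤ (affinePoint C p) trivial
      ((Scheme.ΓSpecIso (CommRingCat.of C)).inv c) =
    algebraMap C ((affine (k := k) C).X.presheaf.stalk (affinePoint C p)) c := by
  rfl

theorem affine_constants (c : k) : (affine (k := k) C).constants c =
    (Scheme.ΓSpecIso (CommRingCat.of C)).inv (algebraMap k C c) := by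
  have := Scheme.ΓSpecIso_inv_naturality (CommRingCat.ofHom (algebraMap k C))
  exact (ConcreteCategory.congr_hom this c).symm

instance instIsScalarTowerStalkAffine (p : PrimeSpectrum C) :
    IsScalarTower k C ((affine (k := k) C).X.presheaf.stalk (affinePoint C p)) :=
  IsScalarTower.of_algebraMap_eq fun c => by
    rw [← germ_top_ΓSpecIso_inv, ← affine_constants]
    rfl

instance instIsNormalAffine [IsIntegrallyClosed C] : (affine (k := k) C).IsNormal where
  isIntegrallyClosed p := by
    let q : PrimeSpectrum C := p
    exact isIntegrallyClosed_of_isLocalization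
      ((affine (k := k) C).X.presheaf.stalk (affinePoint C q))
      q.asIdeal.primeCompl q.asIdeal.primeCompl_le_nonZeroDivisors

theorem coheight_affinePoint (p : PrimeSpectrum C) [IsDiscreteValuationRing
    ((affine (k := k) C).X.presheaf.stalk (affinePoint C p))] :
    Order.coheight (affinePoint (k := k) C p) = 1 := by
  have h1 := ringKrullDim_stalk_eq_coheight (affinePoint (k := k) C p)
  rw [IsDiscreteValuationRing.ringKrullDim_eq_one] at h1
  exact_mod_cast h1.symm

/-- The generic point of an affine variety. -/
def affineGeneric : PrimeSpectrum C := genericPoint (Spec (CommRingCat.of C))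

theorem affineGeneric_asIdeal : (affineGeneric C).asIdeal = ⊥ := by
  have := genericPoint_eq_bot_of_affine (CommRingCat.of C)
  rw [affineGeneric, this]
  rfl

instance instAlgebraAffineK : Algebra C (affine (k := k) C).K :=
  instAlgebraStalkAffine C (affineGeneric C)

instance instIsFractionRingAffineK : IsFractionRing C (affine (k := k) C).K := by
  have h := instIsLocalizationStalkAffine (k := k) C (affineGeneric C)
  have h2 : (affineGeneric C).asIdeal.primeCompl = nonZeroDivisors C := by
    ext a
    rw [Ideal.mem_primeCompl_iff, affineGeneric_asIdeal, Ideal.mem_bot, mem_nonZeroDivisors_iff_ne_zero]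
  rw [IsLocalization.AtPrime, h2] at h
  exact h

instance instIsScalarTowerAffineK (p : PrimeSpectrum C) :
    IsScalarTower C ((affine (k := k) C).X.presheaf.stalk (affinePoint C p))
      (affine (k := k) C).K :=
  IsScalarTower.of_algebraMap_eq fun c =>
    (ConcreteCategory.congr_hom (StructureSheaf.toStalk_stalkSpecializes
      (R := C) ((affine (k := k) C).genericPoint_specializes p)) c).symm

end Affine

/-! ### Morphisms from an affine variety into an affine open set -/

section Morphism

variable {V} {C : Type u} [CommRing C] [IsDomain C] [Algebra k C] [Algebra.FiniteType k C]
  {W : V.X.Opens} (hW : IsAffineOpen W) (φ : Γ(V.X, W) →+* C)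

/-- The morphism from an affine variety given by a ring homomorphism. -/
def affineHom : (affine (k := k) C).X ⟶ V.X :=
  Spec.map (CommRingCat.ofHom φ) ≫ hW.fromSpec

theorem affineHom_comp_str (hφ : ∀ c, φ (V.sectionConstants W c) = algebraMap k C c) :
    affineHom hW φ ≫ V.str = (affine (k := k) C).str := by
  refine (specMap_fromSpec_comp hW (CommRingCat.ofHom φ) V.str).trans ?_
  change _ = Spec.map _
  congr 1
  ext c
  rw [CommRingCat.hom_ofHom, ← hφ, sectionConstants_eq]
  rfl

theorem affineHom_eq {y : V.X} (hy : y ∈ W) (p : PrimeSpectrum C)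
    (h : ∀ a, φ a ∈ p.asIdeal ↔ a ∈ (hW.primeIdealOf ⟨y, hy⟩).asIdeal) :
    affineHom hW φ (affinePoint C p) = y := by
  exact specMap_fromSpec_apply hW (CommRingCat.ofHom φ) hy p h

theorem affineHom_stalkMap (p : PrimeSpectrum C) (hp : affineHom hW φ (affinePoint C p) ∈ W)
    (a : Γ(V.X, W)) :
    (affineHom hW φ).stalkMap (affinePoint C p) (V.X.presheaf.germ W _ hp a) =
      algebraMap C ((affine (k := k) C).X.presheaf.stalk (affinePoint C p)) (φ a) := by
  exact specMap_fromSpec_stalkMap hW (CommRingCat.ofHom φ) p hp a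

theorem affineHom_genericPoint [Nonempty W] (hφ : Function.Injective φ) :
    affineHom (k := k) hW φ (genericPoint (affine (k := k) C).X) = genericPoint V.X := by
  have hy : genericPoint V.X ∈ W := by
    obtain ⟨y, hy⟩ := ‹Nonempty W›
    exact (V.genericPoint_specializes y).mem_open W.2 hy
  refine affineHom_eq hW φ hy (affineGeneric C) fun a => ?_
  have h1 : (hW.primeIdealOf ⟨genericPoint V.X, hy⟩).asIdeal = ⊥ := by
    rw [hW.primeIdealOf_genericPoint, genericPoint_eq_bot_of_affine]
    rfl
  rw [h1, affineGeneric_asIdeal, Ideal.mem_bot, Ideal.mem_bot, map_eq_zero_iff φ hφ]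

end Morphism

theorem bijective_stalkSpecializes_of_eq {X : Scheme.{u}} {x y : X} (h : x = y) :
    Function.Bijective (X.presheaf.stalkSpecializes (specializes_of_eq h)).hom := by
  subst h
  simpa using Function.bijective_id

/-! ### Birational charts given by subalgebras of the function field -/

section Chart

variable {V} {W : V.X.Opens} [Nonempty W] (hW : IsAffineOpen W) (C : Subalgebra k V.K)
  (hWC : ∀ a, V.X.germToFunctionField W a ∈ C)

/-- The inclusion of the functions on `W` into `C`. -/
def toChart : Γ(V.X, W) →+* C := (V.X.germToFunctionField W).hom.codRestrict C hWC

theorem toChart_injective : Function.Injective (toChart C hWC) := fun _ _ h =>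
  Scheme.germToFunctionField_injective V.X W (congrArg Subtype.val h)

theorem toChart_sectionConstants (c : k) :
    toChart C hWC (V.sectionConstants W c) = algebraMap k C c :=
  Subtype.ext (V.germ_sectionConstants _ c)

variable [Algebra.FiniteType k C]

/-- Pullback of rational functions along the morphism of a chart. -/
def chartPullback : V.K →+* (affine (k := k) C).K :=
  (V.X.presheaf.stalkSpecializes
      (specializes_of_eq (affineHom_genericPoint hW _ (toChart_injective C hWC))) ≫
    (affineHom hW (toChart C hWC)).stalkMap (genericPoint (affine (k := k) C).X)).hom

theorem chartPullback_germ (a : Γ(V.X, W)) :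
    chartPullback hW C hWC (V.X.germToFunctionField W a) =
      algebraMap C (affine (k := k) C).K (toChart C hWC a) := by
  have hg := affineHom_genericPoint (k := k) hW _ (toChart_injective C hWC)
  have hy : genericPoint V.X ∈ W := by
    obtain ⟨y, hy⟩ := ‹Nonempty W›
    exact (V.genericPoint_specializes y).mem_open W.2 hy
  have h1 := affineHom_stalkMap (k := k) hW (toChart C hWC) (affineGeneric C)
    (hg.symm ▸ hy : affineHom (k := k) hW _ (genericPoint (affine (k := k) C).X) ∈ W) a
  refine Eq.trans ?_ h1
  refine congrArg ((affineHom hW (toChart C hWC)).stalkMap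
    (genericPoint (affine (k := k) C).X)) ?_
  exact V.X.presheaf.germ_stalkSpecializes_apply _ (specializes_of_eq hg) _

/-- Elements of `C` are fractions of functions on `W`, and on those the pullback is already known.
This identifies the two function fields compatibly with `C`. -/
theorem chartPullback_coe (c : C) :
    chartPullback hW C hWC (c : V.K) = algebraMap C (affine (k := k) C).K c := by
  have := functionField_isFractionRing_of_isAffineOpen V.X W hW
  obtain ⟨a, b, hb, hab⟩ := IsFractionRing.div_surjective (A := Γ(V.X, W)) (c : V.K)
  have hb0 : algebraMap Γ(V.X, W) V.K b ≠ 0 :=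
    IsFractionRing.to_map_ne_zero_of_mem_nonZeroDivisors hb
  have h1 : c * toChart C hWC b = toChart C hWC a := Subtype.ext (by
    change (c : V.K) * algebraMap Γ(V.X, W) V.K b = algebraMap Γ(V.X, W) V.K a
    rw [← hab, div_mul_cancel₀ _ hb0])
  have h2 := congrArg (algebraMap C (affine (k := k) C).K) h1
  rw [map_mul, ← chartPullback_germ hW, ← chartPullback_germ hW] at h2
  have h3 : (c : V.K) * algebraMap Γ(V.X, W) V.K b = algebraMap Γ(V.X, W) V.K a := by
    rw [← hab, div_mul_cancel₀ _ hb0]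
  have h4 := congrArg (chartPullback hW C hWC) h3
  rw [map_mul] at h4
  exact mul_right_cancel₀ ((map_ne_zero (chartPullback hW C hWC)).mpr hb0) (h4.trans h2.symm)

theorem chartPullback_bijective : Function.Bijective (chartPullback hW C hWC) := by
  refine ⟨(chartPullback hW C hWC).injective, fun y => ?_⟩
  obtain ⟨a, b, hb, rfl⟩ := IsFractionRing.div_surjective (A := C) y
  exact ⟨a / b, by rw [map_div₀, chartPullback_coe, chartPullback_coe]⟩

/-- The prime divisor on a chart given by a prime ideal. -/
def chartDivisor [IsIntegrallyClosed C] (p : PrimeSpectrum C)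
    (hp : Order.coheight (affinePoint (k := k) C p) = 1) : V.DivisorOver where
  Y := affine C
  isNormal := inferInstance
  f := affineHom hW (toChart C hWC)
  comp_str := affineHom_comp_str hW _ (toChart_sectionConstants C hWC)
  map_genericPoint := affineHom_genericPoint hW _ (toChart_injective C hWC)
  bijective := by
    have h1 := chartPullback_bijective hW C hWC
    have h2 := bijective_stalkSpecializes_of_eq
      (affineHom_genericPoint (k := k) hW _ (toChart_injective C hWC))
    rw [chartPullback, CommRingCat.hom_comp, RingHom.coe_comp] at h1
    exact (Function.Bijective.of_comp_iff _ h2).mp h1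
  E := ⟨affinePoint C p, hp⟩

end Chart

end Variety

/-! ### Differentials on the blow-up -/

/-- Both sides are alternating in the rows of `A`, so it is enough to compare them on permutations
of the standard basis. -/
theorem ιMulti_eq_det_smul {R M : Type*} [CommRing R] [AddCommGroup M] [Module R M] {n : ℕ}
    (A : Matrix (Fin n) (Fin n) R) (s t : Fin n → M) (h : ∀ i, t i = ∑ j, A i j • s j) :
    exteriorPower.ιMulti R n t = A.det • exteriorPower.ιMulti R n s := by
  have key : (exteriorPower.ιMulti R n).compLinearMap (Fintype.linearCombination R s) =
      (LinearMap.toSpanSingleton R _ (exteriorPower.ιMulti R n s)).compAlternatingMap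
        Matrix.detRowAlternating := by
    refine Module.Basis.ext_alternating (Pi.basisFun R (Fin n)) fun v hv => ?_
    let σ : Equiv.Perm (Fin n) := Equiv.ofBijective v (Finite.injective_iff_bijective.mp hv)
    have h1 : (fun i => Pi.basisFun R (Fin n) (v i)) = (fun i => Pi.basisFun R (Fin n) i) ∘ σ := rfl
    rw [h1, AlternatingMap.map_perm, AlternatingMap.map_perm]
    congr 1
    have h2 : Matrix.detRowAlternating (fun i => Pi.basisFun R (Fin n) i) = 1 := by
      have : (fun i => Pi.basisFun R (Fin n) i) = (1 : Matrix (Fin n) (Fin n) R) := by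
        ext i j
        simp [Matrix.one_apply, Pi.single_apply, eq_comm]
      rw [this]
      exact Matrix.det_one
    rw [LinearMap.compAlternatingMap_apply, h2, LinearMap.toSpanSingleton_apply, one_smul,
      AlternatingMap.compLinearMap_apply]
    congr 1
    ext i
    simp [Fintype.linearCombination_apply, Pi.single_apply]
  have h3 := congrArg (fun f => f A) key
  have h4 : t = fun i => Fintype.linearCombination R s (A i) := by
    ext i
    rw [h, Fintype.linearCombination_apply]
  rw [h4]
  exact h3

/-! ### Bases of differentials and uniformizers on the chart -/

section Algebra

open IsLocalRing

variable {k O K : Type u} [Field k] [CommRing O] [Algebra k O] [Field K] [Algebra k K] [Algebra O K]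
  [IsScalarTower k O K]

theorem span_D_algebraMap_eq_top [IsFractionRing O K] {ι : Type*} {t : ι → O}
    (hspan : Submodule.span O (Set.range fun i => KaehlerDifferential.D k O (t i)) = ⊤) :
    Submodule.span K (Set.range fun i => KaehlerDifferential.D k K (algebraMap O K (t i))) = ⊤ := by
  have := KaehlerDifferential.isLocalizedModule_map k O K (nonZeroDivisors O)
  have h := span_eq_top_of_isLocalizedModule K (nonZeroDivisors O)
    (KaehlerDifferential.map k k O K) hspan
  rw [← Set.range_comp] at h
  have h2 : (fun i => KaehlerDifferential.D k K (algebraMap O K (t i))) =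
      KaehlerDifferential.map k k O K ∘ fun i => KaehlerDifferential.D k O (t i) := by
    funext i
    simp
  rwa [h2]

theorem linearIndependent_D_algebraMap [IsFractionRing O K] {ι : Type*} {t : ι → O}
    (hli : LinearIndependent O fun i => KaehlerDifferential.D k O (t i)) :
    LinearIndependent K fun i => KaehlerDifferential.D k K (algebraMap O K (t i)) := by
  have := KaehlerDifferential.isLocalizedModule_map k O K (nonZeroDivisors O)
  have h := hli.of_isLocalizedModule K (nonZeroDivisors O) (KaehlerDifferential.map k k O K)
  have h2 : (fun i => KaehlerDifferential.D k K (algebraMap O K (t i))) =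
      KaehlerDifferential.map k k O K ∘ fun i => KaehlerDifferential.D k O (t i) := by
    funext i
    simp
  rwa [h2]

theorem finrank_kaehlerDifferential_eq [IsFractionRing O K] {n : ℕ} {t : Fin n → O}
    (hli : LinearIndependent O fun i => KaehlerDifferential.D k O (t i))
    (hspan : Submodule.span O (Set.range fun i => KaehlerDifferential.D k O (t i)) = ⊤) :
    Module.finrank K (Ω[K⁄k]) = n := by
  have := Module.finrank_eq_card_basis (Module.Basis.mk (linearIndependent_D_algebraMap (K := K) hli)
    (span_D_algebraMap_eq_top (K := K) hspan).ge)
  rwa [Fintype.card_fin] at this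

/-- Since `t j = s 0 * s j`, the `ds i` still generate the differentials of `K`. Their number is the
dimension, so they are independent over `K`, and hence already over `L`. -/
theorem linearIndependent_D_blowup [IsFractionRing O K] {d : ℕ} {t : Fin (d + 1) → O}
    (hli : LinearIndependent O fun i => KaehlerDifferential.D k O (t i))
    (hspan : Submodule.span O (Set.range fun i => KaehlerDifferential.D k O (t i)) = ⊤)
    (ht0 : algebraMap O K (t 0) ≠ 0)
    (L : Type u) [CommRing L] [Algebra k L] [Algebra L K] [IsScalarTower k L K]
    (hinj : Function.Injective (algebraMap L K)) (s : Fin (d + 1) → L)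
    (hs0 : algebraMap L K (s 0) = algebraMap O K (t 0))
    (hs : ∀ i : Fin d, algebraMap L K (s i.succ) =
      algebraMap O K (t i.succ) / algebraMap O K (t 0)) :
    LinearIndependent L fun i => KaehlerDifferential.D k L (s i) := by
  have h1 : ⊤ ≤ Submodule.span K
      (Set.range fun i => KaehlerDifferential.D k K (algebraMap L K (s i))) := by
    rw [← span_D_algebraMap_eq_top (K := K) hspan, Submodule.span_le]
    rintro _ ⟨i, rfl⟩
    have hD : ∀ i, KaehlerDifferential.D k K (algebraMap L K (s i)) ∈ Submodule.span K
      (Set.range fun i => KaehlerDifferential.D k K (algebraMap L K (s i))) :=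
        fun i => Submodule.subset_span ⟨i, rfl⟩
    refine Fin.cases ?_ (fun j => ?_) i
    · have := hD 0
      rwa [hs0] at this
    · have : algebraMap O K (t j.succ) = algebraMap L K (s 0) * algebraMap L K (s j.succ) := by
        rw [hs0, hs, mul_div_cancel₀ _ ht0]
      simp only [SetLike.mem_coe]
      rw [this, Derivation.leibniz]
      exact add_mem (Submodule.smul_mem _ _ (hD _)) (Submodule.smul_mem _ _ (hD _))
  have h2 := linearIndependent_of_top_le_span_of_card_eq_finrank h1 (by
    rw [Fintype.card_fin, finrank_kaehlerDifferential_eq (K := K) hli hspan])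
  have h3 : LinearIndependent L fun i => KaehlerDifferential.D k K (algebraMap L K (s i)) :=
    h2.restrict_scalars (by
      intro a b hab
      refine hinj ?_
      simpa [Algebra.smul_def] using hab)
  refine LinearIndependent.of_comp (KaehlerDifferential.map k k L K) ?_
  convert h3 using 1
  funext i
  simp

/-- `L` is the valuation ring of `v`, and `exp (-1)` is the largest value below one. So every
nonunit is divisible by `ϖ`. -/
theorem isDiscreteValuationRing_of_valuation (v : Valuation K (WithZero (Multiplicative ℤ)))
    (L : Type u) [CommRing L] [IsDomain L] [IsLocalRing L] [IsNoetherianRing L] [Algebra L K]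
    (hinj : Function.Injective (algebraMap L K))
    (hL : ∀ y, v y ≤ 1 ↔ ∃ l : L, algebraMap L K l = y) (ϖ : L)
    (hϖ : v (algebraMap L K ϖ) = WithZero.exp (-1)) :
    ∃ _ : IsDiscreteValuationRing L, Irreducible ϖ := by
  have hϖ0 : algebraMap L K ϖ ≠ 0 := fun h => by
    rw [h, map_zero] at hϖ; exact WithZero.exp_ne_zero hϖ.symm
  have hunit : ∀ l : L, v (algebraMap L K l) = 1 → IsUnit l := by
    intro l hl
    have hl0 : algebraMap L K l ≠ 0 := fun h => by
      rw [h, map_zero] at hl; exact zero_ne_one hl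
    obtain ⟨l', hl'⟩ := (hL (algebraMap L K l)⁻¹).mp (by rw [map_inv₀, hl, inv_one])
    exact IsUnit.of_mul_eq_one l' (hinj (by rw [map_mul, hl', map_one, mul_inv_cancel₀ hl0]))
  have hnu : ϖ ∈ maximalIdeal L := by
    intro hu
    obtain ⟨u, hu⟩ := hu.exists_right_inv
    have h1 := congrArg (fun a => v (algebraMap L K a)) hu
    simp only [map_mul, map_one, hϖ] at h1
    have h2 : v (algebraMap L K u) ≤ 1 := (hL _).mpr ⟨u, rfl⟩
    have h3 : WithZero.exp (-1 : ℤ) * v (algebraMap L K u) < 1 := by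
      refine lt_of_le_of_lt (mul_le_of_le_one_right' h2) ?_
      rw [← WithZero.exp_zero, WithZero.exp_lt_exp]
      norm_num
    exact h3.ne h1
  have hmax : maximalIdeal L = Ideal.span {ϖ} := by
    refine le_antisymm (fun l hl => ?_) ((Ideal.span_singleton_le_iff_mem _).mpr hnu)
    rw [Ideal.mem_span_singleton]
    have hle : v (algebraMap L K l) ≤ 1 := (hL _).mpr ⟨l, rfl⟩
    have hlt : v (algebraMap L K l) < 1 := lt_of_le_of_ne hle fun h => hl (hunit l h)
    obtain ⟨q, hq⟩ := (hL (algebraMap L K l / algebraMap L K ϖ)).mp (by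
      rw [map_div₀, hϖ]
      by_cases h0 : v (algebraMap L K l) = 0
      · rw [h0, zero_div]; exact zero_le_one
      rw [← WithZero.exp_log h0] at hlt ⊢
      rw [← WithZero.exp_zero, WithZero.exp_lt_exp] at hlt
      rw [← WithZero.exp_sub, ← WithZero.exp_zero, WithZero.exp_le_exp]
      omega)
    exact ⟨q, hinj (by rw [map_mul, hq, mul_div_cancel₀ _ hϖ0])⟩
  have hF : ¬ IsField L := by
    rw [isField_iff_maximalIdeal_eq, hmax, Ideal.span_singleton_eq_bot]
    rintro rfl
    exact hϖ0 (map_zero _)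
  have hpr : (maximalIdeal L).IsPrincipal := ⟨⟨ϖ, hmax⟩⟩
  have hdvr : IsDiscreteValuationRing L := ((IsDiscreteValuationRing.TFAE L hF).out 0 4).mpr hpr
  exact ⟨hdvr, (IsDiscreteValuationRing.irreducible_iff_uniformizer ϖ).mpr hmax⟩

end Algebra

open IsLocalRing in
-- The value cannot drop below `exp (-e)`, because a nonzero form of degree `e` in the coordinates
-- never lies in the next power of the maximal ideal.
theorem valuation_aeval_eq_exp {k O K : Type u} [Field k] [CommRing O] [Algebra k O] [Field K]
    [Algebra O K] [IsLocalRing O] [Algebra.FormallySmooth k O] {n : ℕ}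
    {t : Fin n → O}
    (hm : maximalIdeal O = Ideal.span (Set.range t))
    (hk : ∀ a : O, ∃ c : k, a - algebraMap k O c ∈ maximalIdeal O)
    (hli : LinearIndependent O fun i => KaehlerDifferential.D k O (t i))
    (hspan : Submodule.span O (Set.range fun i => KaehlerDifferential.D k O (t i)) = ⊤)
    (v : Valuation K (WithZero (Multiplicative ℤ)))
    (hv : ∀ (a : O) (r : ℕ),
      v (algebraMap O K a) ≤ WithZero.exp (-(r : ℤ)) ↔ a ∈ maximalIdeal O ^ r)
    (e : ℕ) (F : MvPolynomial (Fin n) k) (hF0 : F ≠ 0) (hF : F.IsHomogeneous e) :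
    v (algebraMap O K (MvPolynomial.aeval t F)) = WithZero.exp (-(e : ℤ)) := by
  have h1 : MvPolynomial.aeval t F ∈ maximalIdeal O ^ e := by
    rw [MvPolynomial.aeval_def, MvPolynomial.eval₂_eq]
    refine Ideal.sum_mem _ fun m hmF => Ideal.mul_mem_left _ _ ?_
    have hdeg : ∑ i ∈ m.support, m i = e := by
      have := hF (MvPolynomial.mem_support_iff.mp hmF)
      rw [Finsupp.weight_apply, Finsupp.sum] at this
      simpa using this
    rw [← hdeg, ← Finset.prod_pow_eq_pow_sum]
    refine Ideal.prod_mem_prod fun i _ => Ideal.pow_mem_pow ?_ _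
    rw [hm]
    exact Ideal.subset_span ⟨i, rfl⟩
  have h2 : MvPolynomial.aeval t F ∉ maximalIdeal O ^ (e + 1) := fun h =>
    hF0 (eq_zero_of_aeval_mem_pow hm hk hli hspan hF h)
  rw [← hv] at h1 h2
  refine le_antisymm h1 ?_
  push Not at h2
  have h0 : v (algebraMap O K (MvPolynomial.aeval t F)) ≠ 0 := fun h => by
    rw [h] at h2; exact not_lt_zero h2
  rw [← WithZero.exp_log h0, WithZero.exp_lt_exp] at h2
  rw [← WithZero.exp_log h0, WithZero.exp_le_exp]
  push_cast at h2
  omega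

/-! ### The exceptional divisor of the blow-up of a point -/

theorem lt_one_iff_le_exp_neg_one (a : WithZero (Multiplicative ℤ)) :
    a < 1 ↔ a ≤ WithZero.exp (-1) := by
  by_cases h : a = 0
  · simp [h]
  rw [← WithZero.exp_log h, ← WithZero.exp_zero, WithZero.exp_lt_exp, WithZero.exp_le_exp]
  omega

/-- The ideal of elements of positive valuation in a subalgebra of the valuation ring. -/
def centerIdeal {k K : Type*} [Field k] [Field K] [Algebra k K]
    (v : Valuation K (WithZero (Multiplicative ℤ))) (C : Subalgebra k K) (hC : ∀ c ∈ C, v c ≤ 1) :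
    PrimeSpectrum C where
  asIdeal :=
    { carrier := {c | v c < 1}
      zero_mem' := by simp
      add_mem' := fun {a b} ha hb => (v.map_add (a : K) b).trans_lt (max_lt ha hb)
      smul_mem' := fun c a ha => by
        change v ((c : K) * a) < 1
        rw [map_mul]
        exact (mul_le_of_le_one_left' (hC c c.2)).trans_lt ha }
  isPrime :=
    { ne_top' := fun h => by
        have h1 := (Ideal.eq_top_iff_one _).mp h
        have h2 : v ((1 : C) : K) < 1 := h1
        simp at h2
      mem_or_mem' := fun {a b} hab => by
        by_contra! hc
        have ha : ¬ v (a : K) < 1 := hc.1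
        have hb : ¬ v (b : K) < 1 := hc.2
        have h1 : v (a : K) = 1 := le_antisymm (hC a a.2) (not_lt.mp ha)
        have h2 : v (b : K) = 1 := le_antisymm (hC b b.2) (not_lt.mp hb)
        have h3 : v ((a : K) * b) < 1 := hab
        rw [map_mul, h1, h2, mul_one] at h3
        exact lt_irrefl _ h3 }

theorem mem_centerIdeal {k K : Type*} [Field k] [Field K] [Algebra k K]
    {v : Valuation K (WithZero (Multiplicative ℤ))} {C : Subalgebra k K}
    {hC : ∀ c ∈ C, v c ≤ 1} {c : C} : c ∈ (centerIdeal v C hC).asIdeal ↔ v (c : K) < 1 :=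
  Iff.rfl

namespace Variety

variable {k : Type u} [Field k] (V : Variety k)

theorem wedge_eq_det_smul {n : ℕ} (A : Matrix (Fin n) (Fin n) V.K) (s t : Fin n → V.K)
    (h : ∀ i, KaehlerDifferential.D k V.K (t i) = ∑ j, A i j • KaehlerDifferential.D k V.K (s j)) :
    V.wedge t = A.det • V.wedge s :=
  ιMulti_eq_det_smul A _ _ h

/-- From `dt i = s 0 • ds i + s i • ds 0` the change of frame is lower triangular, with diagonal
entries `1` once and `s 0` repeated `d` times. The exponent `d` is the canonical coefficient of the
exceptional divisor. -/
theorem wedge_blowup {d : ℕ} (s t : Fin (d + 1) → V.K) (h0 : t 0 = s 0)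
    (h : ∀ i : Fin d, t i.succ = s 0 * s i.succ) :
    V.wedge t = s 0 ^ d • V.wedge s := by
  let A : Matrix (Fin (d + 1)) (Fin (d + 1)) V.K := fun i j =>
    Fin.cases (if j = 0 then 1 else 0)
      (fun i' => Fin.cases (s i'.succ) (fun j' => if i' = j' then s 0 else 0) j) i
  have hdet : A.det = s 0 ^ d := by
    rw [Matrix.det_of_isLowerTriangular, Fin.prod_univ_succ]
    · simp [A]
    · intro i j hij
      have hij : i < j := hij
      obtain ⟨j', rfl⟩ := Fin.exists_succ_eq.mpr (Fin.ne_zero_of_lt hij)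
      refine Fin.cases (motive := fun i => i < j'.succ → A i j'.succ = 0) ?_ (fun i' hi => ?_) i hij
      · simp [A]
      · have : i' ≠ j' := fun h => by simp [h] at hi
        simp [A, this]
  rw [← hdet]
  refine V.wedge_eq_det_smul A s t fun i => ?_
  rw [Fin.sum_univ_succ]
  refine Fin.cases ?_ (fun i' => ?_) i
  · simp [A, h0]
  · rw [h, Derivation.leibniz, add_comm]
    simp [A]

/-- The prime divisor of the blow-up of a smooth closed point. -/
theorem exists_blowup_divisor [IsAlgClosed k] {x : V.X} (hx : IsClosed {x}) (hsm : V.IsSmoothAt x)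
    {d : ℕ} {t : Fin (d + 1) → V.X.presheaf.stalk x}
    (hm : IsLocalRing.maximalIdeal (V.X.presheaf.stalk x) = Ideal.span (Set.range t))
    (hli : LinearIndependent (V.X.presheaf.stalk x)
      fun i => KaehlerDifferential.D k (V.X.presheaf.stalk x) (t i))
    (hspan : Submodule.span (V.X.presheaf.stalk x)
      (Set.range fun i => KaehlerDifferential.D k (V.X.presheaf.stalk x) (t i)) = ⊤) :
    ∃ B : V.DivisorOver, B.centerPoint = x ∧
      (∀ (r : ℕ) (a : V.X.presheaf.stalk x), a ≠ 0 →
        a ∈ IsLocalRing.maximalIdeal (V.X.presheaf.stalk x) ^ r →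
        (r : ℤ) ≤ B.Y.ord (B.pullback (algebraMap _ V.K a)) B.E) ∧
      B.Y.HasFormOrd 1 (fun i => B.pullback (algebraMap _ V.K (t i))) B.E d := by
  have hfs := V.formallySmooth_stalk hsm
  have heft := V.essFiniteType_stalk x
  have hk := fun a => V.exists_sub_algebraMap_mem_maximalIdeal hx a
  obtain ⟨v, hv⟩ := exists_valuation_le_exp_iff V.K fun r s a b =>
    mul_notMem_pow (k := k) hm hk hli hspan (r := r) (s := s) (a := a) (b := b)
  have hform := valuation_aeval_eq_exp (K := V.K) hm hk hli hspan v hv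
  have hvO : ∀ a : V.X.presheaf.stalk x, v (algebraMap _ V.K a) ≤ 1 := fun a => by
    have := (hv a 0).mpr (by simp)
    simpa using this
  have hvτ : v (algebraMap _ V.K (t 0)) = WithZero.exp (-1) := by
    have := hform 1 (MvPolynomial.X 0) (MvPolynomial.X_ne_zero 0) (MvPolynomial.isHomogeneous_X k 0)
    simpa using this
  have hτ0 : algebraMap _ V.K (t 0) ≠ 0 := fun h => by
    rw [h, map_zero] at hvτ; exact WithZero.exp_ne_zero hvτ.symm
  obtain ⟨_, ⟨W, hW, rfl⟩, hxW, -⟩ :=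
    V.X.isBasis_affineOpens.exists_subset_of_mem_open (Set.mem_univ x) isOpen_univ
  replace hW : IsAffineOpen W := hW
  have hWne : Nonempty W := ⟨⟨x, hxW⟩⟩
  have hgerm : ∀ a, V.X.germToFunctionField W a =
      algebraMap _ V.K (V.X.presheaf.germ W x hxW a) := fun a =>
    (Scheme.algebraMap_germ_eq_germToFunctionField (X := V.X) (U := W) (x := x) hxW a).symm
  -- The chart is required to contain the functions on an affine neighbourhood of `x`, so that it
  -- maps to the variety.
  obtain ⟨C, hAC, hCfg, hCic, hCv, hCs⟩ : ∃ C : Subalgebra k V.K,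
      (∀ a, V.X.germToFunctionField W a ∈ C) ∧ C.FG ∧ IsIntegrallyClosed C ∧
      (∀ c ∈ C, v c ≤ 1) ∧ ∀ y, v y ≤ 1 → ∃ c ∈ C, ∃ s ∈ C, v s = 1 ∧ y * s = c := by
    let _ : Algebra k Γ(V.X, W) := (V.sectionConstants W).toAlgebra
    have : Algebra.FiniteType k Γ(V.X, W) := V.finiteType_sectionConstants hW
    let g : Γ(V.X, W) →ₐ[k] V.K :=
      { (V.X.germToFunctionField W).hom with
        commutes' := fun c => V.germ_sectionConstants _ c }
    have hg : g.range.FG := by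
      rw [← Algebra.map_top]
      exact Subalgebra.FG.map _ Algebra.FiniteType.out
    obtain ⟨C, h1, h2, h3, h4, h5⟩ := exists_chart (K := V.K) hspan v hform g.range hg (by
      rintro _ ⟨a, rfl⟩
      have := hvO (V.X.presheaf.germ W x hxW a)
      rwa [← hgerm] at this)
    exact ⟨C, fun a => h1 ⟨a, rfl⟩, h2, h3, h4, h5⟩
  have hft : Algebra.FiniteType k C := Subalgebra.fg_iff_finiteType C |>.mp hCfg
  set p := centerIdeal v C hCv with hp
  let L := (affine (k := k) C).X.presheaf.stalk (affinePoint C p)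
  -- Identifying the function fields turns the local ring of the chart at the center of `v` into the
  -- valuation ring of `v`.
  let e := RingEquiv.ofBijective _ (chartPullback_bijective hW C hAC)
  let _ : Algebra L V.K := (e.symm.toRingHom.comp (algebraMap L (affine (k := k) C).K)).toAlgebra
  have he : ∀ l : L, chartPullback hW C hAC (algebraMap L V.K l) =
      algebraMap L (affine (k := k) C).K l := fun l => e.apply_symm_apply _
  have hcoe : ∀ c : C, algebraMap L V.K (algebraMap C L c) = c := fun c => by
    refine (chartPullback hW C hAC).injective ?_
    rw [he, chartPullback_coe, ← IsScalarTower.algebraMap_apply]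
  have htow : IsScalarTower k L V.K := IsScalarTower.of_algebraMap_eq fun c => by
    rw [IsScalarTower.algebraMap_apply k C L, hcoe]
    rfl
  have hinj : Function.Injective (algebraMap L V.K) := by
    intro a b hab
    have := congrArg (chartPullback hW C hAC) hab
    rw [he, he] at this
    exact IsFractionRing.injective L (affine (k := k) C).K this
  have hL : ∀ y, v y ≤ 1 ↔ ∃ l : L, algebraMap L V.K l = y := by
    intro y
    constructor
    · intro hy
      obtain ⟨c, hc, s, hs, hvs, hys⟩ := hCs y hy
      have hsp : (⟨s, hs⟩ : C) ∈ p.asIdeal.primeCompl := fun h =>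
        (mem_centerIdeal.mp h).ne hvs
      have hs0 : s ≠ 0 := fun h => by rw [h, map_zero] at hvs; exact zero_ne_one hvs
      refine ⟨IsLocalization.mk' L (⟨c, hc⟩ : C) ⟨⟨s, hs⟩, hsp⟩, ?_⟩
      have h1 := congrArg (algebraMap L V.K)
        (IsLocalization.mk'_spec L (⟨c, hc⟩ : C) (⟨⟨s, hs⟩, hsp⟩ : p.asIdeal.primeCompl))
      rw [map_mul, hcoe, hcoe] at h1
      exact mul_right_cancel₀ hs0 (h1.trans hys.symm)
    · rintro ⟨l, rfl⟩
      obtain ⟨⟨c, s⟩, hcs⟩ := IsLocalization.surj p.asIdeal.primeCompl l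
      have h1 := congrArg (fun a => v (algebraMap L V.K a)) hcs
      simp only [map_mul, hcoe] at h1
      have hvs : v ((s : C) : V.K) = 1 :=
        le_antisymm (hCv _ s.1.2) (not_lt.mp fun h => s.2 (mem_centerIdeal.mpr h))
      rw [hvs, mul_one] at h1
      rw [h1]
      exact hCv _ c.2
  -- The blow-up coordinates `t 0` and `t j / t 0`. The ratios lie in the valuation ring because
  -- every `t j` is in the maximal ideal, while `t 0` has order exactly one.
  choose s hs using fun i : Fin (d + 1) => (hL (Fin.cases (algebraMap _ V.K (t 0))
      (fun j : Fin d => algebraMap _ V.K (t j.succ) / algebraMap _ V.K (t 0)) i)).mp (by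
    refine Fin.cases (hvO _) (fun j => ?_) i
    have h1 : v (algebraMap _ V.K (t j.succ)) ≤ WithZero.exp (-((1 : ℕ) : ℤ)) := by
      rw [hv, pow_one, hm]
      exact Ideal.subset_span ⟨_, rfl⟩
    change v (_ / _) ≤ 1
    rw [map_div₀, hvτ]
    refine (div_le_div_of_nonneg_right h1 zero_le).trans ?_
    exact (div_self WithZero.exp_ne_zero).le)
  have hs0 : algebraMap L V.K (s 0) = algebraMap _ V.K (t 0) := hs 0
  have hs1 : ∀ i : Fin d, algebraMap L V.K (s i.succ) =
      algebraMap _ V.K (t i.succ) / algebraMap _ V.K (t 0) := fun i => hs i.succ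
  obtain ⟨hdvr, hirr⟩ := isDiscreteValuationRing_of_valuation v L hinj hL (s 0) (by rw [hs0, hvτ])
  have hcoh := coheight_affinePoint (k := k) C p
  let Y := affine (k := k) C
  let E : Y.PrimeDivisor := ⟨affinePoint C p, hcoh⟩
  have hord0 : Y.ord (algebraMap L Y.K (s 0)) E = 1 :=
    Y.ord_algebraMap_irreducible E hirr
  have hs00 : algebraMap L Y.K (s 0) ≠ 0 := by
    rw [← he, hs0]
    exact (map_ne_zero _).mpr hτ0
  refine ⟨chartDivisor hW C hAC p hcoh, ?_, fun r a ha har => ?_, ?_⟩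
  -- The center is `x`: a function on `W` has positive order for `v` exactly when it vanishes at
  -- `x`.
  · refine affineHom_eq hW _ hxW p fun a => ?_
    have hloc := hW.isLocalization_stalk ⟨x, hxW⟩
    let _ := V.X.presheaf.algebra_section_stalk (⟨x, hxW⟩ : W)
    rw [mem_centerIdeal, lt_one_iff_le_exp_neg_one]
    have h1 : ((toChart C hAC a : C) : V.K) = algebraMap _ V.K (V.X.presheaf.germ W x hxW a) :=
      hgerm a
    have h2 := hv (V.X.presheaf.germ W x hxW a) 1
    rw [pow_one, Nat.cast_one] at h2
    rw [h1, h2]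
    exact IsLocalization.AtPrime.to_map_mem_maximal_iff (V.X.presheaf.stalk x)
      (hW.primeIdealOf ⟨x, hxW⟩).asIdeal a
  · change (r : ℤ) ≤ Y.ord (chartPullback hW C hAC (algebraMap _ V.K a)) E
    have ha0 : algebraMap _ V.K a ≠ 0 := by
      rwa [ne_eq, map_eq_zero_iff _ (IsFractionRing.injective _ V.K)]
    -- Dividing by `t 0 ^ r` leaves a regular function along `E`, and `t 0` is a uniformizer there.
    obtain ⟨l, hl⟩ := (hL (algebraMap _ V.K a / algebraMap _ V.K (t 0) ^ r)).mp (by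
      rw [map_div₀, map_pow, hvτ, ← WithZero.exp_nsmul]
      have h1 := (hv a r).mpr har
      have h2 : r • (-1 : ℤ) = -(r : ℤ) := by simp
      rw [h2]
      exact (div_le_div_of_nonneg_right h1 zero_le).trans (div_self WithZero.exp_ne_zero).le)
    have hl0 : algebraMap L V.K l ≠ 0 := by
      rw [hl]; exact div_ne_zero ha0 (pow_ne_zero _ hτ0)
    have h3 : algebraMap _ V.K a = algebraMap L V.K (s 0) ^ r * algebraMap L V.K l := by
      rw [hs0, hl, mul_div_cancel₀ _ (pow_ne_zero _ hτ0)]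
    have hl0' : algebraMap L Y.K l ≠ 0 := by
      rw [← he]; exact (map_ne_zero _).mpr hl0
    rw [h3, map_mul, map_pow, he, he, ord_mul _ (pow_ne_zero _ hs00) hl0', ord_pow _ hs00, hord0]
    have := (Y.ord_nonneg_iff hl0' E).mpr ⟨l, rfl⟩
    linarith
  · change Y.HasFormOrd 1 (fun i => chartPullback hW C hAC (algebraMap _ V.K (t i))) E d
    refine ⟨s, algebraMap L Y.K (s 0) ^ d, ?_, ?_, pow_ne_zero _ hs00, ?_, ?_⟩
    · exact linearIndependent_D_blowup hli hspan hτ0 L hinj s hs0 hs1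
    · exact span_D_eq_top_of_valuation hm hspan v hv hvτ L hinj hL s hs0 hs1
    · rw [one_smul]
      refine Y.wedge_blowup (fun i => algebraMap L Y.K (s i)) _ ?_ fun i => ?_
      · rw [← hs0, he]
      · rw [← he, ← he, ← map_mul, hs0, hs1, mul_div_cancel₀ _ hτ0]
    · rw [ord_pow _ hs00, hord0, mul_one]

end Variety

/-! ### Divisors, pullbacks and forms -/

namespace Variety

variable {k : Type u} [Field k] (V : Variety k)

/-- The divisor of a nonzero rational function. -/
def principal {f : V.K} (hf : f ≠ 0) : V.RDiv :=
  Finsupp.ofSupportFinite (fun P => (V.ord f P : ℝ))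
    ((V.finite_setOf_ord_ne_zero hf).subset fun P hP => by simpa using hP)

@[simp] theorem principal_apply {f : V.K} (hf : f ≠ 0) (P : V.PrimeDivisor) :
    V.principal hf P = (V.ord f P : ℝ) := rfl

theorem isPrincipal_principal {f : V.K} (hf : f ≠ 0) : V.IsPrincipal (V.principal hf) :=
  ⟨f, hf, fun _ => rfl⟩

theorem IsPrincipal.isCartier {V : Variety k} {D : V.RDiv} (h : V.IsPrincipal D) :
    V.IsCartier D := fun _ =>
  let ⟨f, hf, hP⟩ := h
  ⟨⊤, trivial, f, hf, fun P _ => hP P⟩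

variable {V}

/-- Near a point, an `ℝ`-Cartier divisor is a real combination of divisors of regular functions. -/
theorem IsRCartier.exists_eq_sum {D : V.RDiv} (hD : V.IsRCartier D) (x : V.X) :
    ∃ (U : V.X.Opens) (N : ℕ) (r : Fin N → ℝ) (h : Fin N → V.X.presheaf.stalk x), x ∈ U ∧
      (∀ i, h i ≠ 0) ∧ ∀ P : V.PrimeDivisor, P.1 ∈ U →
        D P = ∑ i, r i * (V.ord (algebraMap _ V.K (h i)) P : ℝ) := by
  obtain ⟨N, c, G, rfl⟩ := Submodule.mem_span_set'.mp hD
  choose U hU f hf hfP using fun i => (G i).2 x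
  -- Each local equation is split into numerator and denominator, entered with opposite
  -- coefficients. This is why the number of functions doubles.
  choose a b hb hab using fun i =>
    IsFractionRing.div_surjective (A := V.X.presheaf.stalk x) (f i)
  have hb0 : ∀ i, b i ≠ 0 := fun i => nonZeroDivisors.ne_zero (hb i)
  have ha0 : ∀ i, a i ≠ 0 := fun i h => hf i (by rw [← hab, h, map_zero, zero_div])
  have hne : ∀ c : V.X.presheaf.stalk x, c ≠ 0 → algebraMap _ V.K c ≠ 0 := fun c hc =>
    (map_ne_zero_iff _ (IsFractionRing.injective _ V.K)).mpr hc
  refine ⟨⟨⋂ i, U i, isOpen_iInter_of_finite fun i => (U i).2⟩, N + N, Fin.append c (fun i => - c i), Fin.append a b, ?_, ?_, ?_⟩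
  · exact Set.mem_iInter.mpr hU
  · intro i
    refine Fin.addCases (fun j => ?_) (fun j => ?_) i
    · rw [Fin.append_left]; exact ha0 j
    · rw [Fin.append_right]; exact hb0 j
  · intro P hP
    have hPU : ∀ i, P.1 ∈ U i := fun i => Set.mem_iInter.mp hP i
    rw [Fin.sum_univ_add]
    simp only [Fin.append_left, Fin.append_right]
    rw [← Finset.sum_add_distrib, Finsupp.finsetSum_apply]
    refine Finset.sum_congr rfl fun i _ => ?_
    rw [Finsupp.smul_apply, smul_eq_mul, hfP i P (hPU i), ← hab i, div_eq_mul_inv,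
      V.ord_mul (hne _ (ha0 i)) (inv_ne_zero (hne _ (hb0 i))), V.ord_inv (hne _ (hb0 i))]
    push_cast
    ring

namespace DivisorOver

variable (B : V.DivisorOver)

theorem pullback_ne_zero {f : V.K} (hf : f ≠ 0) : B.pullback f ≠ 0 := (map_ne_zero _).mpr hf

theorem hasPullbackCoeff_principal {f : V.K} (hf : f ≠ 0) :
    B.HasPullbackCoeff (V.principal hf) (B.Y.ord (B.pullback f) B.E) :=
  ⟨⊤, 1, fun _ => 1, fun _ => f, trivial, fun _ => hf, fun P _ => by simp, by simp⟩

variable {B}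

theorem HasPullbackCoeff.smul {D : V.RDiv} {c : ℝ} (h : B.HasPullbackCoeff D c) (a : ℝ) :
    B.HasPullbackCoeff (a • D) (a * c) := by
  obtain ⟨U, N, r, f, hU, hf, hD, rfl⟩ := h
  refine ⟨U, N, fun i => a * r i, f, hU, hf, fun P hP => ?_, ?_⟩
  · rw [Finsupp.smul_apply, hD P hP, smul_eq_mul, Finset.mul_sum]
    exact Finset.sum_congr rfl fun i _ => by ring
  · rw [Finset.mul_sum]
    exact Finset.sum_congr rfl fun i _ => by ring

theorem HasPullbackCoeff.add {D D' : V.RDiv} {c c' : ℝ} (h : B.HasPullbackCoeff D c)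
    (h' : B.HasPullbackCoeff D' c') : B.HasPullbackCoeff (D + D') (c + c') := by
  obtain ⟨U, N, r, f, hU, hf, hD, rfl⟩ := h
  obtain ⟨U', N', r', f', hU', hf', hD', rfl⟩ := h'
  refine ⟨U ⊓ U', N + N', Fin.append r r', Fin.append f f', ⟨hU, hU'⟩, fun i => ?_,
    fun P hP => ?_, ?_⟩
  · refine Fin.addCases (fun j => ?_) (fun j => ?_) i
    · rw [Fin.append_left]; exact hf j
    · rw [Fin.append_right]; exact hf' j
  · rw [Finsupp.add_apply, hD P hP.1, hD' P hP.2, Fin.sum_univ_add]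
    simp
  · rw [Fin.sum_univ_add]
    simp

/-- A divisor that is effective near the center has nonnegative pullback. -/
theorem HasPullbackCoeff.nonneg [V.IsNormal] {x : V.X} (hBx : B.centerPoint = x)
    (hB : ∀ a : V.X.presheaf.stalk x, a ≠ 0 →
      0 ≤ B.Y.ord (B.pullback (algebraMap _ V.K a)) B.E)
    {D : V.RDiv} {c : ℝ} (h : B.HasPullbackCoeff D c)
    (hD : ∀ P : V.PrimeDivisor, P.1 ⤳ x → 0 ≤ D P) : 0 ≤ c := by
  obtain ⟨U, N, r, f, hU, hf, hDP, rfl⟩ := h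
  rw [hBx] at hU
  let S : Set V.PrimeDivisor := {P | P.1 ⤳ x ∧ ∃ i, V.ord (f i) P ≠ 0}
  have hS : S.Finite := by
    refine (Set.finite_iUnion fun i => V.finite_setOf_ord_ne_zero (hf i)).subset ?_
    rintro P ⟨-, i, hi⟩
    exact Set.mem_iUnion.mpr ⟨i, hi⟩
  have : Finite S := hS
  -- The real exponents are replaced by integers `q` satisfying the same inequalities. Only the
  -- finitely many prime divisors through `x` in `S` impose a condition.
  refine sum_mul_nonneg_of_forall_int (fun (P : S) i => V.ord (f i) P)
    (fun i => B.Y.ord (B.pullback (f i)) B.E) (fun q hq => ?_) r (fun P => ?_)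
  · have hg0 : ∏ i, f i ^ q i ≠ 0 := Finset.prod_ne_zero_iff.mpr fun i _ => zpow_ne_zero _ (hf i)
    -- For integral exponents the product is a genuine rational function without poles through `x`,
    -- hence regular at `x` and of nonnegative order along `E`.
    obtain ⟨a, ha⟩ := mem_range_algebraMap_of_ord_nonneg x (∏ i, f i ^ q i) fun P hP => by
      rw [V.ord_prod_zpow _ _ hf]
      by_cases hPS : P ∈ S
      · exact hq ⟨P, hPS⟩
      · refine Finset.sum_nonneg fun i _ => ?_
        have : V.ord (f i) P = 0 := by
          by_contra h0
          exact hPS ⟨hP, i, h0⟩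
        rw [this, mul_zero]
    have h1 := hB a (by rintro rfl; exact hg0 (by rw [← ha, map_zero]))
    rw [ha, map_prod] at h1
    simp only [map_zpow₀] at h1
    rwa [B.Y.ord_prod_zpow _ _ fun i => B.pullback_ne_zero (hf i)] at h1
  · rw [← hDP P.1 (P.2.1.mem_open U.2 hU)]
    exact hD _ P.2.1

theorem pullback_algebraMap (c : k) :
    B.pullback (algebraMap k V.K c) = algebraMap k B.Y.K c := by
  have h1 : B.Y.constants c = B.f.appTop (V.constants c) := by
    simp only [constants, ← B.comp_str, Scheme.Hom.comp_appTop]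
    rfl
  have h2 : algebraMap k B.Y.K c = B.Y.X.presheaf.germ ⊤ _ trivial (B.Y.constants c) := rfl
  rw [h2, h1]
  have h3 := Scheme.Hom.germ_stalkMap_apply B.f ⊤ (genericPoint B.Y.X) trivial (V.constants c)
  refine Eq.trans ?_ h3
  refine congrArg (B.f.stalkMap (genericPoint B.Y.X)) ?_
  exact V.X.presheaf.germ_stalkSpecializes_apply _ (specializes_of_eq B.map_genericPoint) _

/-- Expansion of differentials is compatible with pullback. -/
theorem D_pullback {ι : Type*} [Fintype ι] (f : V.K) (a : ι → V.K) (s : ι → V.K)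
    (h : KaehlerDifferential.D k V.K f = ∑ j, a j • KaehlerDifferential.D k V.K (s j)) :
    KaehlerDifferential.D k B.Y.K (B.pullback f) =
      ∑ j, B.pullback (a j) • KaehlerDifferential.D k B.Y.K (B.pullback (s j)) := by
  let _ : Algebra V.K B.Y.K := B.pullback.toAlgebra
  have : IsScalarTower k V.K B.Y.K :=
    IsScalarTower.of_algebraMap_eq fun c => (B.pullback_algebraMap c).symm
  have h1 := congrArg (KaehlerDifferential.map k k V.K B.Y.K) h
  rw [KaehlerDifferential.map_D, map_sum] at h1
  refine h1.trans (Finset.sum_congr rfl fun j _ => ?_)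
  rw [map_smul, KaehlerDifferential.map_D]
  exact algebraMap_smul B.Y.K (a j) _ |>.symm

end DivisorOver

theorem exists_eq_sum_smul_of_span {R M : Type*} [Semiring R] [AddCommMonoid M] [Module R M]
    {n : ℕ} {s : Fin n → M} (hs : Submodule.span R (Set.range s) = ⊤) (m : M) :
    ∃ a : Fin n → R, m = ∑ j, a j • s j := by
  have : m ∈ Submodule.span R (Set.range s) := hs ▸ Submodule.mem_top
  obtain ⟨a, ha⟩ := (Submodule.mem_span_range_iff_exists_fun R).mp this
  exact ⟨a, ha.symm⟩

/-- Comparison of a rational form with the form of a system of coordinates. -/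
theorem RationalForm.exists_eq_smul_wedge {n : ℕ} (ω : V.RationalForm n) {τ : Fin n → V.K}
    (hτ : Submodule.span V.K (Set.range fun i => KaehlerDifferential.D k V.K (τ i)) = ⊤) :
    ∃ h : V.K, h ≠ 0 ∧ ω.g • V.wedge ω.t = h • V.wedge τ ∧
      ∀ (B : V.DivisorOver) (m : ℤ), B.Y.HasFormOrd 1 (fun i => B.pullback (τ i)) B.E m →
        B.Y.HasFormOrd (B.pullback ω.g) (fun i => B.pullback (ω.t i)) B.E
          (m + B.Y.ord (B.pullback h) B.E) := by
  choose A hA using fun i => exists_eq_sum_smul_of_span hτ (KaehlerDifferential.D k V.K (ω.t i))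
  have h1 := V.wedge_eq_det_smul (Matrix.of A) τ ω.t hA
  have hne : ω.g * (Matrix.of A).det ≠ 0 := fun h => ω.ne_zero (by rw [h1, smul_smul, h, zero_smul])
  refine ⟨ω.g * (Matrix.of A).det, hne, by rw [h1, smul_smul], fun B m hm => ?_⟩
  obtain ⟨s, h, hli, hspan, hh, hw, hord⟩ := hm
  have h2 := B.Y.wedge_eq_det_smul (B.pullback.mapMatrix (Matrix.of A)) (fun i => B.pullback (τ i))
    (fun i => B.pullback (ω.t i)) fun i => B.D_pullback _ _ _ (hA i)
  rw [← RingHom.map_det] at h2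
  refine ⟨s, B.pullback (ω.g * (Matrix.of A).det) * h, hli, hspan,
    mul_ne_zero (B.pullback_ne_zero hne) hh, ?_, ?_⟩
  · rw [h2, mul_smul, ← hw, one_smul, smul_smul, map_mul]
  · rw [B.Y.ord_mul (B.pullback_ne_zero hne) hh, hord, add_comm]

/-- The order of a form is at least that of its coefficient with respect to regular functions. -/
theorem HasFormOrd.le [V.IsNormal] {n : ℕ} {g : V.K} {t : Fin n → V.K} {P : V.PrimeDivisor} {m : ℤ}
    (h : V.HasFormOrd g t P m) (τ : Fin n → V.X.presheaf.stalk P.1) {f : V.K} (hf : f ≠ 0)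
    (hg : g • V.wedge t ≠ 0)
    (hgf : g • V.wedge t = f • V.wedge (fun i => algebraMap _ V.K (τ i))) : V.ord f P ≤ m := by
  obtain ⟨s, h, hli, hspan, hh, hw, rfl⟩ := h
  choose A hA using fun i => exists_eq_sum_smul_of_span hspan
    (KaehlerDifferential.D k (V.X.presheaf.stalk P.1) (τ i))
  have h1 := V.wedge_eq_det_smul ((algebraMap _ V.K).mapMatrix (Matrix.of A))
    (fun i => algebraMap _ V.K (s i)) (fun i => algebraMap _ V.K (τ i)) fun i => by
      have h2 := congrArg (KaehlerDifferential.map k k (V.X.presheaf.stalk P.1) V.K) (hA i)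
      rw [KaehlerDifferential.map_D, map_sum] at h2
      refine h2.trans (Finset.sum_congr rfl fun j _ => ?_)
      rw [map_smul, KaehlerDifferential.map_D]
      exact algebraMap_smul V.K (A i j) _ |>.symm
  rw [← RingHom.map_det] at h1
  rw [hgf] at hw hg
  rw [h1, smul_smul] at hw hg
  -- The two coefficients differ by the determinant expressing the `dτ i` in the basis `ds j`. It is
  -- regular at `P`, so it can only increase the order.
  have h3 : f * algebraMap _ V.K (Matrix.of A).det = h :=
    smul_left_injective V.K (right_ne_zero_of_smul hg) hw
  have h4 : algebraMap _ V.K (Matrix.of A).det ≠ 0 := right_ne_zero_of_mul (h3 ▸ hh)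
  rw [← h3, V.ord_mul hf h4]
  have := (V.ord_nonneg_iff h4 P).mpr ⟨_, rfl⟩
  linarith

end Variety

/-! ### Sections vanishing to high order -/

/-- The binomial coefficient is at most `(n + M n + W) ^ n / n!`. After multiplication by `n! / M ^
n` this tends to `n ^ n`, so the fixed shift `W` does not matter, while the limsup exceeds `n ^ n`
for arbitrarily large `M`. -/
theorem exists_choose_lt_of_lt_limsup (h : ℕ → ℕ) (n W : ℕ)
    (hlim : (((n : ℝ) ^ n : ℝ) : EReal) < Filter.limsup (fun m : ℕ =>
      (((n.factorial : ℝ) * (h m : ℝ) / (m : ℝ) ^ n : ℝ) : EReal)) Filter.atTop) :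
    ∃ M : ℕ, 0 < M ∧ (n + (M * n + W)).choose n < h M := by
  obtain ⟨c, hc1, hc2⟩ := EReal.lt_iff_exists_real_btwn.mp hlim
  rw [EReal.coe_lt_coe_iff] at hc1
  have hfreq := Filter.frequently_lt_of_lt_limsup (by isBoundedDefault) hc2
  have htend : Filter.Tendsto (fun M : ℕ => ((n : ℝ) + ((n : ℝ) + W) / (M : ℝ)) ^ n) Filter.atTop
      (nhds ((n : ℝ) ^ n)) := by
    have h1 := (tendsto_const_div_atTop_nhds_zero_nat ((n : ℝ) + W)).const_add (n : ℝ)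
    rw [add_zero] at h1
    exact h1.pow n
  have hev := htend.eventually_lt_const hc1
  obtain ⟨M, hM1, hM2, hM0⟩ :=
    (hfreq.and_eventually (hev.and (Filter.eventually_gt_atTop 0))).exists
  refine ⟨M, hM0, ?_⟩
  rw [EReal.coe_lt_coe_iff] at hM1
  have hM : (0 : ℝ) < M := by exact_mod_cast hM0
  have hfac : (0 : ℝ) < n.factorial := by exact_mod_cast n.factorial_pos
  have h2 := hM2.trans hM1
  rw [lt_div_iff₀ (pow_pos hM n), ← mul_pow, add_mul, div_mul_cancel₀ _ hM.ne'] at h2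
  have h3 : (((n + (M * n + W)).choose n : ℕ) : ℝ) ≤ _ := Nat.choose_le_pow_div (α := ℝ) n _
  have h4 : (((n + (M * n + W)).choose n : ℕ) : ℝ) < h M := by
    refine h3.trans_lt ?_
    rw [div_lt_iff₀ hfac, mul_comm (h M : ℝ)]
    refine lt_of_eq_of_lt ?_ h2
    push_cast
    ring
  exact_mod_cast h4

namespace Variety

variable {k : Type u} [Field k] {V : Variety k} [V.IsNormal]

/-- If some local ring at a closed point is a field, the volume of a divisor is too small. -/
theorem vol_le_of_maximalIdeal_eq_bot {x : V.X}
    (hk : ∀ a : V.X.presheaf.stalk x, ∃ c : k, a - algebraMap k _ c ∈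
      IsLocalRing.maximalIdeal (V.X.presheaf.stalk x))
    (hm : IsLocalRing.maximalIdeal (V.X.presheaf.stalk x) = ⊥) (n : ℕ) (D : V.RDiv) :
    V.vol n D ≤ (((n : ℝ) ^ n : ℝ) : EReal) := by
  -- A local ring with zero maximal ideal and residue field `k` is `k`, and so is its fraction
  -- field. Every space of sections then has dimension at most one, and `n! ≤ n ^ n` (also for `n =
  -- 0`) concludes.
  have hsurj : Function.Surjective (algebraMap k V.K) := by
    have hO : ∀ a : V.X.presheaf.stalk x, ∃ c : k, algebraMap k V.K c = algebraMap _ V.K a := by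
      intro a
      obtain ⟨c, hc⟩ := hk a
      rw [hm, Ideal.mem_bot, sub_eq_zero] at hc
      exact ⟨c, by rw [hc, ← IsScalarTower.algebraMap_apply]⟩
    intro f
    obtain ⟨a, b, -, rfl⟩ := IsFractionRing.div_surjective (A := V.X.presheaf.stalk x) f
    obtain ⟨c, hc⟩ := hO a
    obtain ⟨c', hc'⟩ := hO b
    exact ⟨c / c', by rw [map_div₀, hc, hc']⟩
  have hfin : Module.Finite k V.K :=
    Module.Finite.of_surjective (Algebra.linearMap k V.K) hsurj
  have hrank : ∀ S : Submodule k V.K, Module.finrank k S ≤ 1 := fun S => by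
    refine (Submodule.finrank_le S).trans ?_
    exact finrank_le_one (1 : V.K) fun f => (hsurj f).imp fun c hc => by
      rw [Algebra.smul_def, mul_one, hc]
  refine Filter.limsup_le_of_le (by isBoundedDefault) ?_
  filter_upwards [Filter.eventually_ge_atTop 1] with m hm1
  rw [EReal.coe_le_coe_iff]
  have hm2 : (1 : ℝ) ≤ (m : ℝ) ^ n := one_le_pow₀ (by exact_mod_cast hm1)
  have h1 : (Module.finrank k (V.sections ((m : ℝ) • D)) : ℝ) ≤ 1 := by exact_mod_cast hrank _
  have h2 : (n.factorial : ℝ) ≤ (n : ℝ) ^ n := by exact_mod_cast n.factorial_le_pow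
  have h3 : (0 : ℝ) ≤ n.factorial := by positivity
  calc (n.factorial : ℝ) * (Module.finrank k (V.sections ((m : ℝ) • D)) : ℝ) / (m : ℝ) ^ n
      ≤ (n.factorial : ℝ) * (Module.finrank k (V.sections ((m : ℝ) • D)) : ℝ) :=
        div_le_self (by positivity) hm2
    _ ≤ n.factorial := mul_le_of_le_one_right h3 h1
    _ ≤ (n : ℝ) ^ n := h2

/-- A divisor of large volume has a section of a multiple that vanishes to high order. -/
theorem exists_section_of_lt_vol {x : V.X} {n : ℕ} {t : Fin n → V.X.presheaf.stalk x}
    (hm : IsLocalRing.maximalIdeal (V.X.presheaf.stalk x) = Ideal.span (Set.range t))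
    (hk : ∀ a : V.X.presheaf.stalk x, ∃ c : k, a - algebraMap k _ c ∈
      IsLocalRing.maximalIdeal (V.X.presheaf.stalk x))
    {B : V.DivisorOver} (hBx : B.centerPoint = x)
    (hB : ∀ (r : ℕ) (a : V.X.presheaf.stalk x), a ≠ 0 →
      a ∈ IsLocalRing.maximalIdeal (V.X.presheaf.stalk x) ^ r →
      (r : ℤ) ≤ B.Y.ord (B.pullback (algebraMap _ V.K a)) B.E)
    {D : V.RDiv} (hD : V.IsRCartier D) (hvol : (((n : ℝ) ^ n : ℝ) : EReal) < V.vol n D) :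
    ∃ (M : ℕ) (f : V.K) (c : ℝ), 0 < M ∧ f ≠ 0 ∧ f ∈ V.sections ((M : ℝ) • D) ∧
      B.HasPullbackCoeff D c ∧
      (n : ℝ) ≤ c + (M : ℝ)⁻¹ * (B.Y.ord (B.pullback f) B.E : ℝ) := by
  obtain ⟨U, N, r, h, hxU, hh, hDP⟩ := hD.exists_eq_sum x
  have hne : ∀ c : V.X.presheaf.stalk x, c ≠ 0 → algebraMap _ V.K c ≠ 0 := fun c hc =>
    (map_ne_zero_iff _ (IsFractionRing.injective _ V.K)).mpr hc
  have hPord : ∀ (P : V.PrimeDivisor), P.1 ⤳ x → ∀ i, 0 ≤ V.ord (algebraMap _ V.K (h i)) P := by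
    intro P hP i
    refine (V.ord_nonneg_iff (hne _ (hh i)) P).mpr ⟨V.X.presheaf.stalkSpecializes hP (h i), ?_⟩
    exact ConcreteCategory.congr_hom (V.X.presheaf.stalkSpecializes_comp
      (V.genericPoint_specializes P.1) hP) (h i)
  set w : Fin N → ℤ := fun i => B.Y.ord (B.pullback (algebraMap _ V.K (h i))) B.E with hw
  have hw0 : ∀ i, 0 ≤ w i := fun i => by simpa using hB 0 (h i) (hh i) (by simp)
  -- `W` is the total order along `E` of the local equations: the most that rounding all exponents
  -- up can cost, uniformly in `M`.
  obtain ⟨W, hW⟩ := Int.eq_ofNat_of_zero_le (Finset.sum_nonneg fun i (_ : i ∈ Finset.univ) => hw0 i)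
  obtain ⟨M, hM0, hM⟩ := exists_choose_lt_of_lt_limsup _ n W hvol
  have hMpos : (0 : ℝ) < M := by exact_mod_cast hM0
  -- Rounding up makes `g` vanish at least as much as `⌊M D⌋` asks near `x`, because the `h i` are
  -- regular. So multiplication by `g` turns sections into functions regular at `x`.
  set q : Fin N → ℤ := fun i => ⌈(M : ℝ) * r i⌉ with hq
  set g : V.K := ∏ i, algebraMap _ V.K (h i) ^ q i with hg
  have hg0 : g ≠ 0 := Finset.prod_ne_zero_iff.mpr fun i _ => zpow_ne_zero _ (hne _ (hh i))
  have hreg : ∀ f ∈ V.sections ((M : ℝ) • D),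
      ∃ a : V.X.presheaf.stalk x, algebraMap _ V.K a = g * f := by
    rintro f (rfl | hf)
    · exact ⟨0, by simp⟩
    by_cases hf0 : f = 0
    · exact ⟨0, by simp [hf0]⟩
    refine mem_range_algebraMap_of_ord_nonneg x _ fun P hP => ?_
    have h1 := hf P
    have h2 : (⌊((M : ℝ) • D) P⌋ : ℤ) ≤ ∑ i, q i * V.ord (algebraMap _ V.K (h i)) P := by
      have h3 : ((⌊((M : ℝ) • D) P⌋ : ℤ) : ℝ) ≤
          ((∑ i, q i * V.ord (algebraMap _ V.K (h i)) P : ℤ) : ℝ) := by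
        refine (Int.floor_le _).trans ?_
        rw [Finsupp.smul_apply, hDP P (hP.mem_open U.2 hxU), smul_eq_mul, Finset.mul_sum]
        push_cast
        refine Finset.sum_le_sum fun i _ => ?_
        rw [← mul_assoc]
        exact mul_le_mul_of_nonneg_right (Int.le_ceil _) (by exact_mod_cast hPord P hP i)
      exact_mod_cast h3
    rw [V.ord_mul hg0 hf0, hg, V.ord_prod_zpow _ _ fun i => hne _ (hh i)]
    linarith
  let ψ : V.X.presheaf.stalk x →ₗ[k] V.K :=
    (IsScalarTower.toAlgHom k (V.X.presheaf.stalk x) V.K).toLinearMap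
  have hψ : Function.Injective ψ := IsFractionRing.injective (V.X.presheaf.stalk x) V.K
  let φ : V.sections ((M : ℝ) • D) →ₗ[k] V.X.presheaf.stalk x :=
    (LinearEquiv.ofInjective ψ hψ).symm.toLinearMap ∘ₗ
      ((LinearMap.mulLeft k g ∘ₗ (V.sections ((M : ℝ) • D)).subtype).codRestrict
        (LinearMap.range ψ) fun f => hreg f f.2)
  have hφ : ∀ f, algebraMap _ V.K (φ f) = g * (f : V.K) := fun f =>
    congrArg Subtype.val ((LinearEquiv.ofInjective ψ hψ).apply_symm_apply _)
  obtain ⟨f, hf0, hfm⟩ := exists_ne_zero_mem_pow_of_choose_lt t _ hm hk φ (M * n + W) hM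
  have hf0' : (f : V.K) ≠ 0 := fun h0 => hf0 (Subtype.ext h0)
  have hφf : φ f ≠ 0 := fun h0 => by
    have := hφ f
    rw [h0, map_zero] at this
    exact mul_ne_zero hg0 hf0' this.symm
  refine ⟨M, f, ∑ i, r i * (w i : ℝ), hM0, hf0', f.2,
    ⟨U, N, r, fun i => algebraMap _ V.K (h i), hBx ▸ hxU, fun i => hne _ (hh i), hDP, rfl⟩, ?_⟩
  have h1 := hB _ _ hφf hfm
  rw [hφ, map_mul, B.Y.ord_mul (B.pullback_ne_zero hg0) (B.pullback_ne_zero hf0'), hg, map_prod]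
    at h1
  simp only [map_zpow₀] at h1
  rw [B.Y.ord_prod_zpow _ _ fun i => B.pullback_ne_zero (hne _ (hh i))] at h1
  -- Each rounding adds at most one to an exponent, so `g` has order at most `M` times the pullback
  -- coefficient of `D`, plus `W`. Subtracting it from the order of `g * f` leaves at least `M * n`.
  have h2 : ((∑ i, q i * w i : ℤ) : ℝ) ≤ M * ∑ i, r i * (w i : ℝ) + W := by
    have h3 : ((∑ i, w i : ℤ) : ℝ) = W := by rw [hW]; simp
    rw [← h3]
    push_cast
    rw [Finset.mul_sum, ← Finset.sum_add_distrib]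
    refine Finset.sum_le_sum fun i _ => ?_
    have h4 : (q i : ℝ) ≤ M * r i + 1 := (Int.ceil_lt_add_one _).le
    have h5 : (0 : ℝ) ≤ w i := by exact_mod_cast hw0 i
    nlinarith [mul_le_mul_of_nonneg_right h4 h5]
  have h6 : (((M * n + W + 1 : ℕ) : ℤ) : ℝ) ≤
      ((∑ i, q i * w i + B.Y.ord (B.pullback f) B.E : ℤ) : ℝ) := by exact_mod_cast h1
  have h7 : (M : ℝ) * n ≤ M * ∑ i, r i * (w i : ℝ) + B.Y.ord (B.pullback f) B.E := by
    push_cast at h6 h2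
    linarith
  have h8 := mul_le_mul_of_nonneg_left h7 (inv_nonneg.mpr hMpos.le)
  rw [mul_add, inv_mul_cancel_left₀ hMpos.ne', inv_mul_cancel_left₀ hMpos.ne'] at h8
  exact h8

end Variety

/-! ### The discrepancy of the exceptional divisor -/

namespace Variety

variable {k : Type u} [Field k] {V : Variety k} [V.IsNormal]

/-- The order of the canonical divisor along the exceptional divisor of the blow-up of a smooth
closed point, and the lower bound for the pullback of `K_V + Δ`. -/
theorem IsDivOfForm.exists_hasFormOrd_blowup {n d : ℕ} (hn : n = d + 1) {ω : V.RationalForm n}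
    {C Δ : V.RDiv} (hC : V.IsDivOfForm ω C) (hΔ : ∀ P, 0 ≤ Δ P) {x : V.X}
    {t : Fin n → V.X.presheaf.stalk x}
    (hspan : Submodule.span (V.X.presheaf.stalk x)
      (Set.range fun i => KaehlerDifferential.D k (V.X.presheaf.stalk x) (t i)) = ⊤)
    {B : V.DivisorOver} (hBx : B.centerPoint = x)
    (hB : ∀ a : V.X.presheaf.stalk x, a ≠ 0 →
      0 ≤ B.Y.ord (B.pullback (algebraMap _ V.K a)) B.E)
    (hform : B.Y.HasFormOrd 1 (fun i => B.pullback (algebraMap _ V.K (t i))) B.E d)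
    {c : ℝ} (hc : B.HasPullbackCoeff (C + Δ) c) :
    ∃ m : ℤ, B.Y.HasFormOrd (B.pullback ω.g) (fun i => B.pullback (ω.t i)) B.E m ∧
      (m : ℝ) ≤ n - 1 + c := by
  obtain ⟨h, hh, hω, hpb⟩ := ω.exists_eq_smul_wedge (span_D_algebraMap_eq_top (K := V.K) hspan)
  refine ⟨_, hpb B d hform, ?_⟩
  -- Here `h` is the coefficient of `ω` in the coordinates at `x`, so `C - div h` is effective near
  -- `x`, and so is its sum with `Δ`. Positivity of the pullback bounds the order of `h` along `E`
  -- by `c`.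
  have h1 := hc.add ((B.hasPullbackCoeff_principal hh).smul (-1))
  have h2 := h1.nonneg hBx hB fun P hP => by
    obtain ⟨m, hm, hCP⟩ := hC P
    have h3 : V.ord h P ≤ m := by
      refine hm.le (fun i => V.X.presheaf.stalkSpecializes hP (t i)) hh ω.ne_zero ?_
      rw [hω]
      congr 2
      funext i
      exact (ConcreteCategory.congr_hom (V.X.presheaf.stalkSpecializes_comp
        (V.genericPoint_specializes P.1) hP) (t i)).symm
    have h4 : (V.ord h P : ℝ) ≤ m := by exact_mod_cast h3
    have h5 := hΔ P
    simp only [Finsupp.add_apply, Finsupp.smul_apply, principal_apply, smul_eq_mul]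
    linarith
  subst hn
  push_cast
  linarith

end Variety

end BirGeom

end

/-! ### The main theorem -/

open BirGeom
theorem mainTheorem9 {k : Type u} [Field k] [IsAlgClosed k]
    (X : Variety k) [X.IsNormal] (hproj : X.IsProjective)
    (n : ℕ) (hdim : topologicalKrullDim X.X = n)
    (Δ : X.RDiv) (hΔ : X.IsLogPair n Δ)
    (D : X.RDiv) (hD : X.IsRCartier D)
    (hvol : (((n : ℝ) ^ n : ℝ) : EReal) < X.vol n D)
    (x : X.X) (hx : IsClosed {x}) (hsm : X.IsSmoothAt x) :
    ∃ Θ : X.RDiv, 0 ≤ Θ ∧ X.IsRCartier Θ ∧ X.RLinEquiv Θ D ∧ X.PassesThrough Θ x ∧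
      ¬ X.IsKltAt n (Δ + Θ) x := by
  have hfs := X.formallySmooth_stalk hsm
  have heft := X.essFiniteType_stalk x
  have hk := fun a => X.exists_sub_algebraMap_mem_maximalIdeal hx a
  -- The large volume excludes a point variety. This provides a prime divisor and makes `n`
  -- positive.
  have hm0 : IsLocalRing.maximalIdeal (X.X.presheaf.stalk x) ≠ ⊥ := fun h =>
    (Variety.vol_le_of_maximalIdeal_eq_bot hk h n D).not_gt hvol
  obtain ⟨hΔ0, ω, C, hC, hCΔ⟩ := hΔ
  obtain ⟨e, t, htm, hli, hspan⟩ := exists_coordinates (k := k) hk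
  have hm := maximalIdeal_eq_span_of_span_D hk htm hspan
  obtain ⟨P, -⟩ := Variety.exists_primeDivisor_specializes x hm0
  obtain ⟨-, ⟨s, -, hsli, hsspan, -⟩, -⟩ := hC P
  -- Both the coordinates at `x` and the frame along `P` defining the order of `ω` become bases of
  -- the differentials of the function field.
  obtain rfl : e = n := by
    rw [← finrank_kaehlerDifferential_eq (K := X.K) hli hspan,
      ← finrank_kaehlerDifferential_eq (K := X.K) hsli hsspan]
  obtain ⟨d, hd⟩ : ∃ d, e = d + 1 := by
    refine Nat.exists_eq_succ_of_ne_zero fun h0 => hm0 ?_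
    subst h0
    rw [hm, Set.range_eq_empty, Ideal.span_empty]
  obtain ⟨B, hBx, hBr, hBform⟩ : ∃ B : X.DivisorOver, B.centerPoint = x ∧
      (∀ (r : ℕ) (a : X.X.presheaf.stalk x), a ≠ 0 →
        a ∈ IsLocalRing.maximalIdeal (X.X.presheaf.stalk x) ^ r →
        (r : ℤ) ≤ B.Y.ord (B.pullback (algebraMap _ X.K a)) B.E) ∧
      B.Y.HasFormOrd 1 (fun i => B.pullback (algebraMap _ X.K (t i))) B.E d := by
    subst hd
    exact X.exists_blowup_divisor hx hsm hm hli hspan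
  have hB0 : ∀ a : X.X.presheaf.stalk x, a ≠ 0 →
      0 ≤ B.Y.ord (B.pullback (algebraMap _ X.K a)) B.E := fun a ha => by
    simpa using hBr 0 a ha (by simp)
  obtain ⟨M, f, c, hM0, hf0, hf, hc, hnc⟩ :=
    Variety.exists_section_of_lt_vol hm hk hBx hBr hD hvol
  have hM : (0 : ℝ) < M := by exact_mod_cast hM0
  have hΘ := hc.add ((B.hasPullbackCoeff_principal hf0).smul (M : ℝ)⁻¹)
  refine ⟨D + (M : ℝ)⁻¹ • X.principal hf0, ?_, ?_, ?_, ?_, ?_⟩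
  · intro P
    have h1 := (hf.resolve_left hf0) P
    have h2 := Int.floor_le (((M : ℝ) • D) P)
    have h3 : (0 : ℝ) ≤ X.ord f P + ⌊((M : ℝ) • D) P⌋ := by exact_mod_cast h1
    rw [Finsupp.smul_apply, smul_eq_mul] at h2 h3
    have h4 : 0 ≤ (M : ℝ)⁻¹ * (X.ord f P + M * D P) :=
      mul_nonneg (inv_nonneg.mpr hM.le) (by linarith)
    rw [mul_add, inv_mul_cancel_left₀ hM.ne'] at h4
    simp only [Finsupp.coe_zero, Pi.zero_apply, Finsupp.add_apply, Finsupp.smul_apply,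
      Variety.principal_apply, smul_eq_mul]
    linarith
  · exact add_mem hD (Submodule.smul_mem _ _
      (Submodule.subset_span (X.isPrincipal_principal hf0).isCartier))
  · rw [Variety.RLinEquiv, add_sub_cancel_left]
    exact Submodule.smul_mem _ _ (Submodule.subset_span (X.isPrincipal_principal hf0))
  · by_contra hcon
    -- If `x` were outside the support, the negative of the divisor would also be effective near
    -- `x`, and the coefficient along `E` would be at most zero. It is at least `n ≥ 1`.
    have h1 := (hΘ.smul (-1)).nonneg hBx hB0 fun P hP => by
      have h2 : (D + (M : ℝ)⁻¹ • X.principal hf0) P = 0 := by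
        by_contra h3
        exact hcon ⟨P, h3, specializes_iff_mem_closure.mp hP⟩
      rw [Finsupp.smul_apply, h2, smul_zero]
    have h3 : (1 : ℝ) ≤ e := by
      rw [hd]; push_cast; linarith [(Nat.cast_nonneg d : (0 : ℝ) ≤ d)]
    linarith
  · intro hklt
    obtain ⟨U, N, r, h, hxU, hh, hP⟩ := hCΔ.exists_eq_sum x
    have hcoef : B.HasPullbackCoeff (C + Δ) _ :=
      ⟨U, N, r, fun i => algebraMap _ X.K (h i), hBx ▸ hxU, fun i =>
        (map_ne_zero_iff _ (IsFractionRing.injective _ X.K)).mpr (hh i), hP, rfl⟩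
    -- The pair alone has discrepancy at most `n - 1` along `E`, and the new divisor takes away at
    -- least `n`.
    obtain ⟨m, hmform, hmle⟩ :=
      hC.exists_hasFormOrd_blowup hd (fun P => (hΔ0 P).1) hspan hBx hB0 hBform hcoef
    have h1 := hklt B _ (hBx ▸ subset_closure rfl)
      ⟨ω, C, m, _, hC, hmform, by rw [← add_assoc]; exact hcoef.add hΘ, rfl⟩
    linarith
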